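/- **Setting.** Fix integers $n>0$, $N'>n$ and $N\ge N'+n$; $B(x,r)$ is an open ball and $R$ always denotes an isometry of $\mathbb R^N$. *Cones.* For a finite set $X$ of $k$ unit vectors of $\mathbb R^{N'}$ with $\{0\}\cup X$ affinely independent put $C(X)=\{tx: t\ge 0,\ x\in \operatorname{conv}X\}$, and $C(\emptyset)=\{0\}$. A complex cone of dimension $k$ is a finite nonempty union $T=\bigcup_i C(X_i)$ of such sets with $\#X_i=k$ such that $C(X)\cap C(Y)=C(X\cap Y)$ for all $X,Y\in\Omega_T=\{Y: Y\subset X_i\text{ for some } i\}$. It is non-flat if, whenever $Z_1,Z_2\in\Omega_T$, $\#Z_1=\#Z_2=t+1$, $Y=Z_1\cap Z_2$ and $\#Y=t<k$, the supremum of the angles $\angle f_1 z f_2$ is $<\pi$, over all $z\in C(Y)$ and $f_j\in C(Z_j)\setminus C(Y)$ with $|f_j-z|=\operatorname{dist}(f_j,C(Y))$, $j=1,2$. *Sets of type $m$.* For $0\le m\le n$, a set of type $m$ is a set $W=R(T\times\mathbb R^m\times\{0\})\subset\mathbb R^N$ with $T\subset\mathbb R^{N'}$ a non-flat complex cone of dimension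 $n-m$. Its spines are $L^{k}(W)=R\big(\bigcup_{Y\in\Omega_T,\#Y=k-m}C(Y)\times\mathbb R^m\times\{0\}\big)$ for $m\le k\le n$, and $L^k(W)=\emptyset$ for $k<m$. *Blow-ups.* Let $\mathscr B$ be a collection of sets, each of some type $m\in\{0,\dots,n\}$, that is finite modulo isometries of $\mathbb R^N$. Let $\mathscr A=\mathscr A(\mathscr B)$ be the collection of all isometric images of the blow-up limits $\{cy: c\ge 0,\ y\in W\cap B(x,r)-x\}$ ($r>0$ small) of sets $W\in\mathscr B$ at points $x\in W$, and let $\mathscr A(m)$ be the collection of the sets of type $m$ in $\mathscr A$. *Distances.* Let $d_{x,r}(F,G)=\frac1r\max\{\sup_{z\in G\cap B(x,r)}\operatorname{dist}(z,F),\ \sup_{z\in F\cap B(x,r)}\operatorname{dist}(z,G)\}$. *Constants.* Call $(n_0,\delta_0)$ with $n_0>10$ and $0<\delta_0<1/10$ admissible if for all $0\le m\le t\le n-1$: - (i) if $V\in\mathscr A(m)$, $x\in L^t(V)$, $W\in\bigcup_{k>t}\mathscr A(k)$ and $r>0$, then $d_{x,r}(V,W)>\delta_0$; - (ii) if $W\in\mathscr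 A(m)$ and $B=B(x,r)$ is a ball that meets $W$ such that $B(x,n_0r)\cap L^t(W)=\emptyset$, then $W\cap B=Y\cap B$ for some $Y\in\bigcup_{u>t}\mathscr A(u)$; and if $W\in\mathscr A(m)$ coincides in a ball $B(x,r)$ with no set of $\mathscr A(t+1)$, then $B(x,n_0r)\cap L^t(W)\neq\emptyset$. *Strata.* For a closed set $E\subset\mathbb R^N$, put $a_m(x,r)=\inf\{d_{x,r}(E,W): W\in\mathscr A(m),\ x\in L^m(W)\}$ (with $\inf\emptyset=\infty$) and let $E_m$ be the set of $x\in E\cap B(0,2)$ for which there is $r_x>0$ with $a_m(x,r)<C_0\varepsilon$ for all $0<r<r_x$, where $C_0=10^8(n_0+n)^{3n}n_0/\delta_0$. **Statement.** Admissible constants $(n_0,\delta_0)$ exist. For every admissible pair, there is $\varepsilon_0>0$ (depending only on $n,N',N,\mathscr B,n_0,\delta_0$) such that the following holds for every $\varepsilon<\varepsilon_0$ and every closed set $E\subset\mathbb R^N$ containing the origin. Suppose that for all $x\in E$ and $r>0$ there is $Z(x,r)\in\mathscr A$ with $x\in Z(x,r)$ and $d_{x,r}(E,Z(x,r))<\varepsilon$.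 Then 1. for every $0\le m\le n$, the set $\bigcup_{t=0}^m E_t$ is closed in $\overline{B(0,1.989)}$, that is, $\big(\bigcup_{t=0}^m E_t\big)\cap\overline{B(0,1.989)}$ is closed; 2. for every $0\le m<n$, $E_m\cap\overline{B(0,1.988)}\subset\overline{E_{m+1}}$. -/

import Mathlib

open scoped ENNReal

namespace ConeStrata

/-- Euclidean space `ℝ^d` with its Euclidean norm. -/
abbrev Euc (d : ℕ) : Type := EuclideanSpace ℝ (Fin d)

/-! ### Simple cones, complex cones, the non-flat condition -/

/-- `C(X) = {t x : t ≥ 0, x ∈ conv X}`, with the convention `C(∅) = {0}`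
(for nonempty `X` the point `0` is in the second set already). -/
def coneOver {d : ℕ} (X : Set (Euc d)) : Set (Euc d) :=
  insert 0 {y | ∃ t : ℝ, 0 ≤ t ∧ ∃ x ∈ convexHull ℝ X, y = t • x}

/-- `X` consists of `k` unit vectors and `{0} ∪ X` is affinely independent,
so that `C(X)` is a simple cone of dimension `k`. -/
def IsSimpleFrame {d : ℕ} (k : ℕ) (X : Finset (Euc d)) : Prop :=
  X.card = k ∧ (∀ x ∈ X, ‖x‖ = 1) ∧
    AffineIndependent ℝ (Subtype.val : (insert 0 (X : Set (Euc d)) : Set (Euc d)) → Euc d)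

/-- `Ω_T`: the subsets of the generating sets `X_i` of `T = ⋃ i, C(X_i)`. -/
def Omega {d : ℕ} (𝒳 : Finset (Finset (Euc d))) : Set (Finset (Euc d)) :=
  {Y | ∃ X ∈ 𝒳, Y ⊆ X}

/-- The finite nonempty family `𝒳 = {X_1, …, X_k}` presents the complex cone `⋃ i, C(X_i)`
of dimension `k`: faces meet exactly along common faces. -/
def IsComplexCone {d : ℕ} (k : ℕ) (𝒳 : Finset (Finset (Euc d))) : Prop :=
  𝒳.Nonempty ∧ (∀ X ∈ 𝒳, IsSimpleFrame k X) ∧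
    ∀ X ∈ Omega 𝒳, ∀ Y ∈ Omega 𝒳,
      coneOver (X : Set (Euc d)) ∩ coneOver (Y : Set (Euc d)) =
        coneOver ((X : Set (Euc d)) ∩ (Y : Set (Euc d)))

/-- The set of angles `∠(F₁, F₂)`: angles `∠ f₁ z f₂` with `z ∈ C(F₁ ∩ F₂)`,
`f_j ∈ C(F_j) \ C(F₁ ∩ F₂)`, and `z` a nearest point of `C(F₁ ∩ F₂)` to `f_j`. -/
def faceAngles {d : ℕ} (F₁ F₂ : Set (Euc d)) : Set ℝ :=
  {θ | ∃ z ∈ coneOver (F₁ ∩ F₂),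
    ∃ f₁ ∈ coneOver F₁ \ coneOver (F₁ ∩ F₂), ∃ f₂ ∈ coneOver F₂ \ coneOver (F₁ ∩ F₂),
      Metric.infDist f₁ (coneOver (F₁ ∩ F₂)) = dist f₁ z ∧
      Metric.infDist f₂ (coneOver (F₁ ∩ F₂)) = dist f₂ z ∧
      θ = EuclideanGeometry.angle f₁ z f₂}

/-- The non-flat condition for a complex cone of dimension `k`. -/
def IsNonFlat {d : ℕ} (k : ℕ) (𝒳 : Finset (Finset (Euc d))) : Prop :=
  ∀ Y ∈ Omega 𝒳, Y.card < k →
    ∀ Z₁ ∈ Omega 𝒳, ∀ Z₂ ∈ Omega 𝒳,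
      (Y : Set (Euc d)) = (Z₁ : Set (Euc d)) ∩ (Z₂ : Set (Euc d)) →
      Z₁.card = Y.card + 1 → Z₂.card = Y.card + 1 →
      sSup (faceAngles (Z₁ : Set (Euc d)) (Z₂ : Set (Euc d))) < Real.pi

/-- The union of the `t`-dimensional faces `C(Y)`, `Y ∈ Ω_T`, `#Y = t`. -/
def skeleton {d : ℕ} (𝒳 : Finset (Finset (Euc d))) (t : ℕ) : Set (Euc d) :=
  {y | ∃ Y ∈ Omega 𝒳, Y.card = t ∧ y ∈ coneOver (Y : Set (Euc d))}

/-! ### Sets of type `m` and their spines -/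

/-- `S × ℝ^m × {0} ⊆ ℝ^N` for `S ⊆ ℝ^N'`: the first `N'` coordinates form a point of `S`,
the next `m` are free, and the remaining `N - N' - m` vanish. -/
def prodFlat {N N' : ℕ} (m : ℕ) (S : Set (Euc N')) : Set (Euc N) :=
  {x | (∃ y ∈ S, ∀ (i : Fin N) (hi : (i : ℕ) < N'), x i = y ⟨i, hi⟩) ∧
    ∀ i : Fin N, N' + m ≤ (i : ℕ) → x i = 0}

/-- `W = R(T × ℝ^m × {0})`, where `T` is the complex cone of dimension `n - m` presented by `𝒳`
(it is the union of its `(n - m)`-dimensional faces), which satisfies the non-flat condition. -/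
def Presents {N N' : ℕ} (n m : ℕ) (𝒳 : Finset (Finset (Euc N'))) (R : Euc N ≃ᵢ Euc N)
    (W : Set (Euc N)) : Prop :=
  m ≤ n ∧ IsComplexCone (n - m) 𝒳 ∧ IsNonFlat (n - m) 𝒳 ∧
    W = R '' prodFlat m (⋃ X ∈ 𝒳, coneOver (X : Set (Euc N')))

/-- `W` is a set of type `m` in `ℝ^N` (with respect to `n` and `N'`). -/
def IsTypeSet {N : ℕ} (n N' m : ℕ) (W : Set (Euc N)) : Prop :=
  ∃ (𝒳 : Finset (Finset (Euc N'))) (R : Euc N ≃ᵢ Euc N), Presents n m 𝒳 R W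

/-- The `k`-spine `L^k(W)`. If `W = R(T × ℝ^m × {0})` is of type `m`, it is
`R(⋃ {C(Y) : Y ∈ Ω_T, #Y = k - m} × ℝ^m × {0})` for `m ≤ k ≤ n`, and it is empty for `k < m`.
(The type and the spines of `W` do not depend on the presentation of `W`.) -/
def spine {N : ℕ} (n N' k : ℕ) (W : Set (Euc N)) : Set (Euc N) :=
  {x | ∃ m ≤ k, ∃ (𝒳 : Finset (Finset (Euc N'))) (R : Euc N ≃ᵢ Euc N),
    Presents n m 𝒳 R W ∧ x ∈ R '' prodFlat m (skeleton 𝒳 (k - m))}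

/-- `W₁ ∼ W₂` when `W₁ = R(W₂)` for an isometry `R` of `ℝ^N`. -/
def isometricSetoid (N : ℕ) : Setoid (Set (Euc N)) where
  r W₁ W₂ := ∃ R : Euc N ≃ᵢ Euc N, W₁ = R '' W₂
  iseqv :=
    { refl := fun W => ⟨IsometryEquiv.refl _, (Set.image_id W).symm⟩
      symm := by
        rintro W₁ W₂ ⟨R, rfl⟩
        exact ⟨R.symm, by ext x; simp⟩
      trans := by
        rintro W₁ W₂ W₃ ⟨R, rfl⟩ ⟨R', rfl⟩
        exact ⟨R'.trans R, by rw [← Set.image_comp]; rfl⟩ }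

/-! ### Blow-up limits -/

/-- `C(W ∩ B(x,r) - x) = {c y : y ∈ W ∩ B(x,r) - x, c ≥ 0}`. -/
def localCone {N : ℕ} (W : Set (Euc N)) (x : Euc N) (r : ℝ) : Set (Euc N) :=
  {v | ∃ c : ℝ, 0 ≤ c ∧ ∃ y ∈ W ∩ Metric.ball x r, v = c • (y - x)}

/-- `K` is the blow-up limit of `W` at `x ∈ W`: the common value of the cones
`C(W ∩ B(x,r) - x)` for all small `r`. -/
def IsBlowUp {N : ℕ} (W : Set (Euc N)) (x : Euc N) (K : Set (Euc N)) : Prop :=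
  x ∈ W ∧ ∃ ρ : ℝ, 0 < ρ ∧ ∀ r : ℝ, 0 < r → r < ρ → localCone W x r = K

/-- `𝒜(ℬ)`: all isometric images of the blow-up limits of the sets `W ∈ ℬ` at points of `W`. -/
def blowUps {N : ℕ} (ℬ : Set (Set (Euc N))) : Set (Set (Euc N)) :=
  {Z | ∃ W ∈ ℬ, ∃ (x : Euc N) (K : Set (Euc N)) (R : Euc N ≃ᵢ Euc N),
    IsBlowUp W x K ∧ Z = R '' K}

/-- `𝒜(m)`: the sets of type `m` in `𝒜`. -/
def ofType {N : ℕ} (n N' : ℕ) (𝒜 : Set (Set (Euc N))) (m : ℕ) : Set (Set (Euc N)) :=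
  {W | W ∈ 𝒜 ∧ IsTypeSet n N' m W}

/-! ### The normalised local Hausdorff distance and the strata -/

/-- `d_{x,r}(F₁, F₂)`. -/
noncomputable def relDist {N : ℕ} (x : Euc N) (r : ℝ) (F₁ F₂ : Set (Euc N)) : ℝ≥0∞ :=
  max (⨆ z ∈ F₂ ∩ Metric.ball x r, Metric.infEDist z F₁)
      (⨆ z ∈ F₁ ∩ Metric.ball x r, Metric.infEDist z F₂) / ENNReal.ofReal r

/-- `a_m(x,r) = inf {d_{x,r}(E, W) : W ∈ 𝒜(m), x ∈ L^m(W)}`, with `inf ∅ = ∞`. -/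
noncomputable def typeDeviation {N : ℕ} (n N' : ℕ) (𝒜 : Set (Set (Euc N))) (E : Set (Euc N))
    (m : ℕ) (x : Euc N) (r : ℝ) : ℝ≥0∞ :=
  ⨅ W ∈ {W | W ∈ ofType n N' 𝒜 m ∧ x ∈ spine n N' m W}, relDist x r E W

/-- The defining property of the constant `δ₀`: a set of `𝒜(m)` whose `t`-spine passes through
`x` is at distance `d_{x,r}` more than `δ₀` from every set of `𝒜` of type larger than `t`. -/
def IsGapConstant {N : ℕ} (n N' : ℕ) (𝒜 : Set (Set (Euc N))) (δ₀ : ℝ) : Prop :=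
  ∀ m t : ℕ, m ≤ t → t < n →
    ∀ V ∈ ofType n N' 𝒜 m, ∀ x ∈ spine n N' t V,
      ∀ k : ℕ, t < k → k ≤ n → ∀ W ∈ ofType n N' 𝒜 k,
        ∀ r : ℝ, 0 < r → ENNReal.ofReal δ₀ < relDist x r V W

/-- The defining property of the constant `n₀`: if `n₀B` misses the `t`-spine of `W ∈ 𝒜(m)` and
`B` meets `W`, then `W` coincides in `B` with a set of `𝒜` of type larger than `t`; and if `W`
coincides in `B` with no set of `𝒜(t+1)`, then `n₀B` meets the `t`-spine of `W`. -/
def IsReplacementConstant {N : ℕ} (n N' : ℕ) (𝒜 : Set (Set (Euc N))) (n₀ : ℝ) : Prop :=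
  ∀ m t : ℕ, m ≤ t → t < n →
    ∀ W ∈ ofType n N' 𝒜 m, ∀ (x : Euc N) (r : ℝ), 0 < r →
      ((Metric.ball x r ∩ W).Nonempty →
        Metric.ball x (n₀ * r) ∩ spine n N' t W = ∅ →
        ∃ u : ℕ, t < u ∧ u ≤ n ∧ ∃ Y ∈ ofType n N' 𝒜 u,
          W ∩ Metric.ball x r = Y ∩ Metric.ball x r) ∧
      ((∀ Y ∈ ofType n N' 𝒜 (t + 1), W ∩ Metric.ball x r ≠ Y ∩ Metric.ball x r) →
        (Metric.ball x (n₀ * r) ∩ spine n N' t W).Nonempty)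

/-- The pair `(n₀, δ₀)` has the defining properties of the two constants, normalised by
`n₀ > 10` and `δ₀ < 1/10`. -/
def IsConstantPair {N : ℕ} (n N' : ℕ) (𝒜 : Set (Set (Euc N))) (n₀ δ₀ : ℝ) : Prop :=
  10 < n₀ ∧ 0 < δ₀ ∧ δ₀ < 1 / 10 ∧
    IsReplacementConstant n N' 𝒜 n₀ ∧ IsGapConstant n N' 𝒜 δ₀

/-- `C₀ = 10^8 (n₀ + n)^{3n} N₀` with `N₀ = n₀ / δ₀`. -/
noncomputable def stratumConst (n : ℕ) (n₀ δ₀ : ℝ) : ℝ :=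
  10 ^ 8 * (n₀ + n) ^ (3 * n) * (n₀ / δ₀)

/-- `E_m`: the points `x ∈ E ∩ B(0,2)` such that `a_m(x,r) < C₀ ε` for all small `r > 0`. -/
def stratum {N : ℕ} (n N' : ℕ) (𝒜 : Set (Set (Euc N))) (C₀ ε : ℝ) (E : Set (Euc N))
    (m : ℕ) : Set (Euc N) :=
  {x | x ∈ E ∩ Metric.ball 0 2 ∧ ∃ ρ : ℝ, 0 < ρ ∧ ∀ r : ℝ, 0 < r → r < ρ →
    typeDeviation n N' 𝒜 E m x r < ENNReal.ofReal (C₀ * ε)}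

/-- At each point `x ∈ E` and each scale `r > 0`, `E` is `ε`-close in `d_{x,r}` to a set of `𝒜`
that contains `x`. -/
def IsApproximable {N : ℕ} (𝒜 : Set (Set (Euc N))) (ε : ℝ) (E : Set (Euc N)) : Prop :=
  ∀ x ∈ E, ∀ r : ℝ, 0 < r → ∃ Z ∈ 𝒜, x ∈ Z ∧ relDist x r E Z < ENNReal.ofReal ε

end ConeStrata

/-! The geometric core is that a non-flat cone is not nearly translation invariant. Let `y` lie in a
face `C(F)` of less than full dimension and let `u` be orthogonal to `F`. Then `u` is transversal to
some codimension-one face `Y ⊇ F`. Near an inner point of `C(Y)` the cone is `span Y` times finitely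
many rays, no two of them opposite, so it cannot nearly contain small steps along both `u` and `-u`.
This is `IsNonFlat.exists_not_almost_invariant`.

A set of type `k` is invariant under a `k`-dimensional space of translations. The core therefore
yields the gap constant `δ₀` (`exists_lt_relDist_prodFlat`), and it characterises the spines below
the top one by local invariance (`mem_spine_iff_not_hasFlat`), so that spines are local. The
replacement constant `n₀` comes from Lipschitz coordinates on the cone: either enough coordinates of
a point are large, and the set is locally the star of a face, or deleting the small ones reaches the
spine (`IsTypeSet.exists_replacement`). Finiteness modulo isometries makes both constants uniform.

For `E`, closeness to sets of type at least `t` (`HighAt`) improves itself. If it holds roughly at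
one scale, gap and replacement force it with error of order `ε` at every sufficiently smaller scale
(`highAt_step`, `highAt_of_le`). Hence it is an open condition, and `E_t` consists of the points of
`E ∩ B(0, 2)` where it holds at some scale for `t` and at none for `t + 1`
(`IsTame.mem_stratum_iff`). Closedness of the unions follows.

For density, a model of type `m` at a point of `E_m` has points of its `(m + 1)`-spine far from its
`m`-spine, near which it coincides with a set of type `m + 1`. Recentring such sets on their spines
at geometrically decreasing scales (`exists_refine`) gives points of `E` converging to a point where
no higher type is possible (`exists_limit`). -/

namespace ConeStrata
open scoped Classical

/-! ### Conic coordinates on a complex cone -/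

section Coordinates

variable {d : ℕ}

/-- The linear combination `∑ v ∈ V, c v • v`, as a linear map in the coefficients `c`. -/
noncomputable def combo (V : Finset (Euc d)) : (Euc d → ℝ) →ₗ[ℝ] Euc d where
  toFun c := ∑ v ∈ V, c v • v
  map_add' c c' := by simp [add_smul, Finset.sum_add_distrib]
  map_smul' a c := by simp [mul_smul, Finset.smul_sum]

lemma combo_apply (V : Finset (Euc d)) (c : Euc d → ℝ) : combo V c = ∑ v ∈ V, c v • v := rfl

lemma combo_eq_of_subset {X V : Finset (Euc d)} (h : X ⊆ V) {c : Euc d → ℝ}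
    (hc : ∀ v ∉ X, c v = 0) : combo V c = combo X c :=
  (Finset.sum_subset h fun v _ hv => by simp [hc v hv]).symm

lemma combo_congr {V : Finset (Euc d)} {c c' : Euc d → ℝ} (h : ∀ v ∈ V, c v = c' v) :
    combo V c = combo V c' :=
  Finset.sum_congr rfl fun v hv => by rw [h v hv]

lemma combo_mem_span (X : Finset (Euc d)) (c : Euc d → ℝ) :
    combo X c ∈ Submodule.span ℝ (X : Set (Euc d)) :=
  Submodule.sum_mem _ fun _ hv => Submodule.smul_mem _ _ (Submodule.subset_span hv)

lemma exists_combo_of_mem_span {X : Finset (Euc d)} {y : Euc d}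
    (h : y ∈ Submodule.span ℝ (X : Set (Euc d))) :
    ∃ c : Euc d → ℝ, (∀ v ∉ X, c v = 0) ∧ y = combo X c := by
  obtain ⟨c, hc, rfl⟩ := Submodule.mem_span_finset.1 h
  refine ⟨c, fun v hv => ?_, rfl⟩
  by_contra h0
  exact hv (hc h0)

lemma mem_coneOver_iff {X : Finset (Euc d)} {y : Euc d} :
    y ∈ coneOver (X : Set (Euc d)) ↔
      ∃ c : Euc d → ℝ, (∀ v, 0 ≤ c v) ∧ (∀ v ∉ X, c v = 0) ∧ y = combo X c := by
  constructor
  · rintro (rfl | ⟨t, ht, x, hx, rfl⟩)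
    · exact ⟨0, fun _ => le_rfl, fun _ _ => rfl, by simp⟩
    · obtain ⟨w, hw, -, rfl⟩ := Finset.mem_convexHull'.1 hx
      refine ⟨fun v => if v ∈ X then t * w v else 0, fun v => ?_, fun v hv => by simp [hv], ?_⟩
      · by_cases hv : v ∈ X
        · simpa [hv] using mul_nonneg ht (hw v hv)
        · simp [hv]
      · rw [Finset.smul_sum, combo_apply]
        exact Finset.sum_congr rfl fun v hv => by simp [hv, mul_smul]
  · rintro ⟨c, hc, -, rfl⟩
    rcases (Finset.sum_nonneg fun v (_ : v ∈ X) => hc v).eq_or_lt with h | h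
    · left
      rw [combo_apply]
      exact Finset.sum_eq_zero fun v hv => by
        rw [(Finset.sum_eq_zero_iff_of_nonneg fun v _ => hc v).1 h.symm v hv, zero_smul]
    · refine Or.inr ⟨∑ v ∈ X, c v, h.le, ∑ v ∈ X, (c v / ∑ v ∈ X, c v) • v, ?_, ?_⟩
      · refine Finset.mem_convexHull'.2 ⟨_, fun v _ => div_nonneg (hc v) h.le, ?_, rfl⟩
        rw [← Finset.sum_div, div_self h.ne']
      · rw [Finset.smul_sum, combo_apply]
        exact Finset.sum_congr rfl fun v _ => by rw [smul_smul, mul_div_cancel₀ _ h.ne']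

lemma mem_Omega_self {𝒳 : Finset (Finset (Euc d))} {X : Finset (Euc d)} (hX : X ∈ 𝒳) :
    X ∈ Omega 𝒳 := ⟨X, hX, subset_rfl⟩

lemma IsSimpleFrame.linearIndepOn {k : ℕ} {X : Finset (Euc d)} (h : IsSimpleFrame k X) :
    LinearIndepOn ℝ id (X : Set (Euc d)) := by
  have h0 : (0 : Euc d) ∉ (X : Set (Euc d)) := fun h0 => by
    have := h.2.1 0 h0
    simp at this
  have := (linearIndependent_set_iff_affineIndependent_vadd_union_singleton ℝ
    (V := Euc d) (P := Euc d) (s := (X : Set (Euc d)))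
    (fun v hv h' => h0 (h' ▸ hv)) (0 : Euc d)).2
  refine this ?_
  have e : ({0} ∪ (fun v : Euc d => v +ᵥ (0 : Euc d)) '' (X : Set (Euc d)))
      = insert 0 (X : Set (Euc d)) := by
    rw [Set.singleton_union]
    simp
  rw [e]
  exact h.2.2

lemma combo_injOn {X : Finset (Euc d)} (h : LinearIndepOn ℝ id (X : Set (Euc d)))
    {c c' : Euc d → ℝ} (hc : ∀ v ∉ X, c v = 0) (hc' : ∀ v ∉ X, c' v = 0)
    (e : combo X c = combo X c') : c = c' := by
  have h1 := (linearIndepOn_finset_iff.1 h) (c - c') (by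
    have : combo X (c - c') = 0 := by rw [map_sub, e, sub_self]
    simpa [combo_apply] using this)
  funext v
  by_cases hv : v ∈ X
  · exact sub_eq_zero.1 (h1 v hv)
  · rw [hc v hv, hc' v hv]

/-- All the generating vectors of the family `𝒳`. -/
noncomputable def verts (𝒳 : Finset (Finset (Euc d))) : Finset (Euc d) := 𝒳.biUnion id

lemma subset_verts {𝒳 : Finset (Finset (Euc d))} {X : Finset (Euc d)} (hX : X ∈ 𝒳) :
    X ⊆ verts 𝒳 := Finset.subset_biUnion_of_mem id hX

lemma subset_verts_of_mem_Omega {𝒳 : Finset (Finset (Euc d))} {X : Finset (Euc d)}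
    (hX : X ∈ Omega 𝒳) : X ⊆ verts 𝒳 := by
  obtain ⟨Y, hY, h⟩ := hX
  exact h.trans (subset_verts hY)

lemma finite_Omega (𝒳 : Finset (Finset (Euc d))) : (Omega 𝒳).Finite :=
  (verts 𝒳).powerset.finite_toSet.subset fun X hX => by
    simpa using subset_verts_of_mem_Omega hX

/-- `c` is a system of coordinates of a point of the star of the face `F`: the coefficients are
supported in some generating set containing `F`, and nonnegative off `F`. -/
def IsCoord (𝒳 : Finset (Finset (Euc d))) (F : Finset (Euc d)) (c : Euc d → ℝ) : Prop :=
  (∀ v ∉ F, 0 ≤ c v) ∧ ∃ X ∈ 𝒳, F ⊆ X ∧ ∀ v ∉ X, c v = 0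

/-- The union of the cones `span F + C(X)`, over the generating sets `X` that contain `F`. -/
def starCone (𝒳 : Finset (Finset (Euc d))) (F : Finset (Euc d)) : Set (Euc d) :=
  {y | ∃ c, IsCoord 𝒳 F c ∧ y = combo (verts 𝒳) c}

lemma iUnion_coneOver_eq (𝒳 : Finset (Finset (Euc d))) :
    (⋃ X ∈ 𝒳, coneOver (X : Set (Euc d))) = starCone 𝒳 ∅ := by
  ext y
  simp only [Set.mem_iUnion, mem_coneOver_iff, starCone, Set.mem_ofPred_eq, exists_prop]
  constructor
  · rintro ⟨X, hX, c, hc, h0, rfl⟩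
    exact ⟨c, ⟨fun v _ => hc v, X, hX, by simp, h0⟩, (combo_eq_of_subset (subset_verts hX) h0).symm⟩
  · rintro ⟨c, ⟨hc, X, hX, -, h0⟩, rfl⟩
    exact ⟨X, hX, c, fun v => hc v (by simp), h0, combo_eq_of_subset (subset_verts hX) h0⟩

variable {k : ℕ} {𝒳 : Finset (Finset (Euc d))}

/-- The intersection axiom puts the common point in `C(X ∩ Y)`. Its coordinates there agree with
both given systems, by linear independence of `X` and of `Y`. -/
lemma IsComplexCone.coord_eq (h : IsComplexCone k 𝒳) {c c' : Euc d → ℝ}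
    (hc : IsCoord 𝒳 ∅ c) (hc' : IsCoord 𝒳 ∅ c') (e : combo (verts 𝒳) c = combo (verts 𝒳) c') :
    c = c' := by
  obtain ⟨hc, X, hX, -, h0⟩ := hc
  obtain ⟨hc', Y, hY, -, h0'⟩ := hc'
  rw [combo_eq_of_subset (subset_verts hX) h0, combo_eq_of_subset (subset_verts hY) h0'] at e
  have hm : combo X c ∈ coneOver ((X ∩ Y : Finset (Euc d)) : Set (Euc d)) := by
    rw [Finset.coe_inter, ← h.2.2 X (mem_Omega_self hX) Y (mem_Omega_self hY)]
    exact ⟨mem_coneOver_iff.2 ⟨c, fun v => hc v (by simp), h0, rfl⟩,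
      mem_coneOver_iff.2 ⟨c', fun v => hc' v (by simp), h0', e⟩⟩
  obtain ⟨b, -, hb0, hb⟩ := mem_coneOver_iff.1 hm
  have hX' : combo X b = combo (X ∩ Y) b := combo_eq_of_subset Finset.inter_subset_left hb0
  have hY' : combo Y b = combo (X ∩ Y) b := combo_eq_of_subset Finset.inter_subset_right hb0
  have e1 : c = b := combo_injOn (h.2.1 X hX).linearIndepOn h0
    (fun v hv => hb0 v fun h' => hv (Finset.mem_inter.1 h').1) (by rw [hX', hb])
  have e2 : c' = b := combo_injOn (h.2.1 Y hY).linearIndepOn h0'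
    (fun v hv => hb0 v fun h' => hv (Finset.mem_inter.1 h').2) (by rw [hY', ← e, hb])
  rw [e1, e2]

/-- Adding a large multiple of `∑ v ∈ F, v` makes the coordinates of a star nonnegative. -/
lemma IsCoord.shift {F : Finset (Euc d)} {c : Euc d → ℝ} (hc : IsCoord 𝒳 F c) {s : ℝ}
    (hs : ∀ v ∈ F, 0 ≤ c v + s) : IsCoord 𝒳 ∅ (c + fun v => if v ∈ F then s else 0) := by
  obtain ⟨hc, X, hX, hFX, h0⟩ := hc
  refine ⟨fun v _ => ?_, X, hX, by simp, fun v hv => ?_⟩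
  · by_cases hv : v ∈ F
    · simpa [hv] using hs v hv
    · simpa [hv] using hc v hv
  · have : v ∉ F := fun h => hv (hFX h)
    simp [h0 v hv, this]

lemma exists_shift (F : Finset (Euc d)) (c c' : Euc d → ℝ) :
    ∃ s : ℝ, 0 ≤ s ∧ (∀ v ∈ F, 0 ≤ c v + s) ∧ ∀ v ∈ F, 0 ≤ c' v + s := by
  refine ⟨∑ v ∈ F, (|c v| + |c' v|), Finset.sum_nonneg fun _ _ => by positivity, ?_, ?_⟩ <;>
  · intro v hv
    have := Finset.single_le_sum (f := fun v => |c v| + |c' v|) (fun _ _ => by positivity) hv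
    have h1 := neg_abs_le (c v)
    have h2 := neg_abs_le (c' v)
    have h3 := abs_nonneg (c v)
    have h4 := abs_nonneg (c' v)
    linarith

/-- The coordinates of points of a complex cone are Lipschitz functions. -/
lemma IsComplexCone.exists_lipschitz (h : IsComplexCone k 𝒳) :
    ∃ κ : ℝ, 1 ≤ κ ∧ ∀ c c', IsCoord 𝒳 ∅ c → IsCoord 𝒳 ∅ c' → ∀ v,
      |c v - c' v| ≤ κ * ‖combo (verts 𝒳) c - combo (verts 𝒳) c'‖ := by
  set V := verts 𝒳 with hV
  -- `D` is a finite union of closed cones. It contains every difference `c - c'` with `c` supported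
  -- in `X` and `c'` in `Y`.
  let D : Set (V → ℝ) := ⋃ X ∈ 𝒳, ⋃ Y ∈ 𝒳,
    {e | ∀ v : V, (v.1 ∉ X → e v ≤ 0) ∧ (v.1 ∉ Y → 0 ≤ e v)}
  have hD : IsClosed D := by
    refine 𝒳.finite_toSet.isClosed_biUnion fun X _ => 𝒳.finite_toSet.isClosed_biUnion fun Y _ => ?_
    simp only [Set.ofPred_forall, Set.ofPred_and]
    refine isClosed_iInter fun v => IsClosed.inter ?_ ?_
    · exact isClosed_iInter fun _ => isClosed_le (continuous_apply v) continuous_const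
    · exact isClosed_iInter fun _ => isClosed_le continuous_const (continuous_apply v)
  let Lr : (V → ℝ) → Euc d := fun e => ∑ v : V, e v • v.1
  have hLr : Continuous Lr := by fun_prop
  let ext : (V → ℝ) → Euc d → ℝ := fun e v => if hv : v ∈ V then e ⟨v, hv⟩ else 0
  have hext : ∀ e, combo V (ext e) = Lr e := fun e => by
    rw [combo_apply, ← Finset.sum_coe_sort]
    exact Finset.sum_congr rfl fun v _ => by simp [ext]
  -- The positive and negative parts of `e` are coordinates supported in `X` and `Y`. If `Lr e = 0`,
  -- they represent the same point, hence coincide, and `e = 0`.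
  have hpos : ∀ e ∈ D ∩ Metric.sphere 0 1, (0 : ℝ) < ‖Lr e‖ := by
    rintro e ⟨heD, he⟩
    rw [norm_pos_iff]
    intro h0
    simp only [D, Set.mem_iUnion, exists_prop] at heD
    obtain ⟨X, hX, Y, hY, hXY⟩ := heD
    have h1 : IsCoord 𝒳 ∅ (ext fun v => max (e v) 0) := by
      refine ⟨fun v _ => ?_, X, hX, by simp, fun v hv => ?_⟩
      · by_cases hv : v ∈ V <;> simp [ext, hv]
      · by_cases hv' : v ∈ V
        · simpa [ext, hv'] using (hXY ⟨v, hv'⟩).1 hv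
        · simp [ext, hv']
    have h2 : IsCoord 𝒳 ∅ (ext fun v => max (-e v) 0) := by
      refine ⟨fun v _ => ?_, Y, hY, by simp, fun v hv => ?_⟩
      · by_cases hv : v ∈ V <;> simp [ext, hv]
      · by_cases hv' : v ∈ V
        · simpa [ext, hv'] using (hXY ⟨v, hv'⟩).2 hv
        · simp [ext, hv']
    have h3 : combo V (ext fun v => max (e v) 0) = combo V (ext fun v => max (-e v) 0) := by
      rw [hext fun v => max (e v) 0, hext fun v => max (-e v) 0, ← sub_eq_zero, ← h0]
      simp only [Lr, ← Finset.sum_sub_distrib, ← sub_smul]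
      refine Finset.sum_congr rfl fun v _ => ?_
      congr 1
      rcases le_total 0 (e v) with h | h
      · rw [max_eq_left h, max_eq_right (by linarith)]; ring
      · rw [max_eq_right h, max_eq_left (by linarith)]; ring
    replace h3 := h.coord_eq h1 h2 h3
    have h4 : e = 0 := by
      funext v
      have h5 := congrFun h3 v.1
      simp only [ext, v.2, dite_true, Subtype.coe_eta] at h5
      rcases le_total 0 (e v) with h | h
      · rw [max_eq_left h, max_eq_right (by linarith)] at h5; exact h5
      · rw [max_eq_right h, max_eq_left (by linarith)] at h5
        simpa using h5.symm
    simp [h4] at he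
  -- Compactness of the sphere gives a positive lower bound, which homogeneity extends to all of
  -- `D`.
  obtain ⟨μ, hμ0, hμ⟩ := ((isCompact_sphere (0 : V → ℝ) 1).inter_left hD).exists_forall_le'
    (hLr.norm.continuousOn) hpos
  have key : ∀ e ∈ D, μ * ‖e‖ ≤ ‖Lr e‖ := by
    intro e he
    rcases eq_or_ne e 0 with rfl | hne
    · simp
    have hn : 0 < ‖e‖ := norm_pos_iff.2 hne
    have hsm : Lr (‖e‖⁻¹ • e) = ‖e‖⁻¹ • Lr e := by
      simp [Lr, Finset.smul_sum, mul_smul]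
    have := hμ (‖e‖⁻¹ • e) ⟨?_, by simp [norm_smul, hn.ne']⟩
    · rw [hsm, norm_smul, norm_inv, norm_norm, inv_mul_eq_div, le_div_iff₀ hn] at this
      exact this
    · simp only [D, Set.mem_iUnion, exists_prop] at he ⊢
      obtain ⟨X, hX, Y, hY, hXY⟩ := he
      refine ⟨X, hX, Y, hY, fun v => ⟨fun hv => ?_, fun hv => ?_⟩⟩
      · exact mul_nonpos_of_nonneg_of_nonpos (by positivity) ((hXY v).1 hv)
      · exact mul_nonneg (by positivity) ((hXY v).2 hv)
  refine ⟨max 1 μ⁻¹, le_max_left _ _, fun c c' hc hc' v => ?_⟩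
  have hsub : combo V c - combo V c' = Lr fun v => c v.1 - c' v.1 := by
    rw [← map_sub, combo_apply, ← Finset.sum_coe_sort]
    rfl
  have hmem : (fun v : V => c v.1 - c' v.1) ∈ D := by
    obtain ⟨hc, X, hX, -, h0⟩ := hc
    obtain ⟨hc', Y, hY, -, h0'⟩ := hc'
    simp only [D, Set.mem_iUnion, exists_prop]
    refine ⟨X, hX, Y, hY, fun v => ⟨fun hv => ?_, fun hv => ?_⟩⟩
    · simpa [h0 _ hv] using hc' v (by simp)
    · simpa [h0' _ hv] using hc v (by simp)
  by_cases hv : v ∈ V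
  · have h1 := norm_le_pi_norm (fun v : V => c v.1 - c' v.1) ⟨v, hv⟩
    have h2 := key _ hmem
    rw [hsub]
    calc |c v - c' v| ≤ ‖fun v : V => c v.1 - c' v.1‖ := h1
      _ ≤ μ⁻¹ * ‖Lr fun v => c v.1 - c' v.1‖ := by
        rw [inv_mul_eq_div, le_div_iff₀ hμ0, mul_comm]; exact h2
      _ ≤ _ := by gcongr; exact le_max_right _ _
  · obtain ⟨hc, X, hX, -, h0⟩ := hc
    obtain ⟨hc', Y, hY, -, h0'⟩ := hc'
    rw [h0 v fun h => hv (subset_verts hX h), h0' v fun h => hv (subset_verts hY h)]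
    simp only [sub_self, abs_zero]
    positivity

/-- A large multiple of the sum of `F` carries both points into the cone itself, where coordinates
are unique. -/
lemma IsComplexCone.star_coord_eq (h : IsComplexCone k 𝒳) {F : Finset (Euc d)} {c c' : Euc d → ℝ}
    (hc : IsCoord 𝒳 F c) (hc' : IsCoord 𝒳 F c') (e : combo (verts 𝒳) c = combo (verts 𝒳) c') :
    c = c' := by
  obtain ⟨s, -, h1, h2⟩ := exists_shift F c c'
  have := h.coord_eq (hc.shift h1) (hc'.shift h2) (by rw [map_add, map_add, e])
  exact add_right_cancel this

/-- Where the coordinates indexed by `F` are large, the cone coincides with the star of `F`. -/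
lemma starCone_inter_ball {κ : ℝ} (hκ : ∀ c c', IsCoord 𝒳 ∅ c → IsCoord 𝒳 ∅ c' → ∀ v,
      |c v - c' v| ≤ κ * ‖combo (verts 𝒳) c - combo (verts 𝒳) c'‖) (hκ0 : 0 < κ)
    {F : Finset (Euc d)} {c : Euc d → ℝ} (hc : IsCoord 𝒳 ∅ c) {r : ℝ}
    (hF : ∀ v ∈ F, κ * r < c v) :
    starCone 𝒳 ∅ ∩ Metric.ball (combo (verts 𝒳) c) r =
      starCone 𝒳 F ∩ Metric.ball (combo (verts 𝒳) c) r := by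
  ext w
  refine and_congr_left fun hw => ?_
  rw [mem_ball_iff_norm] at hw
  have hr : 0 < r := (norm_nonneg _).trans_lt hw
  have hFc : ∀ v ∈ F, c v ≠ 0 := fun v hv => ((mul_pos hκ0 hr).trans (hF v hv)).ne'
  constructor
  -- The Lipschitz bound keeps the coordinates on `F` positive, so a generating set supporting `b`
  -- contains `F`.
  · rintro ⟨b, hb, rfl⟩
    have hpos : ∀ v ∈ F, 0 < b v := fun v hv => by
      have h1 := (abs_le.1 (hκ b c hb hc v)).1
      have h2 := hF v hv
      have h3 := mul_lt_mul_of_pos_left hw hκ0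
      linarith
    obtain ⟨hb0, X, hX, -, hbX⟩ := hb
    refine ⟨b, ⟨fun v _ => hb0 v (by simp), X, hX, fun v hv => ?_, hbX⟩, rfl⟩
    by_contra h
    exact (hpos v hv).ne' (hbX v h)
  · rintro ⟨b, hb, rfl⟩
    have hcF : IsCoord 𝒳 F c := by
      obtain ⟨hc0, X, hX, -, hcX⟩ := hc
      refine ⟨fun v _ => hc0 v (by simp), X, hX, fun v hv => ?_, hcX⟩
      by_contra h
      exact hFc v hv (hcX v h)
    -- Coordinates in a star may be negative on `F`, so the Lipschitz bound is applied after a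
    -- common shift, which does not change differences.
    obtain ⟨s, -, h1, h2⟩ := exists_shift F b c
    have hd : ∀ v ∈ F, 0 < b v := fun v hv => by
      have h1 := (abs_le.1 (hκ _ _ (hb.shift h1) (hcF.shift h2) v)).1
      have h2 := hF v hv
      have h3 := mul_lt_mul_of_pos_left hw hκ0
      rw [map_add, map_add, add_sub_add_right_eq_sub] at h1
      simp only [Pi.add_apply] at h1
      linarith
    obtain ⟨hb0, X, hX, -, hbX⟩ := hb
    refine ⟨b, ⟨fun v _ => ?_, X, hX, by simp, hbX⟩, rfl⟩
    by_cases hv : v ∈ F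
    · exact (hd v hv).le
    · exact hb0 v hv

end Coordinates

end ConeStrata
namespace ConeStrata
open scoped Classical

/-! ### Links of faces -/

section Links

variable {d : ℕ}

lemma coneOver_mono {A B : Set (Euc d)} (h : A ⊆ B) : coneOver A ⊆ coneOver B := by
  rintro y (rfl | ⟨t, ht, x, hx, rfl⟩)
  · exact Or.inl rfl
  · exact Or.inr ⟨t, ht, x, convexHull_mono h hx, rfl⟩

lemma mem_coneOver_image_iff {X : Finset (Euc d)} {e : Euc d → Euc d} (he : Set.InjOn e X)
    {y : Euc d} : y ∈ coneOver ((X.image e : Finset (Euc d)) : Set (Euc d)) ↔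
      ∃ a : Euc d → ℝ, (∀ v, 0 ≤ a v) ∧ (∀ v ∉ X, a v = 0) ∧ y = ∑ v ∈ X, a v • e v := by
  rw [mem_coneOver_iff]
  constructor
  · rintro ⟨c, hc, -, rfl⟩
    refine ⟨fun v => if v ∈ X then c (e v) else 0, fun v => ?_, fun v hv => by simp [hv], ?_⟩
    · dsimp only; split_ifs
      exacts [hc _, le_rfl]
    · rw [combo_apply, Finset.sum_image he]
      exact Finset.sum_congr rfl fun v hv => by simp [hv]
  · rintro ⟨a, ha, -, rfl⟩
    refine ⟨fun w => if w ∈ X.image e then a (Function.invFunOn e X w) else 0, fun w => ?_,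
      fun w hw => if_neg hw, ?_⟩
    · dsimp only; split_ifs
      exacts [ha _, le_rfl]
    · rw [combo_apply, Finset.sum_image he]
      refine Finset.sum_congr rfl fun v hv => ?_
      rw [if_pos (Finset.mem_image_of_mem e hv), he.leftInvOn_invFunOn hv]

lemma isSimpleFrame_of_linearIndepOn {k : ℕ} {X : Finset (Euc d)} (hk : X.card = k)
    (h1 : ∀ x ∈ X, ‖x‖ = 1) (h : LinearIndepOn ℝ id (X : Set (Euc d))) : IsSimpleFrame k X := by
  refine ⟨hk, h1, ?_⟩
  have h0 : (0 : Euc d) ∉ (X : Set (Euc d)) := fun h0 => by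
    have := h1 0 h0
    simp at this
  have := (linearIndependent_set_iff_affineIndependent_vadd_union_singleton ℝ
    (V := Euc d) (P := Euc d) (s := (X : Set (Euc d)))
    (fun v hv h' => h0 (h' ▸ hv)) (0 : Euc d)).1 h
  have e : ({0} ∪ (fun v : Euc d => v +ᵥ (0 : Euc d)) '' (X : Set (Euc d)))
      = insert 0 (X : Set (Euc d)) := by
    rw [Set.singleton_union]
    simp
  rw [e] at this
  exact this

/-- A family of unit vectors with unique nonnegative coordinates presents a complex cone. -/
lemma isComplexCone_image {j : ℕ} {𝒴 : Finset (Finset (Euc d))} {e : Euc d → Euc d}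
    (hne : 𝒴.Nonempty) (hcard : ∀ Y ∈ 𝒴, Y.card = j) (hnorm : ∀ Y ∈ 𝒴, ∀ v ∈ Y, ‖e v‖ = 1)
    (hinj : ∀ Y₁ ∈ 𝒴, ∀ Y₂ ∈ 𝒴, ∀ a b : Euc d → ℝ, (∀ v, 0 ≤ a v) → (∀ v, 0 ≤ b v) →
      (∀ v ∉ Y₁, a v = 0) → (∀ v ∉ Y₂, b v = 0) →
      ∑ v ∈ Y₁, a v • e v = ∑ v ∈ Y₂, b v • e v → a = b) :
    (∀ Y₁ ∈ 𝒴, ∀ Y₂ ∈ 𝒴, ∀ v ∈ Y₁, ∀ w ∈ Y₂, e v = e w → v = w) ∧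
      IsComplexCone j (𝒴.image (Finset.image e)) := by
  have hi : ∀ Y₁ ∈ 𝒴, ∀ Y₂ ∈ 𝒴, ∀ v ∈ Y₁, ∀ w ∈ Y₂, e v = e w → v = w := by
    intro Y₁ h₁ Y₂ h₂ v hv w hw hvw
    have := hinj Y₁ h₁ Y₂ h₂ (fun u => if u = v then 1 else 0) (fun u => if u = w then 1 else 0)
      (fun u => by split_ifs <;> norm_num) (fun u => by split_ifs <;> norm_num)
      (fun u hu => if_neg fun h : u = v => hu (h ▸ hv))
      (fun u hu => if_neg fun h : u = w => hu (h ▸ hw))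
      (by simp [hv, hw, hvw])
    have h3 := congrFun this v
    by_contra hne
    simp [hne] at h3
  have hiO : ∀ Y ∈ Omega 𝒴, Set.InjOn e Y := by
    rintro Y ⟨X, hX, hYX⟩ v hv w hw h
    exact hi X hX X hX v (hYX hv) w (hYX hw) h
  have hOm : ∀ Z ∈ Omega (𝒴.image (Finset.image e)), ∃ Y ∈ Omega 𝒴, Z = Y.image e := by
    rintro Z ⟨X, hX, hZX⟩
    obtain ⟨X, hX', rfl⟩ := Finset.mem_image.1 hX
    obtain ⟨Y, hY, rfl⟩ := Finset.subset_image_iff.1 hZX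
    exact ⟨Y, ⟨X, hX', by exact_mod_cast hY⟩, rfl⟩
  refine ⟨hi, hne.image _, fun X hX => ?_, fun X hX Y hY => ?_⟩
  · obtain ⟨Y, hY, rfl⟩ := Finset.mem_image.1 hX
    refine isSimpleFrame_of_linearIndepOn ?_ ?_ ?_
    · rw [Finset.card_image_of_injOn (hiO Y (mem_Omega_self hY)), hcard Y hY]
    · intro x hx
      obtain ⟨v, hv, rfl⟩ := Finset.mem_image.1 hx
      exact hnorm Y hY v hv
    · rw [Finset.coe_image]
      refine LinearIndepOn.id_image (linearIndepOn_finset_iff.2 fun g hg v hv => ?_)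
      -- Splitting a linear relation into its positive and negative parts brings it under the
      -- uniqueness of nonnegative coordinates.
      have := hinj Y hY Y hY (fun v => if v ∈ Y then max (g v) 0 else 0)
        (fun v => if v ∈ Y then max (-g v) 0 else 0)
        (fun u => by split_ifs <;> simp) (fun u => by split_ifs <;> simp)
        (fun u hu => if_neg hu) (fun u hu => if_neg hu) (by
          rw [← sub_eq_zero, ← hg, ← Finset.sum_sub_distrib]
          refine Finset.sum_congr rfl fun u hu => ?_
          rw [if_pos hu, if_pos hu, ← sub_smul]
          congr 1
          rcases le_total 0 (g u) with h | h
          · rw [max_eq_left h, max_eq_right (by linarith)]; ring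
          · rw [max_eq_right h, max_eq_left (by linarith)]; ring)
      have h5 := congrFun this v
      simp only [hv, if_true] at h5
      rcases le_total 0 (g v) with h | h
      · rw [max_eq_left h, max_eq_right (by linarith)] at h5; exact h5
      · rw [max_eq_right h, max_eq_left (by linarith)] at h5
        simpa using h5.symm
  · refine Set.Subset.antisymm ?_ (Set.subset_inter (coneOver_mono Set.inter_subset_left)
      (coneOver_mono Set.inter_subset_right))
    obtain ⟨X, hX', rfl⟩ := hOm X hX
    obtain ⟨Y, hY', rfl⟩ := hOm Y hY
    rintro y ⟨h1, h2⟩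
    obtain ⟨a, ha, ha0, rfl⟩ := (mem_coneOver_image_iff (hiO X hX')).1 h1
    obtain ⟨b, hb, hb0, hab⟩ := (mem_coneOver_image_iff (hiO Y hY')).1 h2
    obtain ⟨X₀, hX₀, hXX⟩ := hX'
    obtain ⟨Y₀, hY₀, hYY⟩ := hY'
    have e1 : ∑ v ∈ X, a v • e v = ∑ v ∈ X₀, a v • e v :=
      Finset.sum_subset hXX fun v _ hv => by simp [ha0 v hv]
    have e2 : ∑ v ∈ Y, b v • e v = ∑ v ∈ Y₀, b v • e v :=
      Finset.sum_subset hYY fun v _ hv => by simp [hb0 v hv]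
    have := hinj X₀ hX₀ Y₀ hY₀ a b ha hb (fun v hv => ha0 v fun h => hv (hXX h))
      (fun v hv => hb0 v fun h => hv (hYY h)) (by rw [← e1, ← e2, hab])
    subst this
    have h3 : ∑ v ∈ X, a v • e v ∈ coneOver (((X ∩ Y).image e : Finset (Euc d)) : Set (Euc d)) := by
      refine (mem_coneOver_image_iff (hiO _ ⟨X₀, hX₀, Finset.inter_subset_left.trans hXX⟩)).2
        ⟨a, ha, fun v hv => ?_, ?_⟩
      · by_cases hvX : v ∈ X
        · exact hb0 v fun h => hv (Finset.mem_inter.2 ⟨hvX, h⟩)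
        · exact ha0 v hvX
      · symm
        refine Finset.sum_subset Finset.inter_subset_left fun v hvX hv => ?_
        rw [hb0 v fun h => hv (Finset.mem_inter.2 ⟨hvX, h⟩), zero_smul]
    refine coneOver_mono ?_ h3
    rw [Finset.coe_image, Finset.coe_inter, Finset.coe_image, Finset.coe_image]
    exact Set.image_inter_subset _ _ _

/-- The orthogonal projection to the orthogonal complement of the span of `F`. -/
noncomputable def perp (F : Finset (Euc d)) : Euc d →L[ℝ] Euc d :=
  (Submodule.span ℝ (F : Set (Euc d)))ᗮ.starProjection

lemma perp_eq_zero_iff {F : Finset (Euc d)} {v : Euc d} :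
    perp F v = 0 ↔ v ∈ Submodule.span ℝ (F : Set (Euc d)) := by
  rw [perp, Submodule.starProjection_apply_eq_zero_iff, Submodule.orthogonal_orthogonal]

lemma perp_of_mem {F : Finset (Euc d)} {v : Euc d} (hv : v ∈ F) : perp F v = 0 :=
  perp_eq_zero_iff.2 (Submodule.subset_span hv)

lemma perp_mem (F : Finset (Euc d)) (v : Euc d) :
    perp F v ∈ (Submodule.span ℝ (F : Set (Euc d)))ᗮ :=
  Submodule.starProjection_apply_mem _ _

lemma perp_eq_self {F : Finset (Euc d)} {v : Euc d}
    (hv : v ∈ (Submodule.span ℝ (F : Set (Euc d)))ᗮ) : perp F v = v :=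
  Submodule.starProjection_eq_self_iff.2 hv

lemma perp_perp (F : Finset (Euc d)) (v : Euc d) : perp F (perp F v) = perp F v :=
  perp_eq_self (perp_mem F v)

lemma sub_perp_mem (F : Finset (Euc d)) (v : Euc d) :
    v - perp F v ∈ Submodule.span ℝ (F : Set (Euc d)) := by
  rw [← perp_eq_zero_iff, map_sub, perp_perp, sub_self]

lemma norm_perp_le (F : Finset (Euc d)) (v : Euc d) : ‖perp F v‖ ≤ ‖v‖ :=
  Submodule.norm_starProjection_apply_le _ _

/-- The direction of the generating vector `v` in the link of the face `F`. -/
noncomputable def linkVec (F : Finset (Euc d)) (v : Euc d) : Euc d := ‖perp F v‖⁻¹ • perp F v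

/-- The link of the face `F`: a family presenting the cone of normal directions to `F`. -/
noncomputable def link (𝒳 : Finset (Finset (Euc d))) (F : Finset (Euc d)) :
    Finset (Finset (Euc d)) :=
  ((𝒳.filter (F ⊆ ·)).image (· \ F)).image (Finset.image (linkVec F))

variable {k : ℕ} {𝒳 : Finset (Finset (Euc d))}

lemma IsComplexCone.notMem_span (h : IsComplexCone k 𝒳) {X F : Finset (Euc d)} (hX : X ∈ 𝒳)
    (hF : F ⊆ X) {v : Euc d} (hv : v ∈ X) (hvF : v ∉ F) :
    v ∉ Submodule.span ℝ (F : Set (Euc d)) := by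
  intro hv'
  obtain ⟨g, hg, e⟩ := exists_combo_of_mem_span hv'
  have := combo_injOn (h.2.1 X hX).linearIndepOn (c := fun u => if u = v then 1 else 0) (c' := g)
    (fun u hu => if_neg fun h : u = v => hu (h ▸ hv)) (fun u hu => hg u fun h => hu (hF h)) (by
      rw [combo_eq_of_subset hF hg, ← e, combo_apply]
      simp [hv])
  have h1 := congrFun this v
  rw [hg v hvF] at h1
  simp at h1

lemma perp_combo {F X : Finset (Euc d)} (c : Euc d → ℝ) :
    perp F (combo X c) = ∑ v ∈ X \ F, c v • perp F v := by
  rw [combo_apply, map_sum]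
  simp only [map_smul]
  symm
  refine Finset.sum_subset Finset.sdiff_subset fun v hv hv' => ?_
  rw [perp_of_mem (by simpa [hv] using hv'), smul_zero]

lemma exists_combo_of_perp_eq {F : Finset (Euc d)} {x y : Euc d} (h : perp F x = perp F y) :
    ∃ g : Euc d → ℝ, (∀ v ∉ F, g v = 0) ∧ x = y + combo F g := by
  obtain ⟨g, hg, e⟩ := exists_combo_of_mem_span (perp_eq_zero_iff.1
    (show perp F (x - y) = 0 by rw [map_sub, h, sub_self]))
  exact ⟨g, hg, by rw [← e]; abel⟩

/-- Equality after projection is equality modulo `span F`. The discrepancy is absorbed by the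
coordinates on `F`, whose sign is free in a star, and uniqueness in the star applies. -/
lemma IsComplexCone.link_coord_eq (h : IsComplexCone k 𝒳) {F X Y : Finset (Euc d)}
    (hX : X ∈ 𝒳) (hFX : F ⊆ X) (hY : Y ∈ 𝒳) (hFY : F ⊆ Y) {a b : Euc d → ℝ}
    (ha : ∀ v, 0 ≤ a v) (hb : ∀ v, 0 ≤ b v) (ha0 : ∀ v ∉ X \ F, a v = 0)
    (hb0 : ∀ v ∉ Y \ F, b v = 0)
    (e : ∑ v ∈ X \ F, a v • linkVec F v = ∑ v ∈ Y \ F, b v • linkVec F v) : a = b := by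
  let a' : Euc d → ℝ := fun v => a v * ‖perp F v‖⁻¹
  let b' : Euc d → ℝ := fun v => b v * ‖perp F v‖⁻¹
  have e' : perp F (combo X a') = perp F (combo Y b') := by
    rw [perp_combo, perp_combo]
    simpa only [linkVec, smul_smul] using e
  have ha0X : ∀ v ∉ X, a v = 0 := fun v hv => ha0 v fun h => hv (Finset.mem_sdiff.1 h).1
  have hb0Y : ∀ v ∉ Y, b v = 0 := fun v hv => hb0 v fun h => hv (Finset.mem_sdiff.1 h).1
  obtain ⟨g, hg, hg'⟩ := exists_combo_of_perp_eq e'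
  have hA : IsCoord 𝒳 F a' := ⟨fun v _ => mul_nonneg (ha v) (by positivity), X, hX, hFX,
    fun v hv => by simp [a', ha0X v hv]⟩
  have hB : IsCoord 𝒳 F (b' + g) := by
    refine ⟨fun v hv => ?_, Y, hY, hFY, fun v hv => ?_⟩
    · rw [Pi.add_apply, hg v hv, add_zero]
      exact mul_nonneg (hb v) (by positivity)
    · rw [Pi.add_apply, hg v fun h => hv (hFY h)]
      simp [b', hb0Y v hv]
  have := h.star_coord_eq hA hB (by
    rw [map_add, combo_eq_of_subset (subset_verts hX) fun v hv => by simp [a', ha0X v hv],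
      combo_eq_of_subset (subset_verts hY) fun v hv => by simp [b', hb0Y v hv], hg',
      combo_eq_of_subset (hFY.trans (subset_verts hY)) hg])
  funext v
  by_cases hvF : v ∈ F
  · rw [ha0 v (by simp [hvF]), hb0 v (by simp [hvF])]
  · have h1 := congrFun this v
    simp only [a', b', Pi.add_apply, hg v hvF, add_zero] at h1
    by_cases hp : perp F v = 0
    · have hp' := perp_eq_zero_iff.1 hp
      have h2 : v ∉ X := fun hv => h.notMem_span hX hFX hv hvF hp'
      have h3 : v ∉ Y := fun hv => h.notMem_span hY hFY hv hvF hp'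
      rw [ha0X v h2, hb0Y v h3]
    · exact mul_right_cancel₀ (inv_ne_zero (norm_ne_zero_iff.2 hp)) h1

lemma IsComplexCone.link_aux (h : IsComplexCone k 𝒳) {F : Finset (Euc d)} (hF : F ∈ Omega 𝒳) :
    (∀ X ∈ 𝒳, F ⊆ X → ∀ Y ∈ 𝒳, F ⊆ Y → ∀ v ∈ X \ F, ∀ w ∈ Y \ F,
      linkVec F v = linkVec F w → v = w) ∧ IsComplexCone (k - F.card) (link 𝒳 F) := by
  have hmem : ∀ Y ∈ (𝒳.filter (F ⊆ ·)).image (· \ F), ∃ X ∈ 𝒳, F ⊆ X ∧ Y = X \ F := by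
    intro Y hY
    obtain ⟨X, hX, rfl⟩ := Finset.mem_image.1 hY
    exact ⟨X, (Finset.mem_filter.1 hX).1, (Finset.mem_filter.1 hX).2, rfl⟩
  have hmem' : ∀ X ∈ 𝒳, F ⊆ X → X \ F ∈ (𝒳.filter (F ⊆ ·)).image (· \ F) := fun X hX hFX =>
    Finset.mem_image_of_mem _ (Finset.mem_filter.2 ⟨hX, hFX⟩)
  have := isComplexCone_image (𝒴 := (𝒳.filter (F ⊆ ·)).image (· \ F)) (e := linkVec F)
    (j := k - F.card) (by
      obtain ⟨X, hX, hFX⟩ := hF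
      exact ⟨_, hmem' X hX hFX⟩) (fun Y hY => by
      obtain ⟨X, hX, hFX, rfl⟩ := hmem Y hY
      rw [Finset.card_sdiff_of_subset hFX, (h.2.1 X hX).1]) (fun Y hY v hv => by
      obtain ⟨X, hX, hFX, rfl⟩ := hmem Y hY
      rw [Finset.mem_sdiff] at hv
      have : perp F v ≠ 0 := fun h0 => h.notMem_span hX hFX hv.1 hv.2 (perp_eq_zero_iff.1 h0)
      rw [linkVec, norm_smul, norm_inv, norm_norm, inv_mul_cancel₀ (norm_ne_zero_iff.2 this)])
      (fun Y₁ hY₁ Y₂ hY₂ a b ha hb ha0 hb0 e => by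
      obtain ⟨X₁, hX₁, hFX₁, rfl⟩ := hmem Y₁ hY₁
      obtain ⟨X₂, hX₂, hFX₂, rfl⟩ := hmem Y₂ hY₂
      exact h.link_coord_eq hX₁ hFX₁ hX₂ hFX₂ ha hb ha0 hb0 e)
  exact ⟨fun X hX hFX Y hY hFY => this.1 _ (hmem' X hX hFX) _ (hmem' Y hY hFY), this.2⟩

lemma IsComplexCone.link_injOn (h : IsComplexCone k 𝒳) {F X : Finset (Euc d)} (hX : X ∈ 𝒳)
    (hFX : F ⊆ X) : Set.InjOn (linkVec F) (X \ F : Finset (Euc d)) := fun v hv w hw e =>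
  (h.link_aux ⟨X, hX, hFX⟩).1 X hX hFX X hX hFX v hv w hw e

/-- A point projects into the cone over a face of the link if and only if it has coordinates
supported in the corresponding face, nonnegative off `F`. -/
lemma IsComplexCone.perp_mem_coneOver_iff (h : IsComplexCone k 𝒳) {F X Z : Finset (Euc d)}
    (hX : X ∈ 𝒳) (hFX : F ⊆ X) (hZ : Z ⊆ X \ F) {q : Euc d} :
    perp F q ∈ coneOver ((Z.image (linkVec F) : Finset (Euc d)) : Set (Euc d)) ↔
      ∃ c : Euc d → ℝ, (∀ v ∉ F, 0 ≤ c v) ∧ (∀ v ∉ Z ∪ F, c v = 0) ∧ q = combo (Z ∪ F) c := by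
  rw [mem_coneOver_image_iff ((h.link_injOn hX hFX).mono (by exact_mod_cast hZ))]
  have hZF : Disjoint Z F := Finset.disjoint_of_subset_left hZ Finset.sdiff_disjoint
  have hne : ∀ v ∈ Z, perp F v ≠ 0 := fun v hv h0 => by
    have := Finset.mem_sdiff.1 (hZ hv)
    exact h.notMem_span hX hFX this.1 this.2 (perp_eq_zero_iff.1 h0)
  constructor
  · rintro ⟨a, ha, ha0, e⟩
    have e' : perp F q = perp F (combo Z fun v => a v * ‖perp F v‖⁻¹) := by
      rw [e, perp_combo, Finset.sdiff_eq_self_of_disjoint hZF]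
      simp only [linkVec, smul_smul]
    obtain ⟨g, hg, hg'⟩ := exists_combo_of_perp_eq e'
    refine ⟨(fun v => a v * ‖perp F v‖⁻¹) + g, fun v hv => ?_, fun v hv => ?_, ?_⟩
    · rw [Pi.add_apply, hg v hv, add_zero]
      exact mul_nonneg (ha v) (by positivity)
    · rw [Finset.mem_union, not_or] at hv
      rw [Pi.add_apply, hg v hv.2, ha0 v hv.1]
      simp
    · rw [map_add, combo_eq_of_subset Finset.subset_union_left fun v hv => by simp [ha0 v hv],
        combo_eq_of_subset Finset.subset_union_right hg, hg']
  · rintro ⟨c, hc, hc0, rfl⟩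
    refine ⟨fun v => if v ∈ Z then c v * ‖perp F v‖ else 0, fun v => ?_,
      fun v hv => if_neg hv, ?_⟩
    · dsimp only
      split_ifs with hv
      · exact mul_nonneg (hc v (Finset.disjoint_left.1 hZF hv)) (norm_nonneg _)
      · exact le_rfl
    · rw [perp_combo, Finset.union_sdiff_right, Finset.sdiff_eq_self_of_disjoint hZF]
      refine Finset.sum_congr rfl fun v hv => ?_
      simp only [hv, if_true]
      rw [linkVec, smul_smul, mul_assoc,
        mul_inv_cancel₀ (norm_ne_zero_iff.2 (hne v hv)), mul_one]

/-- This exhibits the star as the product of `span F` with the cone of the link, which is how stars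
become sets of higher type. -/
lemma IsComplexCone.mem_starCone_iff (h : IsComplexCone k 𝒳) {F : Finset (Euc d)} {q : Euc d} :
    q ∈ starCone 𝒳 F ↔ perp F q ∈ ⋃ X ∈ link 𝒳 F, coneOver (X : Set (Euc d)) := by
  simp only [Set.mem_iUnion, exists_prop]
  constructor
  · rintro ⟨c, ⟨hc, X, hX, hFX, h0⟩, rfl⟩
    refine ⟨(X \ F).image (linkVec F), ?_, ?_⟩
    · exact Finset.mem_image_of_mem _ (Finset.mem_image_of_mem _ (Finset.mem_filter.2 ⟨hX, hFX⟩))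
    · refine (h.perp_mem_coneOver_iff hX hFX subset_rfl).2 ⟨c, hc, ?_, ?_⟩
      · rwa [Finset.sdiff_union_of_subset hFX]
      · rw [Finset.sdiff_union_of_subset hFX, combo_eq_of_subset (subset_verts hX) h0]
  · rintro ⟨Y, hY, hq⟩
    obtain ⟨Y, hY', rfl⟩ := Finset.mem_image.1 hY
    obtain ⟨X, hX, rfl⟩ := Finset.mem_image.1 hY'
    obtain ⟨hX, hFX⟩ := Finset.mem_filter.1 hX
    obtain ⟨c, hc, h0, rfl⟩ := (h.perp_mem_coneOver_iff hX hFX subset_rfl).1 hq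
    rw [Finset.sdiff_union_of_subset hFX] at h0 ⊢
    exact ⟨c, ⟨hc, X, hX, hFX, h0⟩, (combo_eq_of_subset (subset_verts hX) h0).symm⟩

lemma combo_const_eq (F : Finset (Euc d)) {X : Finset (Euc d)} (hFX : F ⊆ X) (s : ℝ) :
    combo X (fun v => if v ∈ F then s else 0) = s • ∑ v ∈ F, v := by
  rw [combo_eq_of_subset hFX fun v hv => if_neg hv, combo_apply, Finset.smul_sum]
  exact Finset.sum_congr rfl fun v hv => by rw [if_pos hv]

lemma coneOver_link_subset (F : Finset (Euc d)) (Z : Finset (Euc d)) :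
    ∀ q ∈ coneOver ((Z.image (linkVec F) : Finset (Euc d)) : Set (Euc d)), perp F q = q := by
  intro q hq
  obtain ⟨c, -, -, rfl⟩ := mem_coneOver_iff.1 hq
  rw [combo_apply, map_sum]
  refine Finset.sum_congr rfl fun v hv => ?_
  obtain ⟨w, -, rfl⟩ := Finset.mem_image.1 hv
  rw [map_smul, linkVec, map_smul, perp_perp]

/-- A point of the link has coordinates on `Z ∪ F` that can be negative only on `F`; a large
multiple of the sum of `F` repairs the signs. -/
lemma IsComplexCone.exists_lift (h : IsComplexCone k 𝒳) {F X Z : Finset (Euc d)}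
    (hX : X ∈ 𝒳) (hFX : F ⊆ X) (hZ : Z ⊆ X \ F) {q : Euc d}
    (hq : q ∈ coneOver ((Z.image (linkVec F) : Finset (Euc d)) : Set (Euc d))) :
    ∃ s₀ : ℝ, ∀ s ≥ s₀, q + s • ∑ v ∈ F, v ∈ coneOver ((Z ∪ F : Finset (Euc d)) : Set (Euc d)) := by
  rw [← coneOver_link_subset F Z q hq] at hq
  obtain ⟨c, hc, h0, rfl⟩ := (h.perp_mem_coneOver_iff hX hFX hZ).1 hq
  obtain ⟨s₀, -, hs, -⟩ := exists_shift F c c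
  refine ⟨s₀, fun s hss => mem_coneOver_iff.2 ⟨c + fun v => if v ∈ F then s else 0,
    fun v => ?_, fun v hv => ?_, ?_⟩⟩
  · by_cases hv : v ∈ F
    · have := hs v hv
      simp only [Pi.add_apply, hv, if_true]
      linarith
    · simpa [hv] using hc v hv
  · have hv' : v ∉ F := fun h => hv (Finset.mem_union_right _ h)
    simp [h0 v hv, hv']
  · rw [map_add, combo_const_eq F Finset.subset_union_right]

lemma IsComplexCone.perp_mem_of_mem (h : IsComplexCone k 𝒳) {F X Z : Finset (Euc d)}
    (hX : X ∈ 𝒳) (hFX : F ⊆ X) (hZ : Z ⊆ X \ F) {q : Euc d}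
    (hq : q ∈ coneOver ((Z ∪ F : Finset (Euc d)) : Set (Euc d))) :
    perp F q ∈ coneOver ((Z.image (linkVec F) : Finset (Euc d)) : Set (Euc d)) := by
  obtain ⟨c, hc, h0, e⟩ := mem_coneOver_iff.1 hq
  exact (h.perp_mem_coneOver_iff hX hFX hZ).2 ⟨c, fun v _ => hc v, h0, e⟩

lemma faceAngles_le_pi (F₁ F₂ : Set (Euc d)) : ∀ θ ∈ faceAngles F₁ F₂, θ ≤ Real.pi := by
  rintro θ ⟨z, -, f₁, -, f₂, -, -, -, rfl⟩
  exact EuclideanGeometry.angle_le_pi _ _ _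

lemma sSup_faceAngles_lt {F₁ F₂ G₁ G₂ : Set (Euc d)} (h : faceAngles F₁ F₂ ⊆ faceAngles G₁ G₂)
    (hG : sSup (faceAngles G₁ G₂) < Real.pi) : sSup (faceAngles F₁ F₂) < Real.pi := by
  rcases (faceAngles F₁ F₂).eq_empty_or_nonempty with h0 | h0
  -- An empty set of angles has supremum `0` by convention.
  · rw [h0, Real.sSup_empty]
    exact Real.pi_pos
  · exact (csSup_le_csSup ⟨Real.pi, fun θ hθ => faceAngles_le_pi _ _ θ hθ⟩ h0 h).trans_lt hG

/-- Every angle of the link already occurs in the original cone: a far translation along `F` carries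
the vertex and both points of the link into the corresponding faces containing `F`, preserving
nearest points and the angle. -/
lemma IsNonFlat.link (h : IsComplexCone k 𝒳) (hn : IsNonFlat k 𝒳) {F : Finset (Euc d)}
    (hF : F ∈ Omega 𝒳) : IsNonFlat (k - F.card) (link 𝒳 F) := by
  have hOm : ∀ Z ∈ Omega (ConeStrata.link 𝒳 F), ∃ X ∈ 𝒳, F ⊆ X ∧ ∃ Y ⊆ X \ F,
      Z = Y.image (linkVec F) := by
    rintro Z ⟨X, hX, hZX⟩
    obtain ⟨X, hX', rfl⟩ := Finset.mem_image.1 hX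
    obtain ⟨X, hX₀, rfl⟩ := Finset.mem_image.1 hX'
    obtain ⟨Y, hY, rfl⟩ := Finset.subset_image_iff.1 hZX
    exact ⟨X, (Finset.mem_filter.1 hX₀).1, (Finset.mem_filter.1 hX₀).2, Y, by exact_mod_cast hY,
      rfl⟩
  intro Y hY hYk Z₁ hZ₁ Z₂ hZ₂ hYZ hc₁ hc₂
  obtain ⟨X₁, hX₁, hFX₁, Z₁, hZX₁, rfl⟩ := hOm Z₁ hZ₁
  obtain ⟨X₂, hX₂, hFX₂, Z₂, hZX₂, rfl⟩ := hOm Z₂ hZ₂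
  have hinj := (h.link_aux hF).1
  have hYe : Y = (Z₁ ∩ Z₂).image (linkVec F) := by
    ext w
    rw [← Finset.mem_coe, hYZ]
    simp only [Set.mem_inter_iff, Finset.mem_coe, Finset.mem_image, Finset.mem_inter]
    constructor
    · rintro ⟨⟨v, hv, rfl⟩, u, hu, e⟩
      have := hinj X₂ hX₂ hFX₂ X₁ hX₁ hFX₁ u (hZX₂ hu) v (hZX₁ hv) e
      subst this
      exact ⟨u, ⟨hv, hu⟩, rfl⟩
    · rintro ⟨v, ⟨h1, h2⟩, rfl⟩
      exact ⟨⟨v, h1, rfl⟩, v, h2, rfl⟩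
  have hd₁ : Disjoint Z₁ F := Finset.disjoint_of_subset_left hZX₁ Finset.sdiff_disjoint
  have hd₂ : Disjoint Z₂ F := Finset.disjoint_of_subset_left hZX₂ Finset.sdiff_disjoint
  have hi₁ := (h.link_injOn hX₁ hFX₁).mono (show (Z₁ : Set (Euc d)) ⊆ _ by exact_mod_cast hZX₁)
  have hi₂ := (h.link_injOn hX₂ hFX₂).mono (show (Z₂ : Set (Euc d)) ⊆ _ by exact_mod_cast hZX₂)
  have hI : Z₁ ∩ Z₂ ⊆ X₁ \ F := Finset.inter_subset_left.trans hZX₁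
  have hi := hi₁.mono (show ((Z₁ ∩ Z₂ : Finset (Euc d)) : Set (Euc d)) ⊆ Z₁ by simp)
  have hunion : (Z₁ ∩ Z₂) ∪ F = (Z₁ ∪ F) ∩ (Z₂ ∪ F) := Finset.inter_union_distrib_right _ _ _
  subst hYe
  rw [Finset.card_image_of_injOn hi] at hYk hc₁ hc₂
  rw [Finset.card_image_of_injOn hi₁] at hc₁
  rw [Finset.card_image_of_injOn hi₂] at hc₂
  have hcI : ((Z₁ ∩ Z₂) ∪ F).card = (Z₁ ∩ Z₂).card + F.card :=
    Finset.card_union_of_disjoint (Finset.disjoint_of_subset_left Finset.inter_subset_left hd₁)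
  have hm₁ : Z₁ ∪ F ⊆ X₁ := Finset.union_subset (hZX₁.trans Finset.sdiff_subset) hFX₁
  have hm₂ : Z₂ ∪ F ⊆ X₂ := Finset.union_subset (hZX₂.trans Finset.sdiff_subset) hFX₂
  refine sSup_faceAngles_lt ?_ (hn ((Z₁ ∩ Z₂) ∪ F) ?_ (by omega) (Z₁ ∪ F) ⟨X₁, hX₁, hm₁⟩
    (Z₂ ∪ F) ⟨X₂, hX₂, hm₂⟩ (by rw [hunion, Finset.coe_inter])
    (by rw [Finset.card_union_of_disjoint hd₁]; omega)
    (by rw [Finset.card_union_of_disjoint hd₂]; omega))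
  · rw [faceAngles, ← hYZ, faceAngles, ← Finset.coe_inter (Z₁ ∪ F), ← hunion]
    rintro θ ⟨z, hz, f₁, hf₁, f₂, hf₂, hd₁, hd₂, rfl⟩
    obtain ⟨s₀, hs₀⟩ := h.exists_lift hX₁ hFX₁ hI hz
    obtain ⟨s₁, hs₁⟩ := h.exists_lift hX₁ hFX₁ hZX₁ hf₁.1
    obtain ⟨s₂, hs₂⟩ := h.exists_lift hX₂ hFX₂ hZX₂ hf₂.1
    set s := max s₀ (max s₁ s₂)
    set y := s • ∑ v ∈ F, v
    have hy : perp F y = 0 := perp_eq_zero_iff.2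
      (Submodule.smul_mem _ _ (Submodule.sum_mem _ fun v hv => Submodule.subset_span hv))
    have key : ∀ (Z : Finset (Euc d)) (f : Euc d),
        f ∈ coneOver ((Z.image (linkVec F) : Finset (Euc d)) : Set (Euc d)) →
        f ∉ coneOver (((Z₁ ∩ Z₂).image (linkVec F) : Finset (Euc d)) : Set (Euc d)) →
        Metric.infDist f (coneOver (((Z₁ ∩ Z₂).image (linkVec F) : Finset (Euc d)) :
          Set (Euc d))) = dist f z →
        f + y ∉ coneOver ((Z₁ ∩ Z₂ ∪ F : Finset (Euc d)) : Set (Euc d)) ∧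
        Metric.infDist (f + y) (coneOver ((Z₁ ∩ Z₂ ∪ F : Finset (Euc d)) : Set (Euc d)))
          = dist (f + y) (z + y) := by
      intro Z f hf hf' hd
      have hpf : perp F (f + y) = f := by rw [map_add, hy, add_zero, coneOver_link_subset F Z f hf]
      refine ⟨fun hmem => hf' ?_, le_antisymm
        (Metric.infDist_le_dist_of_mem (hs₀ s (le_max_left _ _))) ?_⟩
      · have := h.perp_mem_of_mem hX₁ hFX₁ hI hmem
        rwa [hpf] at this
      -- No point of the larger face is nearer, because `perp F` does not increase distances and
      -- sends that face into the face of the link.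
      · refine (Metric.le_infDist ⟨_, hs₀ s (le_max_left _ _)⟩).2 fun u hu => ?_
        rw [dist_add_right, ← hd]
        refine (Metric.infDist_le_dist_of_mem (h.perp_mem_of_mem hX₁ hFX₁ hI hu)).trans ?_
        conv_lhs => rw [← hpf]
        rw [dist_eq_norm, ← map_sub, dist_eq_norm]
        exact norm_perp_le F _
    have k₁ := key Z₁ f₁ hf₁.1 hf₁.2 hd₁
    have k₂ := key Z₂ f₂ hf₂.1 hf₂.2 hd₂
    refine ⟨z + y, hs₀ s (le_max_left _ _), f₁ + y,
      ⟨hs₁ s ((le_max_left _ _).trans (le_max_right _ _)), k₁.1⟩, f₂ + y,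
      ⟨hs₂ s ((le_max_right _ _).trans (le_max_right _ _)), k₂.1⟩, k₁.2, k₂.2, ?_⟩
    simp [EuclideanGeometry.angle]
  · exact ⟨X₁, hX₁, (Finset.union_subset_union_left Finset.inter_subset_left).trans hm₁⟩

end Links

end ConeStrata
namespace ConeStrata
open scoped Classical

/-! ### Non-flat cones are not almost translation invariant -/

/-- This makes a constant uniform over finitely many vertices, faces or isometry classes, for
properties inherited by smaller constants. -/
lemma exists_pos_forall_finite {ι : Type*} {s : Set ι} (hs : s.Finite) {P : ι → ℝ → Prop}
    (hP : ∀ i ∈ s, ∀ a b, 0 < a → a ≤ b → P i b → P i a) (h : ∀ i ∈ s, ∃ a > 0, P i a) :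
    ∃ a > 0, ∀ i ∈ s, P i a := by
  choose! f hf0 hf using h
  rcases s.eq_empty_or_nonempty with rfl | hne
  · exact ⟨1, one_pos, fun i hi => hi.elim⟩
  obtain ⟨j, hj, hmin⟩ := Set.exists_min_image s f hs hne
  exact ⟨f j, hf0 j hj, fun i hi => hP i hi _ _ (hf0 j hj) (hmin i hi) (hf i hi)⟩

section NonFlat

variable {d : ℕ}

/-- With `c = ⟨h, h'⟩ > -1` and `ε = min 1 (1 + c)`, the squared norm `a² + 2cab + b²` is at least
`ε(a² + b²) + (1 - ε)(a - b)²`. -/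
lemma exists_mul_le_norm_add {h h' : Euc d} (hh : ‖h‖ = 1) (hh' : ‖h'‖ = 1)
    (hang : InnerProductGeometry.angle h h' ≠ Real.pi) :
    ∃ μ > 0, ∀ a b : ℝ, 0 ≤ a → 0 ≤ b → μ * a ≤ ‖a • h + b • h'‖ := by
  have hc : -1 < inner ℝ h h' := by
    rw [← InnerProductGeometry.cos_angle_mul_norm_mul_norm, hh, hh', mul_one, mul_one]
    refine lt_of_le_of_ne (Real.neg_one_le_cos _) fun h => hang ?_
    exact InnerProductGeometry.cos_eq_neg_one_iff_angle_eq_pi.1 h.symm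
  set c : ℝ := inner ℝ h h'
  set ε : ℝ := min 1 (1 + c)
  have hε0 : 0 < ε := lt_min one_pos (by linarith)
  have hε1 : ε ≤ 1 := min_le_left _ _
  have hεc : ε ≤ 1 + c := min_le_right _ _
  refine ⟨ε, hε0, fun a b ha hb => ?_⟩
  have h1 : ‖a • h + b • h'‖ ^ 2 = a ^ 2 + 2 * c * (a * b) + b ^ 2 := by
    rw [norm_add_sq_real, norm_smul, norm_smul, hh, hh', inner_smul_left, inner_smul_right]
    simp [c]
    ring
  refine abs_le_of_sq_le_sq' ?_ (norm_nonneg _) |>.2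
  rw [h1]
  nlinarith [mul_nonneg ha hb, mul_nonneg (sub_nonneg.2 hε1) (sq_nonneg (a - b)),
    mul_nonneg (sub_nonneg.2 hεc) (mul_nonneg ha hb), mul_nonneg hε0.le (sq_nonneg b),
    mul_nonneg (mul_nonneg hε0.le (sub_nonneg.2 hε1)) (sq_nonneg a)]

variable {k : ℕ} {𝒳 : Finset (Finset (Euc d))}

lemma smul_mem_starCone {F : Finset (Euc d)} {q : Euc d} (hq : q ∈ starCone 𝒳 F) {a : ℝ}
    (ha : 0 ≤ a) : a • q ∈ starCone 𝒳 F := by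
  obtain ⟨c, ⟨hc, X, hX, hFX, h0⟩, rfl⟩ := hq
  exact ⟨a • c, ⟨fun v hv => mul_nonneg ha (hc v hv), X, hX, hFX, fun v hv => by simp [h0 v hv]⟩,
    by rw [map_smul]⟩

lemma IsComplexCone.mem_starCone_congr (h : IsComplexCone k 𝒳) {F : Finset (Euc d)} {p q : Euc d}
    (e : p - q ∈ Submodule.span ℝ (F : Set (Euc d))) : p ∈ starCone 𝒳 F ↔ q ∈ starCone 𝒳 F := by
  rw [h.mem_starCone_iff, h.mem_starCone_iff,
    show perp F p = perp F q by rw [← sub_eq_zero, ← map_sub, perp_eq_zero_iff.2 e]]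

lemma IsComplexCone.norm_linkVec (h : IsComplexCone k 𝒳) {Y : Finset (Euc d)} {w : Euc d}
    (hw : w ∉ Y) (hY : insert w Y ∈ 𝒳) : ‖linkVec Y w‖ = 1 := by
  have : perp Y w ≠ 0 := fun h0 => h.notMem_span hY (Finset.subset_insert _ _)
    (Finset.mem_insert_self _ _) hw (perp_eq_zero_iff.1 h0)
  rw [linkVec, norm_smul, norm_inv, norm_norm, inv_mul_cancel₀ (norm_ne_zero_iff.2 this)]

lemma IsComplexCone.insert_mem_link {Y : Finset (Euc d)} {w : Euc d}
    (hw : w ∉ Y) (hY : insert w Y ∈ 𝒳) : {linkVec Y w} ∈ link 𝒳 Y := by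
  refine Finset.mem_image.2 ⟨{w}, Finset.mem_image.2 ⟨insert w Y, Finset.mem_filter.2
    ⟨hY, Finset.subset_insert _ _⟩, ?_⟩, Finset.image_singleton _ _⟩
  exact Finset.insert_sdiff_cancel hw

/-- Here `Y` has codimension one, so its link is made of rays. Non-flatness of the link at the empty
face, with vertex `0`, bounds the angle of two distinct rays; equal rays make the angle `0`. -/
lemma IsNonFlat.angle_ne_pi (h : IsComplexCone k 𝒳) (hn : IsNonFlat k 𝒳) {Y : Finset (Euc d)}
    {w w' : Euc d} (hw : w ∉ Y) (hY : insert w Y ∈ 𝒳) (hw' : w' ∉ Y) (hY' : insert w' Y ∈ 𝒳) :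
    InnerProductGeometry.angle (linkVec Y w) (linkVec Y w') ≠ Real.pi := by
  have h1 := h.norm_linkVec hw hY
  have h1' := h.norm_linkVec hw' hY'
  have hne0 : linkVec Y w ≠ 0 := fun h0 => by simp [h0] at h1
  have hne0' : linkVec Y w' ≠ 0 := fun h0 => by simp [h0] at h1'
  by_cases hww : linkVec Y w = linkVec Y w'
  · rw [← hww, InnerProductGeometry.angle_self hne0]
    exact Real.pi_pos.ne
  have hYO : Y ∈ Omega 𝒳 := ⟨_, hY, Finset.subset_insert _ _⟩
  have hk : k = Y.card + 1 := by
    rw [← (h.2.1 _ hY).1, Finset.card_insert_of_notMem hw]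
  have hmem := IsComplexCone.insert_mem_link hw hY
  have hmem' := IsComplexCone.insert_mem_link hw' hY'
  have hI : ((∅ : Finset (Euc d)) : Set (Euc d)) =
      (({linkVec Y w} : Finset (Euc d)) : Set (Euc d)) ∩
      (({linkVec Y w'} : Finset (Euc d)) : Set (Euc d)) := by
    ext x
    simp only [Finset.coe_empty, Finset.coe_singleton, Set.mem_inter_iff, Set.mem_singleton_iff,
      Set.mem_empty_iff_false, false_iff, not_and]
    rintro rfl
    exact hww
  have := hn.link h hYO ∅ ⟨_, hmem, by simp⟩ (by simp [hk]) {linkVec Y w} (mem_Omega_self hmem)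
    {linkVec Y w'} (mem_Omega_self hmem') hI (by simp) (by simp)
  have h0 : coneOver ((∅ : Finset (Euc d)) : Set (Euc d)) = {0} := by
    ext y
    rw [mem_coneOver_iff]
    constructor
    · rintro ⟨c, -, -, rfl⟩
      simp [combo_apply]
    · rintro rfl
      exact ⟨0, by simp, by simp, by simp⟩
  have hs : ∀ v : Euc d, v ∈ coneOver (({v} : Finset (Euc d)) : Set (Euc d)) := fun v =>
    Or.inr ⟨1, zero_le_one, v, subset_convexHull _ _ (by simp), by simp⟩
  refine ne_of_lt (lt_of_le_of_lt (le_csSup ⟨Real.pi, fun θ hθ => faceAngles_le_pi _ _ θ hθ⟩ ?_)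
    this)
  rw [faceAngles, ← hI, h0]
  exact ⟨0, rfl, _, ⟨hs _, hne0⟩, _, ⟨hs _, hne0'⟩, by simp, by simp,
    by simp [EuclideanGeometry.angle]⟩

/-- A generating set containing a face of codimension one has a single further vertex, so its part
of the star projects to a ray. -/
lemma IsComplexCone.perp_starCone (h : IsComplexCone k 𝒳) {Y : Finset (Euc d)}
    (hk : k = Y.card + 1) {p : Euc d} (hp : p ∈ starCone 𝒳 Y) :
    ∃ w, w ∉ Y ∧ insert w Y ∈ 𝒳 ∧ ∃ a : ℝ, 0 ≤ a ∧ perp Y p = a • linkVec Y w := by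
  obtain ⟨c, ⟨hc, X, hX, hYX, h0⟩, rfl⟩ := hp
  have hcard : (X \ Y).card = 1 := by
    rw [Finset.card_sdiff_of_subset hYX, (h.2.1 X hX).1, hk]
    omega
  obtain ⟨w, hw⟩ := Finset.card_eq_one.1 hcard
  have hwm : w ∈ X \ Y := by simp [hw]
  rw [Finset.mem_sdiff] at hwm
  have hX' : insert w Y = X := by
    rw [Finset.insert_eq, ← hw, Finset.sdiff_union_of_subset hYX]
  subst hX'
  have hne : perp Y w ≠ 0 := fun h0 => h.notMem_span hX hYX
    (Finset.mem_insert_self _ _) hwm.2 (perp_eq_zero_iff.1 h0)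
  refine ⟨w, hwm.2, hX, c w * ‖perp Y w‖, mul_nonneg (hc w hwm.2) (norm_nonneg _), ?_⟩
  rw [combo_eq_of_subset (subset_verts hX) h0, perp_combo, hw, Finset.sum_singleton, linkVec,
    smul_smul, mul_assoc, mul_inv_cancel₀ (norm_ne_zero_iff.2 hne), mul_one]

/-- Around a face of codimension one, a non-flat cone is nearly invariant in the directions of
the face only. -/
lemma IsNonFlat.exists_perp_le (h : IsComplexCone k 𝒳) (hn : IsNonFlat k 𝒳) {Y : Finset (Euc d)}
    (hk : k = Y.card + 1) :
    ∃ μ > 0, ∀ u p q : Euc d, ∀ τ : ℝ, p ∈ starCone 𝒳 Y → q ∈ starCone 𝒳 Y → ‖u - p‖ ≤ τ →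
      ‖-u - q‖ ≤ τ → μ * ‖perp Y u‖ ≤ τ := by
  have hfin : {w | w ∉ Y ∧ insert w Y ∈ 𝒳}.Finite :=
    (verts 𝒳).finite_toSet.subset fun w hw => subset_verts hw.2 (Finset.mem_insert_self _ _)
  obtain ⟨μ, hμ, H⟩ := exists_pos_forall_finite (hfin.prod hfin)
    (P := fun ww μ => ∀ a b : ℝ, 0 ≤ a → 0 ≤ b → μ * a ≤ ‖a • linkVec Y ww.1 + b • linkVec Y ww.2‖)
    (fun ww _ μ μ' _ hμ H a b ha hb => (by gcongr : μ * a ≤ μ' * a).trans (H a b ha hb))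
    (fun ww hw => exists_mul_le_norm_add (h.norm_linkVec hw.1.1 hw.1.2)
      (h.norm_linkVec hw.2.1 hw.2.2) (hn.angle_ne_pi h hw.1.1 hw.1.2 hw.2.1 hw.2.2))
  refine ⟨(1 + 2 / μ)⁻¹, by positivity, fun u p q τ hp hq hup huq => ?_⟩
  obtain ⟨w, hwY, hw, a, ha, hpa⟩ := h.perp_starCone hk hp
  obtain ⟨w', hwY', hw', b, hb, hqb⟩ := h.perp_starCone hk hq
  have h1 : ‖perp Y u - a • linkVec Y w‖ ≤ τ := by
    rw [← hpa, ← map_sub]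
    exact (norm_perp_le _ _).trans hup
  have h2 : ‖-perp Y u - b • linkVec Y w'‖ ≤ τ := by
    rw [← hqb, ← map_neg, ← map_sub]
    exact (norm_perp_le _ _).trans huq
  -- Adding the two approximations cancels `perp Y u` and leaves a short nonnegative combination of
  -- two rays that are not opposite.
  have h3 : μ * a ≤ 2 * τ := by
    refine (H (w, w') ⟨⟨hwY, hw⟩, hwY', hw'⟩ a b ha hb).trans ?_
    have : a • linkVec Y w + b • linkVec Y w' =
        -((perp Y u - a • linkVec Y w) + (-perp Y u - b • linkVec Y w')) := by abel
    rw [this, norm_neg]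
    exact (norm_add_le _ _).trans (by linarith)
  have h4 : ‖perp Y u‖ ≤ τ + a := by
    have : perp Y u = (perp Y u - a • linkVec Y w) + a • linkVec Y w := by abel
    rw [this]
    refine (norm_add_le _ _).trans (add_le_add h1 ?_)
    rw [norm_smul, h.norm_linkVec hwY hw, mul_one, Real.norm_of_nonneg ha]
  rw [inv_mul_le_iff₀ (by positivity)]
  have h5 : a ≤ 2 * τ / μ := by rwa [le_div_iff₀ hμ, mul_comm]
  calc _ ≤ τ + a := h4
    _ ≤ τ + 2 * τ / μ := by gcongr
    _ = _ := by ring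

/-- A vector orthogonal to a proper face `F` of `X` is transversal to some facet of `X` that
contains `F`. -/
lemma IsComplexCone.exists_transversal (h : IsComplexCone k 𝒳) {F X : Finset (Euc d)}
    (hX : X ∈ 𝒳) (hFX : F ⊆ X) (hF : F.card < k) :
    ∃ μ > 0, ∀ u ∈ (Submodule.span ℝ (F : Set (Euc d)))ᗮ, ∃ v ∈ X \ F,
      μ * ‖u‖ ≤ ‖perp (X.erase v) u‖ := by
  have hne : (X \ F).Nonempty := by
    rw [← Finset.card_pos, Finset.card_sdiff_of_subset hFX, (h.2.1 X hX).1]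
    omega
  let A : (Submodule.span ℝ (F : Set (Euc d)))ᗮ →ₗ[ℝ] ((X \ F : Finset (Euc d)) → Euc d) :=
    LinearMap.pi fun v => (perp (X.erase v.1)).toLinearMap ∘ₗ Submodule.subtype _
  -- A kernel vector lies in the span of `X.erase v` for each `v ∈ X \ F`. By linear independence
  -- these spans meet in `span F`, to which the vector is orthogonal.
  have hker : LinearMap.ker A = ⊥ := by
    rw [LinearMap.ker_eq_bot']
    rintro ⟨u, hu⟩ h0
    have h1 : ∀ v ∈ X \ F, u ∈ Submodule.span ℝ (X.erase v : Set (Euc d)) := fun v hv => by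
      have h2 := congrFun h0 ⟨v, hv⟩
      exact perp_eq_zero_iff.1 h2
    obtain ⟨v₀, hv₀⟩ := hne
    obtain ⟨c, hc, hcu⟩ := exists_combo_of_mem_span
      (Submodule.span_mono (Finset.coe_subset.2 (Finset.erase_subset v₀ X))
        (h1 v₀ hv₀) : u ∈ Submodule.span ℝ (X : Set (Euc d)))
    have hcF : ∀ v ∉ F, c v = 0 := fun v hv => by
      by_cases hvX : v ∈ X
      · have h3 := h1 v (Finset.mem_sdiff.2 ⟨hvX, hv⟩)
        obtain ⟨g, hg, hgu⟩ := exists_combo_of_mem_span h3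
        have : c = g := combo_injOn (h.2.1 X hX).linearIndepOn hc
          (fun w hw => hg w fun h' => hw (Finset.mem_of_mem_erase h'))
          (by rw [← hcu, hgu, combo_eq_of_subset (Finset.erase_subset v X) hg])
        rw [this]
        exact hg v (Finset.notMem_erase v X)
      · exact hc v hvX
    have huF : u ∈ Submodule.span ℝ (F : Set (Euc d)) := by
      rw [hcu, combo_eq_of_subset hFX hcF]
      exact combo_mem_span F c
    have : u = 0 := by
      have := Submodule.inner_right_of_mem_orthogonal huF hu
      exact inner_self_eq_zero.1 this
    simpa using this
  obtain ⟨K, hK0, hK⟩ := LinearMap.exists_antilipschitzWith A hker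
  refine ⟨(K : ℝ)⁻¹, by positivity, fun u hu => ?_⟩
  have : Nonempty (X \ F : Finset (Euc d)) := hne.to_subtype
  obtain ⟨v, hv⟩ := Finite.exists_max fun v : (X \ F : Finset (Euc d)) => ‖A ⟨u, hu⟩ v‖
  refine ⟨v.1, v.2, ?_⟩
  rw [inv_mul_le_iff₀ (by exact_mod_cast hK0)]
  have h1 : ‖u‖ ≤ K * ‖A ⟨u, hu⟩‖ := by
    simpa using hK.le_mul_dist ⟨u, hu⟩ 0
  refine h1.trans ?_
  gcongr
  exact (pi_norm_le_iff_of_nonneg (norm_nonneg _)).2 hv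

lemma norm_sum_le_card (h : IsComplexCone k 𝒳) {Y : Finset (Euc d)} (hY : Y ∈ Omega 𝒳) :
    ‖∑ v ∈ Y, v‖ ≤ k := by
  obtain ⟨X, hX, hYX⟩ := hY
  calc ‖∑ v ∈ Y, v‖ ≤ ∑ v ∈ Y, ‖v‖ := norm_sum_le _ _
    _ = Y.card := by
      rw [Finset.sum_congr rfl fun v hv => (h.2.1 X hX).2.1 v (hYX hv)]
      simp
    _ ≤ k := by
      rw [← (h.2.1 X hX).1]
      exact_mod_cast Finset.card_le_card hYX

/-- Near a point of a face `F`, a non-flat complex cone is not almost invariant in any direction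
orthogonal to `F`. -/
theorem IsNonFlat.exists_not_almost_invariant (h : IsComplexCone k 𝒳) (hn : IsNonFlat k 𝒳) :
    ∃ δ > 0, ∀ F ∈ Omega 𝒳, F.card < k → ∀ y ∈ coneOver (F : Set (Euc d)),
      ∀ u ∈ (Submodule.span ℝ (F : Set (Euc d)))ᗮ, 1 / 2 ≤ ‖u‖ → ‖u‖ ≤ 1 → ∀ r > 0,
      ¬ ∀ z ∈ starCone 𝒳 ∅, ‖z - y‖ < r → ∀ s : ℝ, |s| < r →
        ∃ q ∈ starCone 𝒳 ∅, ‖z + s • u - q‖ ≤ δ * r := by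
  obtain ⟨κ, hκ1, hκ⟩ := h.exists_lipschitz
  obtain ⟨μ, hμ0, hμ⟩ := exists_pos_forall_finite (finite_Omega 𝒳)
    (P := fun Y μ => k = Y.card + 1 → ∀ u p q : Euc d, ∀ τ : ℝ, p ∈ starCone 𝒳 Y →
      q ∈ starCone 𝒳 Y → ‖u - p‖ ≤ τ → ‖-u - q‖ ≤ τ → μ * ‖perp Y u‖ ≤ τ)
    (fun Y _ a b _ hab H hk u p q τ hp hq h1 h2 =>
      (by gcongr : a * ‖perp Y u‖ ≤ b * ‖perp Y u‖).trans (H hk u p q τ hp hq h1 h2))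
    (fun Y _ => by
      by_cases hk : k = Y.card + 1
      · obtain ⟨μ, hμ, H⟩ := hn.exists_perp_le h hk
        exact ⟨μ, hμ, fun _ => H⟩
      · exact ⟨1, one_pos, fun h => (hk h).elim⟩)
  obtain ⟨ν, hν0, hν⟩ := exists_pos_forall_finite ((finite_Omega 𝒳).prod 𝒳.finite_toSet)
    (P := fun FX ν => FX.1 ⊆ FX.2 → FX.1.card < k →
      ∀ u ∈ (Submodule.span ℝ (FX.1 : Set (Euc d)))ᗮ, ∃ v ∈ FX.2 \ FX.1,
        ν * ‖u‖ ≤ ‖perp (FX.2.erase v) u‖)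
    (fun FX _ a b _ hab H h1 h2 u hu => by
      obtain ⟨v, hv, h3⟩ := H h1 h2 u hu
      exact ⟨v, hv, (by gcongr : a * ‖u‖ ≤ b * ‖u‖).trans h3⟩)
    (fun FX hFX => by
      by_cases hc : FX.1 ⊆ FX.2 ∧ FX.1.card < k
      · obtain ⟨ν, hν, H⟩ := h.exists_transversal hFX.2 hc.1 hc.2
        exact ⟨ν, hν, fun _ _ => H⟩
      · exact ⟨1, one_pos, fun h1 h2 => (hc ⟨h1, h2⟩).elim⟩)
  -- The sum of a face has norm at most `k`, so `η` times this sum displaces by less than `1`.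
  set η : ℝ := 1 / (2 * (k + 1)) with hη
  have hη0 : 0 < η := by positivity
  have hκ0 : 0 < κ := by linarith
  -- The first bound gives `δ r ≤ ρ / 4` for the radius `ρ` below. The second makes the rescaled
  -- error at most `μ ν / 4`, whereas transversality would force at least `μ ν / 2`.
  refine ⟨min (η / (8 * κ)) (η * μ * ν / (16 * κ)), by positivity, ?_⟩
  set δ := min (η / (8 * κ)) (η * μ * ν / (16 * κ))
  have hδ0 : 0 < δ := by positivity
  intro F hF hFk y hy u hu hu2 hu1 r hr H
  obtain ⟨X, hX, hFX⟩ := hF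
  obtain ⟨v, hv, hvu⟩ := hν (F, X) ⟨⟨X, hX, hFX⟩, hX⟩ hFX hFk u hu
  dsimp only at hv hvu
  rw [Finset.mem_sdiff] at hv
  set Y := X.erase v
  have hYX : Y ⊆ X := Finset.erase_subset v X
  have hFY : F ⊆ Y := fun w hw => Finset.mem_erase.2 ⟨fun e => hv.2 (e ▸ hw), hFX hw⟩
  have hYO : Y ∈ Omega 𝒳 := ⟨X, hX, hYX⟩
  have hYk : k = Y.card + 1 := by
    rw [Finset.card_erase_add_one hv.1, (h.2.1 X hX).1]
  obtain ⟨c, hc, hc0, rfl⟩ := mem_coneOver_iff.1 hy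
  -- Moving from `y` inside `C(Y)` makes every coordinate on `Y` at least `η r`, so the cone is the
  -- star of `Y` in a ball of radius `ρ` around the new point `z`.
  set b : Euc d → ℝ := c + fun w => if w ∈ Y then η * r else 0
  have hb : IsCoord 𝒳 ∅ b := by
    refine ⟨fun w _ => add_nonneg (hc w) (by dsimp only; split_ifs <;> positivity), X, hX, by simp,
      fun w hw => ?_⟩
    have h1 : w ∉ Y := fun h' => hw (hYX h')
    have h2 : w ∉ F := fun h' => hw (hFX h')
    simp [b, h1, hc0 w h2]
  set z := combo (verts 𝒳) b with hz
  have hzy : z = combo F c + (η * r) • ∑ w ∈ Y, w := by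
    rw [hz, map_add, combo_const_eq Y (hYX.trans (subset_verts hX)),
      combo_eq_of_subset (hFX.trans (subset_verts hX)) hc0]
  have hzY : z ∈ Submodule.span ℝ (Y : Set (Euc d)) := by
    rw [hzy]
    exact add_mem (Submodule.span_mono (by exact_mod_cast hFY) (combo_mem_span F c))
      (Submodule.smul_mem _ _ (Submodule.sum_mem _ fun w hw => Submodule.subset_span hw))
  set ρ := η * r / (2 * κ) with hρ
  have hρ0 : 0 < ρ := by positivity
  have hloc := starCone_inter_ball hκ hκ0 (F := Y) hb (r := ρ) (fun w hw => by
    have h1 : κ * ρ = η * r / 2 := by rw [hρ]; field_simp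
    have h2 : 0 < η * r := by positivity
    simp only [b, Pi.add_apply, hw, if_true]
    linarith [hc w])
  have hη1 : η * (k + 1) = 1 / 2 := by rw [hη]; field_simp
  have hρr : ρ < r := by
    rw [hρ, div_lt_iff₀ (by positivity)]
    have : η ≤ 1 / 2 := by nlinarith [show (0 : ℝ) ≤ k from Nat.cast_nonneg k]
    nlinarith
  have hzT : z ∈ starCone 𝒳 ∅ := ⟨b, hb, rfl⟩
  have hzr : ‖z - combo F c‖ < r := by
    rw [hzy, add_sub_cancel_left, norm_smul, Real.norm_of_nonneg (by positivity)]
    have := norm_sum_le_card h hYO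
    calc η * r * ‖∑ w ∈ Y, w‖ ≤ η * r * k := by gcongr
      _ < r := by nlinarith
  have hδ1 : δ * r ≤ ρ / 4 := by
    have : δ ≤ η / (8 * κ) := min_le_left _ _
    calc δ * r ≤ η / (8 * κ) * r := by gcongr
      _ = ρ / 4 := by rw [hρ]; field_simp; norm_num
  -- Since `z ∈ span Y`, subtracting it does not leave the star.
  have key : ∀ s : ℝ, |s| = ρ / 2 → ∃ q ∈ starCone 𝒳 Y, ‖s • u - q‖ ≤ δ * r := by
    intro s hs
    obtain ⟨q, hq, hqz⟩ := H z hzT hzr s (by rw [hs]; linarith)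
    refine ⟨q - z, ?_, by rwa [show s • u - (q - z) = z + s • u - q by abel]⟩
    refine (h.mem_starCone_congr (show (q - z) - q ∈ _ by
      rw [sub_sub_cancel_left]; exact neg_mem hzY)).2 ?_
    have : q ∈ starCone 𝒳 ∅ ∩ Metric.ball z ρ := by
      refine ⟨hq, ?_⟩
      rw [mem_ball_iff_norm]
      have h1 : q - z = s • u - (z + s • u - q) := by abel
      have h2 : ‖s • u‖ ≤ ρ / 2 := by
        rw [norm_smul, Real.norm_eq_abs, hs]
        nlinarith
      calc ‖q - z‖ ≤ ‖s • u‖ + ‖z + s • u - q‖ := by rw [h1]; exact norm_sub_le _ _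
        _ ≤ ρ / 2 + ρ / 4 := add_le_add h2 (hqz.trans hδ1)
        _ < ρ := by linarith
    rw [hloc] at this
    exact this.1
  have key' : ∀ s : ℝ, |s| = ρ / 2 → ∃ q ∈ starCone 𝒳 Y,
      ‖(2 / ρ * s) • u - q‖ ≤ 2 / ρ * (δ * r) := by
    intro s hs
    obtain ⟨q, hq, hqs⟩ := key s hs
    refine ⟨(2 / ρ) • q, smul_mem_starCone hq (by positivity), ?_⟩
    rw [mul_smul, ← smul_sub, norm_smul, Real.norm_of_nonneg (by positivity)]
    gcongr
  obtain ⟨p, hp, hup⟩ := key' (ρ / 2) (abs_of_pos (by positivity))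
  obtain ⟨q, hq, huq⟩ := key' (-(ρ / 2)) (by rw [abs_neg, abs_of_pos (by positivity)])
  rw [show 2 / ρ * (ρ / 2) = 1 by field_simp, one_smul] at hup
  rw [show 2 / ρ * -(ρ / 2) = -1 by field_simp, neg_one_smul] at huq
  have h1 := hμ Y hYO hYk u p q _ hp hq hup huq
  have h2 : 2 / ρ * (δ * r) ≤ μ * ν / 4 := by
    have : δ ≤ η * μ * ν / (16 * κ) := min_le_right _ _
    calc 2 / ρ * (δ * r) = δ * (4 * κ / η) := by rw [hρ]; field_simp; norm_num
      _ ≤ η * μ * ν / (16 * κ) * (4 * κ / η) := by gcongr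
      _ = μ * ν / 4 := by field_simp; norm_num
  have h3 : μ * (ν * ‖u‖) ≤ μ * ν / 4 := by
    refine le_trans ?_ (h1.trans h2)
    gcongr
  have h4 : μ * ν * (1 / 2) ≤ μ * ν * ‖u‖ := by gcongr
  have h5 : 0 < μ * ν := by positivity
  nlinarith

end NonFlat

end ConeStrata
namespace ConeStrata
open scoped Classical

/-! ### The product `S × ℝ^m × {0}` -/

section Product

variable {N N' : ℕ}

/-- The first `N'` coordinates of a point of `ℝ^N`. -/
noncomputable def head (N' : ℕ) : Euc N →ₗ[ℝ] Euc N' where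
  toFun x := WithLp.toLp 2 fun l => if h : (l : ℕ) < N then x ⟨l, h⟩ else 0
  map_add' x y := by
    ext l
    by_cases h : (l : ℕ) < N <;> simp [h]
  map_smul' a x := by
    ext l
    by_cases h : (l : ℕ) < N <;> simp [h]

/-- The inclusion of `ℝ^N'` in `ℝ^N` as the space of the first `N'` coordinates. -/
noncomputable def emb (N : ℕ) : Euc N' →ₗ[ℝ] Euc N where
  toFun y := WithLp.toLp 2 fun i => if h : (i : ℕ) < N' then y ⟨i, h⟩ else 0
  map_add' x y := by
    ext l
    by_cases h : (l : ℕ) < N' <;> simp [h]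
  map_smul' a x := by
    ext l
    by_cases h : (l : ℕ) < N' <;> simp [h]

lemma emb_apply (y : Euc N') (i : Fin N) :
    emb N y i = if h : (i : ℕ) < N' then y ⟨i, h⟩ else 0 := rfl

lemma head_apply (x : Euc N) (l : Fin N') :
    head N' x l = if h : (l : ℕ) < N then x ⟨l, h⟩ else 0 := rfl

lemma head_emb (h : N' ≤ N) (y : Euc N') : head N' (emb N y) = y := by
  ext l
  simp [head_apply, emb_apply, l.2.trans_le h]

lemma inner_emb (h : N' ≤ N) (y : Euc N') (x : Euc N) :
    inner ℝ (emb N y) x = inner ℝ y (head N' x) := by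
  rw [PiLp.inner_apply, PiLp.inner_apply]
  symm
  refine Finset.sum_of_injOn (Fin.castLE h) (Fin.castLE_injective h).injOn (by simp) ?_ ?_
  · intro i _ hi
    have : ¬ (i : ℕ) < N' := fun hlt => hi ⟨⟨i, hlt⟩, by simp, rfl⟩
    simp [emb_apply, this]
  · intro l _
    have : (l : ℕ) < N := l.2.trans_le h
    simp [emb_apply, head_apply, this, Fin.castLE]

lemma norm_emb (h : N' ≤ N) (y : Euc N') : ‖emb N y‖ = ‖y‖ := by
  have : ‖emb N y‖ ^ 2 = ‖y‖ ^ 2 := by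
    rw [← real_inner_self_eq_norm_sq, inner_emb h, head_emb h, real_inner_self_eq_norm_sq]
  exact (pow_left_inj₀ (norm_nonneg _) (norm_nonneg _) two_ne_zero).1 this

lemma norm_le_of_abs_le {x y : Euc N} (h : ∀ i, |x i| ≤ |y i|) : ‖x‖ ≤ ‖y‖ := by
  rw [EuclideanSpace.norm_eq, EuclideanSpace.norm_eq]
  refine Real.sqrt_le_sqrt (Finset.sum_le_sum fun i _ => ?_)
  rw [Real.norm_eq_abs, Real.norm_eq_abs]
  exact pow_le_pow_left₀ (abs_nonneg _) (h i) 2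

lemma emb_head_apply (x : Euc N) (i : Fin N) :
    emb N (head N' x) i = if (i : ℕ) < N' then x i else 0 := by
  by_cases h : (i : ℕ) < N' <;> simp [emb_apply, head_apply, h]

lemma norm_head_le (h : N' ≤ N) (x : Euc N) : ‖head N' x‖ ≤ ‖x‖ := by
  rw [← norm_emb h]
  refine norm_le_of_abs_le fun i => ?_
  rw [emb_head_apply]
  split_ifs <;> simp

lemma mem_prodFlat_iff (h : N' ≤ N) {m : ℕ} {S : Set (Euc N')} {x : Euc N} :
    x ∈ prodFlat m S ↔ head N' x ∈ S ∧ ∀ i : Fin N, N' + m ≤ (i : ℕ) → x i = 0 := by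
  refine and_congr_left fun _ => ⟨?_, fun hx => ⟨_, hx, fun i hi => ?_⟩⟩
  · rintro ⟨y, hy, hxy⟩
    have : head N' x = y := by
      ext l
      have hl : (l : ℕ) < N := l.2.trans_le h
      rw [head_apply, dif_pos hl, hxy ⟨l, hl⟩ l.2]
    rwa [this]
  · rw [head_apply, dif_pos i.2]

lemma prodFlat_mono {m : ℕ} {S S' : Set (Euc N')} (h : S ⊆ S') :
    (prodFlat m S : Set (Euc N)) ⊆ prodFlat m S' := fun _ ⟨⟨y, hy, hxy⟩, h0⟩ =>
  ⟨⟨y, h hy, hxy⟩, h0⟩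

/-- The coordinate subspace of the `j` coordinates starting at position `a`. -/
def coordFlat (N a j : ℕ) : Submodule ℝ (Euc N) where
  carrier := {x | ∀ i : Fin N, ((i : ℕ) < a ∨ a + j ≤ (i : ℕ)) → x i = 0}
  add_mem' hx hy i hi := by simp [hx i hi, hy i hi]
  zero_mem' i _ := by simp
  smul_mem' c x hx i hi := by simp [hx i hi]

lemma mem_coordFlat {a j : ℕ} {x : Euc N} :
    x ∈ coordFlat N a j ↔ ∀ i : Fin N, ((i : ℕ) < a ∨ a + j ≤ (i : ℕ)) → x i = 0 := Iff.rfl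

lemma finrank_coordFlat {a j : ℕ} (h : a + j ≤ N) : Module.finrank ℝ (coordFlat N a j) = j := by
  let f : (Fin j → ℝ) →ₗ[ℝ] Euc N :=
    { toFun := fun y => WithLp.toLp 2 fun i =>
        if h : a ≤ (i : ℕ) ∧ (i : ℕ) < a + j then y ⟨i - a, by omega⟩ else 0
      map_add' := fun x y => by
        ext i
        by_cases h : a ≤ (i : ℕ) ∧ (i : ℕ) < a + j <;> simp [h]
      map_smul' := fun c x => by
        ext i
        by_cases h : a ≤ (i : ℕ) ∧ (i : ℕ) < a + j <;> simp [h] }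
  have hf : ∀ y i, f y i = if h : a ≤ (i : ℕ) ∧ (i : ℕ) < a + j then y ⟨i - a, by omega⟩ else 0 :=
    fun _ _ => rfl
  have hinj : Function.Injective f := by
    intro y y' e
    funext l
    have := congrArg (fun x : Euc N => x ⟨a + l, by omega⟩) e
    simpa [hf] using this
  have hr : LinearMap.range f = coordFlat N a j := by
    ext x
    rw [LinearMap.mem_range, mem_coordFlat]
    constructor
    · rintro ⟨y, rfl⟩ i hi
      rw [hf, dif_neg (by omega)]
    · intro hx
      refine ⟨fun l => x ⟨a + l, by omega⟩, ?_⟩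
      ext i
      rw [hf]
      split_ifs with hi
      · exact congrArg (fun q : Fin N => x q) (Fin.ext (show a + ((i : ℕ) - a) = i by omega))
      · exact (hx i (by omega)).symm
  rw [← hr, LinearMap.finrank_range_of_inj hinj, Module.finrank_fin_fun]

/-- Two subspaces of the same dimension orthogonal to `H` are exchanged by an isometry that
fixes `H`. -/
lemma exists_isometry_fixing {E : Type*} [NormedAddCommGroup E] [InnerProductSpace ℝ E]
    [FiniteDimensional ℝ E] {H S₁ S₂ : Submodule ℝ E} (h₁ : S₁ ≤ Hᗮ) (h₂ : S₂ ≤ Hᗮ)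
    (hd : Module.finrank ℝ S₁ = Module.finrank ℝ S₂) :
    ∃ Φ : E ≃ₗᵢ[ℝ] E, (∀ x ∈ H, Φ x = x) ∧ ∀ x, Φ x ∈ S₂ ↔ x ∈ S₁ := by
  let e : S₁ ≃ₗᵢ[ℝ] S₂ := (stdOrthonormalBasis ℝ S₁).equiv (stdOrthonormalBasis ℝ S₂)
    (finCongr hd)
  let S₁' : Submodule ℝ Hᗮ := S₁.comap Hᗮ.subtype
  -- The isometry from `S₁` onto `S₂` is extended within `Hᗮ` and then completed by the identity on
  -- `H`.
  let L : S₁' →ₗᵢ[ℝ] Hᗮ :=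
    { toLinearMap := (Submodule.inclusion h₂) ∘ₗ e.toLinearEquiv.toLinearMap ∘ₗ
        ((Hᗮ.subtype ∘ₗ S₁'.subtype).codRestrict S₁ fun x => x.2)
      norm_map' := fun x => by
        have h1 := e.norm_map ⟨x.1.1, x.2⟩
        exact h1 }
  have hL : ∀ x (hx : x ∈ S₁), ((L ⟨⟨x, h₁ hx⟩, hx⟩ : Hᗮ) : E) = e ⟨x, hx⟩ := fun x hx => rfl
  let Λ : Hᗮ ≃ₗᵢ[ℝ] Hᗮ := L.extend.toLinearIsometryEquiv rfl
  have hΛ : ∀ x (hx : x ∈ S₁), ((Λ ⟨x, h₁ hx⟩ : Hᗮ) : E) = e ⟨x, hx⟩ := fun x hx => by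
    rw [← hL x hx, ← L.extend_apply]
    rfl
  let Φ : E ≃ₗᵢ[ℝ] E := (H.orthogonalDecomposition.trans
    (LinearIsometryEquiv.withLpProdCongr 2 (LinearIsometryEquiv.refl ℝ H) Λ)).trans
      H.orthogonalDecomposition.symm
  have hΦ : ∀ x, Φ x = (H.orthogonalProjectionOnto x : E) +
      (Λ (Hᗮ.orthogonalProjectionOnto x) : Hᗮ) := fun x => by simp [Φ]
  have hΦ' : ∀ x (hx : x ∈ Hᗮ), Φ x = (Λ ⟨x, hx⟩ : Hᗮ) := fun x hx => by
    rw [hΦ, Submodule.orthogonalProjectionOnto_eq_zero_iff.2 hx,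
      Submodule.orthogonalProjectionOnto_mem_subspace_eq_self (K := Hᗮ) ⟨x, hx⟩]
    simp
  have hsub : ∀ x ∈ S₁, Φ x ∈ S₂ := fun x hx => by
    rw [hΦ' x (h₁ hx), hΛ x hx]
    exact (e ⟨x, hx⟩).2
  refine ⟨Φ, fun x hx => ?_, fun x => ⟨fun hx => ?_, hsub x⟩⟩
  · rw [hΦ, Submodule.orthogonalProjectionOnto_mem_subspace_eq_self (K := H) ⟨x, hx⟩,
      Submodule.orthogonalProjectionOnto_eq_zero_iff.2
        (by rwa [Submodule.orthogonal_orthogonal])]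
    simp
  · have : S₁.map Φ.toLinearEquiv.toLinearMap = S₂ := by
      refine Submodule.eq_of_le_of_finrank_eq ?_ ?_
      · rintro _ ⟨y, hy, rfl⟩
        exact hsub y hy
      · rw [← hd]
        exact LinearEquiv.finrank_map_eq Φ.toLinearEquiv S₁
    rw [← this] at hx
    obtain ⟨y, hy, e⟩ := hx
    rwa [← Φ.injective e]

end Product

end ConeStrata
namespace ConeStrata
open scoped Classical

/-! ### Types of stars, and invariance -/

section Types

variable {N N' n : ℕ}

lemma exists_linear_part (R : Euc N ≃ᵢ Euc N) :
    ∃ Λ : Euc N ≃ₗᵢ[ℝ] Euc N, ∀ x v, R (x + v) = R x + Λ v := by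
  refine ⟨R.toRealAffineIsometryEquiv.linearIsometryEquiv, fun x v => ?_⟩
  have := R.toRealAffineIsometryEquiv.map_vadd x v
  rw [add_comm x, add_comm (R x)]
  exact this

lemma image_trans_image (R R' : Euc N ≃ᵢ Euc N) (W : Set (Euc N)) :
    (R.trans R') '' W = R' '' (R '' W) := by
  rw [← Set.image_comp]
  rfl

lemma IsTypeSet.image {m : ℕ} {W : Set (Euc N)} (h : IsTypeSet n N' m W) (R : Euc N ≃ᵢ Euc N) :
    IsTypeSet n N' m (R '' W) := by
  obtain ⟨𝒳, R₀, hm, h1, h2, rfl⟩ := h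
  exact ⟨𝒳, R₀.trans R, hm, h1, h2, by rw [image_trans_image]⟩

lemma IsComplexCone.card_le {d k : ℕ} {𝒳 : Finset (Finset (Euc d))} (h : IsComplexCone k 𝒳)
    {F : Finset (Euc d)} (hF : F ∈ Omega 𝒳) : F.card ≤ k := by
  obtain ⟨X, hX, hFX⟩ := hF
  rw [← (h.2.1 X hX).1]
  exact Finset.card_le_card hFX

/-- The product of `ℝ^m` with the star of a face with `f` elements is a set of type `m + f`. -/
theorem isTypeSet_starCone (hN : N' + n ≤ N) {m : ℕ} (hm : m ≤ n)
    {𝒳 : Finset (Finset (Euc N'))} (h : IsComplexCone (n - m) 𝒳) (hn : IsNonFlat (n - m) 𝒳)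
    {F : Finset (Euc N')} (hF : F ∈ Omega 𝒳) :
    IsTypeSet n N' (m + F.card) (prodFlat m (starCone 𝒳 F) : Set (Euc N)) := by
  have hN' : N' ≤ N := by omega
  have hFk := h.card_le hF
  have hFlin : Module.finrank ℝ (Submodule.span ℝ (F : Set (Euc N'))) = F.card := by
    obtain ⟨X, hX, hFX⟩ := hF
    have := finrank_span_set_eq_card
      ((h.2.1 X hX).linearIndepOn.mono (show (F : Set (Euc N')) ⊆ X from by exact_mod_cast hFX))
    simpa using this
  let T : Set (Euc N') := ⋃ X ∈ link 𝒳 F, coneOver (X : Set (Euc N'))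
  have hT : ∀ q ∈ T, perp F q = q := by
    intro q hq
    simp only [T, Set.mem_iUnion, exists_prop] at hq
    obtain ⟨X, hX, hq⟩ := hq
    obtain ⟨Y, -, rfl⟩ := Finset.mem_image.1 hX
    exact coneOver_link_subset F Y q hq
  -- The star has its extra flat directions in `span F`, while `prodFlat` wants them in the
  -- coordinates following `N' + m`. An isometry carries `S₁` onto `S₂` and fixes `H`, which
  -- contains the link and `ℝ^m`; `N' + n ≤ N` provides the room.
  let H : Submodule ℝ (Euc N) := (Submodule.span ℝ (F : Set (Euc N')))ᗮ.comap (head N') ⊓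
    coordFlat N 0 (N' + m)
  let S₁ : Submodule ℝ (Euc N) := coordFlat N (N' + m) F.card
  let S₂ : Submodule ℝ (Euc N) := (Submodule.span ℝ (F : Set (Euc N'))).map (emb N)
  have hS₁ : S₁ ≤ Hᗮ := by
    intro x hx
    rw [Submodule.mem_orthogonal]
    intro y hy
    rw [PiLp.inner_apply]
    refine Finset.sum_eq_zero fun i _ => ?_
    by_cases hi : N' + m ≤ (i : ℕ)
    · simp [hy.2 i (by right; omega)]
    · simp [hx i (by left; omega)]
  have hS₂ : S₂ ≤ Hᗮ := by
    rintro _ ⟨s, hs, rfl⟩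
    rw [Submodule.mem_orthogonal']
    intro y hy
    rw [inner_emb hN']
    exact Submodule.inner_right_of_mem_orthogonal hs hy.1
  obtain ⟨Φ, hΦH, hΦS⟩ := exists_isometry_fixing hS₁ hS₂ (by
    rw [finrank_coordFlat (by omega), ← hFlin]
    exact (Submodule.equivMapOfInjective (emb N)
      (Function.LeftInverse.injective (head_emb hN')) _).finrank_eq)
  refine ⟨link 𝒳 F, Φ.toIsometryEquiv, by omega, ?_, ?_, ?_⟩
  · rw [← Nat.sub_sub]
    exact (h.link_aux hF).2
  · rw [← Nat.sub_sub]
    exact hn.link h hF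
  change _ = Φ '' prodFlat (m + F.card) T
  have hsplit : ∀ x : Euc N, ∃ p s : Euc N, x = p + s ∧ (∀ i : Fin N, N' ≤ (i : ℕ) →
      p i = x i) ∧ head N' p = perp F (head N' x) ∧ s ∈ S₂ := by
    intro x
    refine ⟨x - emb N (head N' x - perp F (head N' x)), emb N (head N' x - perp F (head N' x)),
      by abel, fun i hi => ?_, ?_, ⟨_, sub_perp_mem _ _, rfl⟩⟩
    · have : ¬ (i : ℕ) < N' := by omega
      simp [emb_apply, this]
    · rw [map_sub, head_emb hN']
      abel
  have hstar : ∀ q, q ∈ starCone 𝒳 F ↔ perp F q ∈ T := fun q => h.mem_starCone_iff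
  ext x
  constructor
  · intro hx
    rw [mem_prodFlat_iff hN', hstar] at hx
    obtain ⟨p, s, rfl, hp, hhp, hs⟩ := hsplit x
    have hpH : p ∈ H := by
      refine ⟨?_, fun i hi => ?_⟩
      · rw [SetLike.mem_coe, Submodule.mem_comap, hhp]
        exact perp_mem F _
      · rw [zero_add] at hi
        have hi' : N' + m ≤ (i : ℕ) := by omega
        rw [hp i (by omega), hx.2 i hi']
    have hs' : Φ.symm s ∈ S₁ := by
      rw [← hΦS, Φ.apply_symm_apply]
      exact hs
    refine ⟨p + Φ.symm s, ?_, by rw [map_add, hΦH p hpH, Φ.apply_symm_apply]⟩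
    rw [mem_prodFlat_iff hN']
    have h0 : head N' (Φ.symm s) = 0 := by
      ext l
      rw [head_apply, dif_pos (l.2.trans_le hN')]
      exact hs' _ (Or.inl (by simp; omega))
    rw [map_add, h0, add_zero, hhp]
    refine ⟨hx.1, fun i hi => ?_⟩
    rw [PiLp.add_apply, hpH.2 i (by omega), hs' i (by omega), add_zero]
  · rintro ⟨z, hz, rfl⟩
    rw [mem_prodFlat_iff hN'] at hz
    let g : Euc N := WithLp.toLp 2 fun i => if (i : ℕ) < N' + m then z i else 0
    have hg : ∀ i, g i = if (i : ℕ) < N' + m then z i else 0 := fun _ => rfl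
    have hgh : head N' g = head N' z := by
      ext l
      have hl := l.2.trans_le hN'
      rw [head_apply, head_apply, dif_pos hl, dif_pos hl, hg, if_pos (by simp; omega)]
    have hgH : g ∈ H := by
      refine ⟨?_, fun i hi => ?_⟩
      · rw [SetLike.mem_coe, Submodule.mem_comap, hgh, ← hT _ hz.1]
        exact perp_mem F _
      · rw [hg, if_neg (by omega)]
    have hgS : z - g ∈ S₁ := by
      intro i hi
      rw [PiLp.sub_apply, hg]
      rcases hi with hi | hi
      · rw [if_pos hi, sub_self]
      · rw [if_neg (by omega), sub_zero, hz.2 i (by omega)]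
    have hΦz : Φ z = g + Φ (z - g) := by
      conv_lhs => rw [← add_sub_cancel g z]
      rw [map_add, hΦH g hgH]
    obtain ⟨s, hs, hse⟩ := (hΦS _).2 hgS
    rw [mem_prodFlat_iff hN', hstar, hΦz, ← hse, map_add, head_emb hN', map_add,
      perp_eq_zero_iff.2 hs, add_zero, hgh, hT _ hz.1]
    refine ⟨hz.1, fun i hi => ?_⟩
    have : ¬ (i : ℕ) < N' := by omega
    rw [PiLp.add_apply, hgH.2 i (by omega), emb_apply, dif_neg this, add_zero]

/-- `W` is invariant under the translations by the vectors of `S`. -/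
def IsInvariant (S : Submodule ℝ (Euc N)) (W : Set (Euc N)) : Prop :=
  ∀ w ∈ W, ∀ s ∈ S, w + s ∈ W

lemma IsInvariant.image {S : Submodule ℝ (Euc N)} {W : Set (Euc N)} (h : IsInvariant S W)
    {R : Euc N → Euc N} {Λ : Euc N ≃ₗᵢ[ℝ] Euc N} (hR : ∀ x v, R (x + v) = R x + Λ v) :
    IsInvariant (S.map Λ.toLinearEquiv.toLinearMap) (R '' W) := by
  rintro _ ⟨w, hw, rfl⟩ _ ⟨s, hs, rfl⟩
  exact ⟨w + s, h w hw s hs, hR w s⟩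

lemma finrank_map_isometry (S : Submodule ℝ (Euc N)) (Λ : Euc N ≃ₗᵢ[ℝ] Euc N) :
    Module.finrank ℝ (S.map Λ.toLinearEquiv.toLinearMap) = Module.finrank ℝ S :=
  LinearEquiv.finrank_map_eq Λ.toLinearEquiv S

/-- A set of type `m` is invariant under an `m`-dimensional space of translations. -/
lemma IsTypeSet.exists_isInvariant (hN : N' + n ≤ N) {m : ℕ} {W : Set (Euc N)}
    (h : IsTypeSet n N' m W) :
    ∃ S : Submodule ℝ (Euc N), Module.finrank ℝ S = m ∧ IsInvariant S W := by
  obtain ⟨𝒳, R, hm, -, -, rfl⟩ := h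
  obtain ⟨Λ, hΛ⟩ := exists_linear_part R
  have hN' : N' ≤ N := by omega
  refine ⟨(coordFlat N N' m).map Λ.toLinearEquiv.toLinearMap, ?_, IsInvariant.image ?_ hΛ⟩
  · rw [finrank_map_isometry, finrank_coordFlat (by omega)]
  · intro w hw s hs
    rw [mem_prodFlat_iff hN'] at hw ⊢
    have h0 : head N' s = 0 := by
      ext l
      rw [head_apply, dif_pos (l.2.trans_le hN')]
      exact hs _ (Or.inl (by simp))
    refine ⟨by rw [map_add, h0, add_zero]; exact hw.1, fun i hi => ?_⟩
    rw [PiLp.add_apply, hw.2 i hi, hs i (Or.inr hi), add_zero]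

end Types

end ConeStrata
namespace ConeStrata
open scoped Classical

/-! ### Sets of type `m` against invariant sets -/

section Core

variable {N N' n : ℕ}

lemma exists_dist_lt_of_relDist_le {x : Euc N} {r a : ℝ} (hr : 0 < r) {A B : Set (Euc N)}
    (h : relDist x r A B ≤ ENNReal.ofReal a) {b : ℝ} (hb : a * r < b) (hb0 : 0 < b) :
    (∀ z ∈ B, dist z x < r → ∃ y ∈ A, dist z y < b) ∧
      ∀ z ∈ A, dist z x < r → ∃ y ∈ B, dist z y < b := by
  rw [relDist, ENNReal.div_le_iff (by simpa using hr) ENNReal.ofReal_ne_top,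
    ← ENNReal.ofReal_mul' hr.le, max_le_iff] at h
  have key : ∀ C D : Set (Euc N), ⨆ z ∈ C ∩ Metric.ball x r, Metric.infEDist z D ≤
      ENNReal.ofReal (a * r) → ∀ z ∈ C, dist z x < r → ∃ y ∈ D, dist z y < b := by
    intro C D h z hz hzx
    have h1 := (iSup₂_le_iff.1 h z ⟨hz, hzx⟩).trans_lt
      ((ENNReal.ofReal_lt_ofReal_iff hb0).2 hb)
    obtain ⟨y, hy, hzy⟩ := Metric.infEDist_lt_iff.1 h1
    refine ⟨y, hy, ?_⟩
    rwa [edist_dist, ENNReal.ofReal_lt_ofReal_iff hb0] at hzy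
  exact ⟨key _ _ h.1, key _ _ h.2⟩

lemma relDist_eq_zero_of_inter_eq {x : Euc N} {r : ℝ} {A B : Set (Euc N)}
    (h : A ∩ Metric.ball x r = B ∩ Metric.ball x r) : relDist x r A B = 0 := by
  have key : ∀ C D : Set (Euc N), C ∩ Metric.ball x r = D ∩ Metric.ball x r →
      ⨆ z ∈ C ∩ Metric.ball x r, Metric.infEDist z D = 0 := by
    intro C D h
    simp only [ENNReal.iSup_eq_zero]
    intro z hz
    exact Metric.infEDist_zero_of_mem (h ▸ hz).1
  rw [relDist, key _ _ h, key _ _ h.symm, max_self, ENNReal.zero_div]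

/-- Around a point of a face, the product of a non-flat cone with `ℝ^m` is at a definite distance
from every set with more invariance than the face. -/
theorem exists_lt_relDist_prodFlat (hN : N' + n ≤ N) {m : ℕ} (hm : m ≤ n)
    {𝒳 : Finset (Finset (Euc N'))} (h : IsComplexCone (n - m) 𝒳) (hn : IsNonFlat (n - m) 𝒳) :
    ∃ δ > 0, ∀ F ∈ Omega 𝒳, F.card < n - m →
      ∀ x ∈ (prodFlat m (coneOver (F : Set (Euc N'))) : Set (Euc N)),
      ∀ S : Submodule ℝ (Euc N), m + F.card < Module.finrank ℝ S → ∀ W, IsInvariant S W →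
      ∀ r > 0, ENNReal.ofReal δ < relDist x r (prodFlat m (starCone 𝒳 ∅)) W := by
  have hN' : N' ≤ N := by omega
  obtain ⟨δ₁, hδ₁, H⟩ := hn.exists_not_almost_invariant h
  refine ⟨min (δ₁ / 16) (1 / 64), by positivity, fun F hF hFk x hx S hS W hW r hr => ?_⟩
  set δ := min (δ₁ / 16) (1 / 64)
  have hδ0 : 0 < δ := by positivity
  have hδ2 : δ ≤ δ₁ / 16 := min_le_left _ _
  have hδ3 : δ ≤ 1 / 64 := min_le_right _ _
  by_contra hcon
  rw [not_lt] at hcon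
  obtain ⟨hWV, hVW⟩ := exists_dist_lt_of_relDist_le hr hcon (b := 2 * δ * r)
    (by nlinarith [mul_pos hδ0 hr]) (by positivity)
  rw [mem_prodFlat_iff hN'] at hx
  have hFO := hF
  obtain ⟨X, hX, hFX⟩ := hF
  have hxT : head N' x ∈ starCone 𝒳 ∅ := by
    rw [← iUnion_coneOver_eq]
    exact Set.mem_biUnion hX (coneOver_mono (by exact_mod_cast hFX) hx.1)
  -- A dimension count gives a nonzero vector of `S` orthogonal to `F` and to the `m` free
  -- coordinates.
  let B : Finset (Euc N) := F.image (emb N) ∪ (Finset.univ : Finset (Fin m)).image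
    fun j : Fin m => EuclideanSpace.single (⟨N' + (j : ℕ), by omega⟩ : Fin N) (1 : ℝ)
  have hB : Module.finrank ℝ (Submodule.span ℝ (B : Set (Euc N))) ≤ m + F.card := by
    refine (finrank_span_finset_le_card B).trans ((Finset.card_union_le _ _).trans ?_)
    rw [add_comm m]
    refine add_le_add Finset.card_image_le (Finset.card_image_le.trans ?_)
    simp
  have hex : ∃ u ∈ S, u ∈ (Submodule.span ℝ (B : Set (Euc N)))ᗮ ∧ u ≠ 0 := by
    have h1 := Submodule.finrank_sup_add_finrank_inf_eq S (Submodule.span ℝ (B : Set (Euc N)))ᗮ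
    have h2 := Submodule.finrank_add_finrank_orthogonal (Submodule.span ℝ (B : Set (Euc N)))
    have h3 := Submodule.finrank_le (S ⊔ (Submodule.span ℝ (B : Set (Euc N)))ᗮ)
    have h4 : S ⊓ (Submodule.span ℝ (B : Set (Euc N)))ᗮ ≠ ⊥ := by
      intro h0
      rw [h0, finrank_bot] at h1
      omega
    obtain ⟨u, hu, hu0⟩ := Submodule.exists_mem_ne_zero_of_ne_bot h4
    exact ⟨u, hu.1, hu.2, hu0⟩
  obtain ⟨u, huS, huB, hu1⟩ : ∃ u ∈ S, u ∈ (Submodule.span ℝ (B : Set (Euc N)))ᗮ ∧ ‖u‖ = 1 := by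
    obtain ⟨u, h1, h2, h3⟩ := hex
    exact ⟨‖u‖⁻¹ • u, Submodule.smul_mem _ _ h1, Submodule.smul_mem _ _ h2, by
      rw [norm_smul, norm_inv, norm_norm, inv_mul_cancel₀ (norm_ne_zero_iff.2 h3)]⟩
  have huF : head N' u ∈ (Submodule.span ℝ (F : Set (Euc N')))ᗮ := by
    rw [Submodule.mem_orthogonal]
    intro y hy
    rw [← inner_emb hN']
    refine Submodule.inner_right_of_mem_orthogonal (K := Submodule.span ℝ (B : Set (Euc N))) ?_ huB
    have : (Submodule.span ℝ (F : Set (Euc N'))).map (emb N) ≤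
        Submodule.span ℝ (B : Set (Euc N)) := by
      rw [Submodule.map_span, Submodule.span_le]
      rintro _ ⟨v, hv, rfl⟩
      exact Submodule.subset_span (by
        simp only [B, Finset.coe_union, Finset.coe_image]
        exact Or.inl ⟨v, hv, rfl⟩)
    exact this ⟨y, hy, rfl⟩
  have hum : ∀ i : Fin N, N' ≤ (i : ℕ) → (i : ℕ) < N' + m → u i = 0 := by
    intro i hi hi'
    have h1 : EuclideanSpace.single i (1 : ℝ) ∈ Submodule.span ℝ (B : Set (Euc N)) := by
      refine Submodule.subset_span ?_
      simp only [B, Finset.coe_union, Finset.coe_image]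
      refine Or.inr ⟨⟨i - N', by omega⟩, by simp, ?_⟩
      exact congrArg (fun q : Fin N => EuclideanSpace.single q (1 : ℝ))
        (Fin.ext (show N' + ((i : ℕ) - N') = i by omega))
    have h2 := Submodule.inner_right_of_mem_orthogonal h1 huB
    simpa [EuclideanSpace.inner_single_left] using h2
  -- Passing from the cone to `W`, translating inside `W` and coming back costs two errors of `2 δ
  -- r`.
  have hV : ∀ z ∈ (prodFlat m (starCone 𝒳 ∅) : Set (Euc N)), ‖z - x‖ < r / 4 → ∀ s : ℝ,
      |s| ≤ r / 4 → ∃ z' ∈ (prodFlat m (starCone 𝒳 ∅) : Set (Euc N)),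
        ‖z + s • u - z'‖ ≤ 4 * δ * r := by
    intro z hz hzx s hs
    obtain ⟨w, hw, hzw⟩ := hVW z hz (by rw [dist_eq_norm]; linarith)
    rw [dist_eq_norm] at hzw
    have hws := hW w hw (s • u) (Submodule.smul_mem _ _ huS)
    have hsu : ‖s • u‖ ≤ r / 4 := by rwa [norm_smul, hu1, mul_one]
    obtain ⟨z', hz', hwz⟩ := hWV _ hws (by
      rw [dist_eq_norm, show w + s • u - x = s • u + (z - x) - (z - w) by abel]
      have h1 := norm_sub_le (s • u + (z - x)) (z - w)
      have h2 := norm_add_le (s • u) (z - x)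
      nlinarith)
    rw [dist_eq_norm] at hwz
    refine ⟨z', hz', ?_⟩
    rw [show z + s • u - z' = (z - w) + (w + s • u - z') by abel]
    exact (norm_add_le _ _).trans (by linarith)
  have hxV : x ∈ (prodFlat m (starCone 𝒳 ∅) : Set (Euc N)) :=
    (mem_prodFlat_iff hN').2 ⟨hxT, hx.2⟩
  -- Coordinates from `N' + m` on vanish on the cone, so `u` has only a small component there and
  -- its head has norm at least `1 / 2`.
  have hu2 : ‖u - emb N (head N' u)‖ ≤ 1 / 4 := by
    obtain ⟨z', hz', hd⟩ := hV x hxV (by simpa using by linarith) (r / 4)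
      (by rw [abs_of_pos (by linarith)])
    rw [mem_prodFlat_iff hN'] at hz'
    have h1 : ‖(r / 4) • (u - emb N (head N' u))‖ ≤ ‖x + (r / 4) • u - z'‖ := by
      refine norm_le_of_abs_le fun i => ?_
      simp only [PiLp.smul_apply, PiLp.sub_apply, PiLp.add_apply, emb_head_apply, smul_eq_mul]
      by_cases hi : (i : ℕ) < N'
      · simp [hi]
      · by_cases hi' : (i : ℕ) < N' + m
        · simp [hi, hum i (by omega) hi']
        · simp [hi, hx.2 i (by omega), hz'.2 i (by omega)]
    rw [norm_smul, Real.norm_of_nonneg (by linarith)] at h1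
    nlinarith
  have huh : ‖emb N (head N' u)‖ = ‖head N' u‖ := norm_emb hN' _
  have hlow : 1 / 2 ≤ ‖head N' u‖ := by
    have := norm_sub_norm_le u (emb N (head N' u))
    rw [hu1, huh] at this
    linarith
  refine H F hFO hFk (head N' x) hx.1 (head N' u) huF hlow ((norm_head_le hN' u).trans hu1.le)
    (r / 4) (by positivity) fun q hq hqx s hs => ?_
  obtain ⟨z', hz', hd⟩ := hV (x + emb N (q - head N' x)) (by
    rw [mem_prodFlat_iff hN', map_add, head_emb hN', add_sub_cancel]
    refine ⟨hq, fun i hi => ?_⟩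
    have : ¬ (i : ℕ) < N' := by omega
    rw [PiLp.add_apply, hx.2 i hi, emb_apply, dif_neg this, add_zero])
    (by rwa [add_sub_cancel_left, norm_emb hN']) s hs.le
  rw [mem_prodFlat_iff hN'] at hz'
  refine ⟨head N' z', hz'.1, ?_⟩
  have h1 := norm_head_le hN' (x + emb N (q - head N' x) + s • u - z')
  rw [map_sub, map_add, map_add, map_smul, head_emb hN', add_sub_cancel] at h1
  refine (h1.trans hd).trans ?_
  nlinarith

end Core

/-! ### Local cones -/

section LocalCones

variable {N N' n : ℕ}

/-- `W` coincides near `x` with the translate to `x` of the cone `K`. -/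
def IsLocalCone (W : Set (Euc N)) (x : Euc N) (K : Set (Euc N)) : Prop :=
  (0 : Euc N) ∈ K ∧ (∀ a : ℝ, 0 ≤ a → ∀ v ∈ K, a • v ∈ K) ∧
    ∃ ρ > 0, ∀ v : Euc N, ‖v‖ < ρ → (x + v ∈ W ↔ v ∈ K)

lemma IsLocalCone.isBlowUp {W K : Set (Euc N)} {x : Euc N} (h : IsLocalCone W x K) :
    IsBlowUp W x K := by
  obtain ⟨h0, hK, ρ, hρ, hW⟩ := h
  refine ⟨by simpa using (hW 0 (by simpa)).2 h0, ρ, hρ, fun r hr hrρ => ?_⟩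
  ext v
  constructor
  · rintro ⟨c, hc, y, ⟨hy, hyr⟩, rfl⟩
    rw [mem_ball_iff_norm] at hyr
    exact hK c hc _ ((hW (y - x) (hyr.trans hrρ)).1 (by simpa using hy))
  · intro hv
    have hc : 0 < r / (‖v‖ + 1) := by positivity
    have hn : ‖(r / (‖v‖ + 1)) • v‖ < r := by
      rw [norm_smul, Real.norm_of_nonneg hc.le, div_mul_eq_mul_div, div_lt_iff₀ (by positivity)]
      nlinarith [norm_nonneg v]
    refine ⟨(r / (‖v‖ + 1))⁻¹, by positivity, x + (r / (‖v‖ + 1)) • v, ⟨?_, ?_⟩, ?_⟩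
    · exact (hW _ (hn.trans hrρ)).2 (hK _ hc.le v hv)
    · simpa [mem_ball_iff_norm] using hn
    · rw [add_sub_cancel_left, inv_smul_smul₀ hc.ne']

lemma IsBlowUp.unique {W K K' : Set (Euc N)} {x : Euc N} (h : IsBlowUp W x K)
    (h' : IsBlowUp W x K') : K = K' := by
  obtain ⟨-, ρ, hρ, h⟩ := h
  obtain ⟨-, ρ', hρ', h'⟩ := h'
  have hm : 0 < min ρ ρ' := lt_min hρ hρ'
  rw [← h (min ρ ρ' / 2) (by positivity) (by linarith [min_le_left ρ ρ']),
    ← h' (min ρ ρ' / 2) (by positivity) (by linarith [min_le_right ρ ρ'])]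

lemma IsLocalCone.image {W K : Set (Euc N)} {x : Euc N} (h : IsLocalCone W x K)
    {R : Euc N → Euc N} (hinj : Function.Injective R) {Λ : Euc N ≃ₗᵢ[ℝ] Euc N}
    (hR : ∀ x v, R (x + v) = R x + Λ v) :
    IsLocalCone (R '' W) (R x) (Λ '' K) := by
  obtain ⟨h0, hK, ρ, hρ, hW⟩ := h
  refine ⟨⟨0, h0, map_zero Λ⟩, ?_, ρ, hρ, fun v hv => ?_⟩
  · rintro a ha _ ⟨v, hv, rfl⟩
    exact ⟨a • v, hK a ha v hv, map_smul Λ a v⟩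
  · obtain ⟨w, rfl⟩ := Λ.surjective v
    rw [← hR, hinj.mem_set_image, Λ.injective.mem_set_image]
    exact hW w (by rwa [Λ.norm_map] at hv)

/-- A local cone of the local cone `K` of `W` is a local cone of `W` at a nearby point. -/
lemma IsLocalCone.trans {W K K' : Set (Euc N)} {x y : Euc N} (h : IsLocalCone W x K)
    (h' : IsLocalCone K y K') : ∃ s : ℝ, IsLocalCone W (x + s • y) K' := by
  obtain ⟨h0, hK, ρ, hρ, hW⟩ := h
  obtain ⟨h0', hK', ρ', hρ', hW'⟩ := h'
  -- The factor `s` brings `y` into the ball where `W` is a translate of `K`. As `K` and `K'` are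
  -- cones, the local cone at `s • y` is still `K'`.
  set s : ℝ := ρ / (2 * (‖y‖ + 1)) with hs
  have hs0 : 0 < s := by positivity
  have hKs : ∀ v, s⁻¹ • v ∈ K ↔ v ∈ K := fun v =>
    ⟨fun h => by simpa [smul_smul, hs0.ne'] using hK s hs0.le _ h,
      fun h => hK _ (by positivity) _ h⟩
  have hKs' : ∀ v, s⁻¹ • v ∈ K' ↔ v ∈ K' := fun v =>
    ⟨fun h => by simpa [smul_smul, hs0.ne'] using hK' s hs0.le _ h,
      fun h => hK' _ (by positivity) _ h⟩
  refine ⟨s, h0', hK', min (ρ / 2) (s * ρ'), by positivity, fun v hv => ?_⟩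
  have hv1 : ‖v‖ < ρ / 2 := hv.trans_le (min_le_left _ _)
  have hv2 : ‖s⁻¹ • v‖ < ρ' := by
    rw [norm_smul, norm_inv, Real.norm_of_nonneg hs0.le, inv_mul_lt_iff₀ hs0]
    exact hv.trans_le (min_le_right _ _)
  have hsy : ‖s • y‖ ≤ ρ / 2 := by
    rw [norm_smul, Real.norm_of_nonneg hs0.le, hs, div_mul_eq_mul_div, div_le_iff₀ (by positivity)]
    nlinarith [norm_nonneg y]
  rw [add_assoc, hW _ ((norm_add_le _ _).trans_lt (by linarith)), ← hKs, smul_add,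
    inv_smul_smul₀ hs0.ne', hW' _ hv2, hKs']

/-- The support `F` of the coordinates is the face with the head of `x` in its interior. The set is
locally the star of `F`, which is invariant under translation by the head of `x`, a vector of `span
F`. -/
lemma IsComplexCone.isLocalCone_prodFlat (hN' : N' ≤ N) {k m : ℕ}
    {𝒳 : Finset (Finset (Euc N'))} (h : IsComplexCone k 𝒳) {x : Euc N} {c : Euc N' → ℝ}
    (hc : IsCoord 𝒳 ∅ c) (hx : head N' x = combo (verts 𝒳) c)
    (hx0 : ∀ i : Fin N, N' + m ≤ (i : ℕ) → x i = 0) {F : Finset (Euc N')}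
    (hF : ∀ v, v ∈ F ↔ c v ≠ 0) :
    IsLocalCone (prodFlat m (starCone 𝒳 ∅)) x (prodFlat m (starCone 𝒳 F)) := by
  obtain ⟨κ, hκ1, hκ⟩ := h.exists_lipschitz
  have hκ0 : 0 < κ := by linarith
  have hcX := hc.2
  obtain ⟨X, hX, -, hX0⟩ := hcX
  have hFX : F ⊆ X := fun v hv => by
    by_contra hvX
    exact (hF v).1 hv (hX0 v hvX)
  obtain ⟨ρ, hρ, hρF⟩ := exists_pos_forall_finite F.finite_toSet
    (P := fun v ρ => κ * ρ < c v) (fun v _ a b _ hab h => lt_of_le_of_lt (by gcongr) h)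
    (fun v hv => by
      have : 0 < c v := lt_of_le_of_ne (hc.1 v (by simp)) ((hF v).1 hv).symm
      refine ⟨c v / (2 * κ), by positivity, ?_⟩
      rw [show κ * (c v / (2 * κ)) = c v / 2 by field_simp]
      linarith)
  have hloc := starCone_inter_ball hκ hκ0 (F := F) hc (r := ρ) hρF
  have hxF : head N' x ∈ Submodule.span ℝ (F : Set (Euc N')) := by
    rw [hx, combo_eq_of_subset (hFX.trans (subset_verts hX)) fun v hv => by
      by_contra h0
      exact hv ((hF v).2 h0)]
    exact combo_mem_span F c
  refine ⟨?_, ?_, ρ, hρ, fun v hv => ?_⟩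
  · rw [mem_prodFlat_iff hN', map_zero]
    refine ⟨?_, fun i _ => by simp⟩
    rw [show (0 : Euc N') = (0 : ℝ) • head N' x by simp]
    refine smul_mem_starCone ?_ le_rfl
    rw [hx]
    refine ⟨c, ⟨fun v _ => hc.1 v (by simp), X, hX, hFX, hX0⟩, rfl⟩
  · intro a ha v hv
    rw [mem_prodFlat_iff hN'] at hv ⊢
    rw [map_smul]
    exact ⟨smul_mem_starCone hv.1 ha, fun i hi => by simp [hv.2 i hi]⟩
  · rw [mem_prodFlat_iff hN', mem_prodFlat_iff hN', map_add]
    refine and_congr ?_ (forall₂_congr fun i hi => by rw [PiLp.add_apply, hx0 i hi, zero_add])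
    have hball : head N' x + head N' v ∈ Metric.ball (combo (verts 𝒳) c) ρ := by
      rw [mem_ball_iff_norm, ← hx, add_sub_cancel_left]
      exact (norm_head_le hN' v).trans_lt hv
    have := Set.ext_iff.1 hloc (head N' x + head N' v)
    simp only [Set.mem_inter_iff, hball, and_true] at this
    rw [this]
    exact h.mem_starCone_congr (by rwa [add_sub_cancel_right])

/-- Every point of a set of type `m` lies in the interior of a unique face; near that point, the
set is a cone isometric to the product of `ℝ^m` with the star of that face. -/
lemma Presents.exists_isLocalCone (hN' : N' ≤ N) {m : ℕ} {𝒳 : Finset (Finset (Euc N'))}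
    {R : Euc N ≃ᵢ Euc N} {W : Set (Euc N)} (h : Presents n m 𝒳 R W) {x : Euc N} (hx : x ∈ W) :
    ∃ F ∈ Omega 𝒳, x ∈ R '' prodFlat m (coneOver (F : Set (Euc N'))) ∧ ∃ Λ : Euc N ≃ₗᵢ[ℝ] Euc N,
      IsLocalCone W x (Λ '' prodFlat m (starCone 𝒳 F)) := by
  obtain ⟨-, hX, -, rfl⟩ := h
  obtain ⟨Λ, hΛ⟩ := exists_linear_part R
  obtain ⟨z, hz, rfl⟩ := hx
  rw [iUnion_coneOver_eq, mem_prodFlat_iff hN'] at hz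
  obtain ⟨⟨c, hc, hzc⟩, hz0⟩ := hz
  have hcX := hc.2
  obtain ⟨X, hXX, -, hX0⟩ := hcX
  have hF : ∀ v, v ∈ X.filter (c · ≠ 0) ↔ c v ≠ 0 := fun v => by
    rw [Finset.mem_filter, and_iff_right_iff_imp]
    intro h1
    by_contra h2
    exact h1 (hX0 v h2)
  refine ⟨X.filter (c · ≠ 0), ⟨X, hXX, Finset.filter_subset _ _⟩, ⟨z, ?_, rfl⟩, Λ, ?_⟩
  · rw [mem_prodFlat_iff hN', mem_coneOver_iff]
    refine ⟨⟨c, fun v => hc.1 v (by simp), fun v hv => ?_, ?_⟩, hz0⟩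
    · by_contra h0
      exact hv ((hF v).2 h0)
    · rw [hzc]
      refine combo_eq_of_subset ((Finset.filter_subset _ _).trans (subset_verts hXX)) fun v hv => ?_
      by_contra h0
      exact hv ((hF v).2 h0)
  · rw [iUnion_coneOver_eq]
    exact (hX.isLocalCone_prodFlat hN' hc hzc hz0 hF).image R.injective hΛ

end LocalCones

/-! ### Spines -/

section Spines

variable {N N' n : ℕ}

/-- Near `x`, the set `W` is invariant under a space of translations of dimension larger
than `t`. -/
def HasFlat (W : Set (Euc N)) (x : Euc N) (t : ℕ) : Prop :=
  ∃ S : Submodule ℝ (Euc N), t < Module.finrank ℝ S ∧ ∃ W', IsInvariant S W' ∧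
    ∃ ρ > 0, W ∩ Metric.ball x ρ = W' ∩ Metric.ball x ρ

lemma HasFlat.congr {W W' : Set (Euc N)} {x : Euc N} {t : ℕ} (h : HasFlat W x t) {y : Euc N}
    {r : ℝ} (hx : x ∈ Metric.ball y r) (e : W ∩ Metric.ball y r = W' ∩ Metric.ball y r) :
    HasFlat W' x t := by
  obtain ⟨S, hS, Z, hZ, ρ, hρ, hWZ⟩ := h
  obtain ⟨η, hη, hηr⟩ := Metric.isOpen_iff.1 Metric.isOpen_ball x hx
  refine ⟨S, hS, Z, hZ, min ρ η, lt_min hρ hη, ?_⟩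
  ext z
  refine and_congr_left fun hz => ?_
  have h1 := Set.ext_iff.1 hWZ z
  have h2 := Set.ext_iff.1 e z
  have hz1 : z ∈ Metric.ball x ρ := Metric.ball_subset_ball (min_le_left _ _) hz
  have hz2 : z ∈ Metric.ball y r := hηr (Metric.ball_subset_ball (min_le_right _ _) hz)
  simp only [Set.mem_inter_iff, hz1, hz2, and_true] at h1 h2
  exact h2.symm.trans h1

lemma isInvariant_preimage {S : Submodule ℝ (Euc N)} {W : Set (Euc N)} (h : IsInvariant S W)
    {R : Euc N → Euc N} {Λ : Euc N ≃ₗᵢ[ℝ] Euc N} (hR : ∀ x v, R (x + v) = R x + Λ v) :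
    IsInvariant (S.comap Λ.toLinearEquiv.toLinearMap) (R ⁻¹' W) := by
  intro w hw s hs
  rw [Set.mem_preimage, hR]
  exact h _ hw _ hs

lemma finrank_comap_isometry (S : Submodule ℝ (Euc N)) (Λ : Euc N ≃ₗᵢ[ℝ] Euc N) :
    Module.finrank ℝ (S.comap Λ.toLinearEquiv.toLinearMap) = Module.finrank ℝ S := by
  have := finrank_map_isometry (S.comap Λ.toLinearEquiv.toLinearMap) Λ
  rw [Submodule.map_comap_eq_of_surjective Λ.surjective] at this
  exact this.symm

lemma relDist_image (R : Euc N ≃ᵢ Euc N) (x : Euc N) (r : ℝ) (A B : Set (Euc N)) :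
    relDist (R x) r (R '' A) (R '' B) = relDist x r A B := by
  have key : ∀ C D : Set (Euc N), ⨆ z ∈ R '' C ∩ Metric.ball (R x) r, Metric.infEDist z (R '' D) =
      ⨆ z ∈ C ∩ Metric.ball x r, Metric.infEDist z D := by
    intro C D
    rw [← R.image_ball, ← Set.image_inter R.injective, iSup_image]
    simp only [Metric.infEDist_image R.isometry]
  rw [relDist, relDist, key, key]

lemma relDist_image_left (R : Euc N ≃ᵢ Euc N) (x : Euc N) (r : ℝ) (A B : Set (Euc N)) :
    relDist (R x) r (R '' A) B = relDist x r A (R ⁻¹' B) := by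
  rw [← relDist_image R x r A, Set.image_preimage_eq B R.surjective]

lemma Presents.exists_lt_relDist (hN : N' + n ≤ N) {m : ℕ} {𝒳 : Finset (Finset (Euc N'))}
    {R : Euc N ≃ᵢ Euc N} {W : Set (Euc N)} (h : Presents n m 𝒳 R W) :
    ∃ δ > 0, ∀ t, m ≤ t → t < n → ∀ x ∈ R '' prodFlat m (skeleton 𝒳 (t - m)),
      ∀ S : Submodule ℝ (Euc N), t < Module.finrank ℝ S → ∀ W', IsInvariant S W' →
      ∀ r > 0, ENNReal.ofReal δ < relDist x r W W' := by
  obtain ⟨hm, hX, hn, rfl⟩ := h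
  obtain ⟨δ, hδ, H⟩ := exists_lt_relDist_prodFlat hN hm hX hn
  obtain ⟨Λ, hΛ⟩ := exists_linear_part R
  refine ⟨δ, hδ, ?_⟩
  rintro t hmt htn _ ⟨x, hx, rfl⟩ S hS W' hW' r hr
  rw [relDist_image_left, iUnion_coneOver_eq]
  obtain ⟨⟨y, ⟨F, hF, hFt, hy⟩, hxy⟩, hx0⟩ := hx
  exact H F hF (by omega) x ⟨⟨y, hy, hxy⟩, hx0⟩ _
    (by rw [finrank_comap_isometry]; omega) _ (isInvariant_preimage hW' hΛ) r hr

lemma Presents.not_hasFlat (hN : N' + n ≤ N) {m : ℕ} {𝒳 : Finset (Finset (Euc N'))}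
    {R : Euc N ≃ᵢ Euc N} {W : Set (Euc N)} (h : Presents n m 𝒳 R W) {t : ℕ} (hmt : m ≤ t)
    (htn : t < n) {x : Euc N} (hx : x ∈ R '' prodFlat m (skeleton 𝒳 (t - m))) :
    ¬ HasFlat W x t := by
  rintro ⟨S, hS, W', hW', ρ, hρ, e⟩
  obtain ⟨δ, -, H⟩ := h.exists_lt_relDist hN
  have := H t hmt htn x hx S hS W' hW' ρ hρ
  rw [relDist_eq_zero_of_inter_eq e] at this
  exact not_lt_bot this

/-- If `F` is the face with `x` in its interior, the local cone at `x` is invariant in `m + F.card`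
directions. So `m + F.card ≤ t`, and `F` can be enlarged to a face with `t - m` elements. -/
lemma Presents.mem_of_not_hasFlat (hN : N' + n ≤ N) {m : ℕ} {𝒳 : Finset (Finset (Euc N'))}
    {R : Euc N ≃ᵢ Euc N} {W : Set (Euc N)} (h : Presents n m 𝒳 R W) {t : ℕ} (htn : t ≤ n)
    {x : Euc N} (hx : x ∈ W) (hflat : ¬ HasFlat W x t) :
    m ≤ t ∧ x ∈ R '' prodFlat m (skeleton 𝒳 (t - m)) := by
  have hN' : N' ≤ N := by omega
  obtain ⟨F, hF, hxF, Λ, hloc⟩ := h.exists_isLocalCone hN' hx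
  have hle : m + F.card ≤ t := by
    by_contra hlt
    rw [not_le] at hlt
    refine hflat ?_
    obtain ⟨S, hS, hSi⟩ := (isTypeSet_starCone hN h.1 h.2.1 h.2.2.1 hF).exists_isInvariant hN
    have hR : ∀ y v, (fun v => x + Λ v) (y + v) = (fun v => x + Λ v) y + Λ v := fun y v => by
      simp only [map_add, add_assoc]
    obtain ⟨-, -, ρ, hρ, hW⟩ := hloc
    refine ⟨_, ?_, _, hSi.image (R := fun v => x + Λ v) hR, ρ, hρ, ?_⟩
    · rw [finrank_map_isometry, hS]
      exact hlt
    · ext z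
      refine and_congr_left fun hz => ?_
      rw [mem_ball_iff_norm] at hz
      have := hW (z - x) hz
      rw [add_sub_cancel] at this
      rw [this]
      constructor
      · rintro ⟨v, hv, e⟩
        exact ⟨v, hv, by simp only [e, add_sub_cancel]⟩
      · rintro ⟨v, hv, rfl⟩
        exact ⟨v, hv, by simp⟩
  refine ⟨by omega, ?_⟩
  obtain ⟨X, hX, hFX⟩ := hF
  obtain ⟨Y, hFY, hYX, hY⟩ := Finset.exists_subsuperset_card_eq hFX (n := t - m) (by omega)
    (by rw [(h.2.1.2.1 X hX).1]; omega)
  have hsub : coneOver (F : Set (Euc N')) ⊆ skeleton 𝒳 (t - m) := fun y hy =>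
    ⟨Y, ⟨X, hX, hYX⟩, hY, coneOver_mono (by exact_mod_cast hFY) hy⟩
  exact Set.image_mono (prodFlat_mono hsub) hxF

lemma skeleton_subset {d : ℕ} (𝒳 : Finset (Finset (Euc d))) (t : ℕ) :
    skeleton 𝒳 t ⊆ ⋃ X ∈ 𝒳, coneOver (X : Set (Euc d)) := by
  rintro y ⟨Y, ⟨X, hX, hYX⟩, -, hy⟩
  exact Set.mem_biUnion hX (coneOver_mono (by exact_mod_cast hYX) hy)

lemma spine_subset (t : ℕ) (W : Set (Euc N)) : spine n N' t W ⊆ W := by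
  rintro x ⟨m, hm, 𝒳, R, h, hx⟩
  rw [h.2.2.2]
  exact Set.image_mono (prodFlat_mono (skeleton_subset _ _)) hx

/-- The spines can be computed in any presentation. -/
theorem Presents.mem_spine_iff (hN : N' + n ≤ N) {m : ℕ} {𝒳 : Finset (Finset (Euc N'))}
    {R : Euc N ≃ᵢ Euc N} {W : Set (Euc N)} (h : Presents n m 𝒳 R W) {t : ℕ} (htn : t ≤ n)
    {x : Euc N} : x ∈ spine n N' t W ↔ m ≤ t ∧ x ∈ R '' prodFlat m (skeleton 𝒳 (t - m)) := by
  refine ⟨fun hx => ?_, fun hx => ⟨m, hx.1, 𝒳, R, h, hx.2⟩⟩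
  have hxW := spine_subset t W hx
  rcases htn.eq_or_lt with rfl | htn
  · refine ⟨h.1, ?_⟩
    rw [h.2.2.2] at hxW
    refine Set.image_mono (prodFlat_mono fun y hy => ?_) hxW
    simp only [Set.mem_iUnion, exists_prop] at hy
    obtain ⟨X, hX, hy⟩ := hy
    exact ⟨X, mem_Omega_self hX, (h.2.1.2.1 X hX).1, hy⟩
  · obtain ⟨m', hm', 𝒳', R', h', hx'⟩ := hx
    exact h.mem_of_not_hasFlat hN htn.le hxW (h'.not_hasFlat hN hm' htn hx')

lemma spine_top_eq (hN : N' + n ≤ N) {m : ℕ} {W : Set (Euc N)} (h : IsTypeSet n N' m W) :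
    spine n N' n W = W := by
  obtain ⟨𝒳, R, h⟩ := h
  refine Set.Subset.antisymm (spine_subset n W) fun x hx => (h.mem_spine_iff hN le_rfl).2 ⟨h.1, ?_⟩
  rw [h.2.2.2] at hx
  refine Set.image_mono (prodFlat_mono fun y hy => ?_) hx
  simp only [Set.mem_iUnion, exists_prop] at hy
  obtain ⟨X, hX, hy⟩ := hy
  exact ⟨X, mem_Omega_self hX, (h.2.1.2.1 X hX).1, hy⟩

/-- The right-hand side mentions no presentation and depends only on `W` near `x`; locality of the
spines rests on it. -/
lemma mem_spine_iff_not_hasFlat (hN : N' + n ≤ N) {m : ℕ} {W : Set (Euc N)}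
    (h : IsTypeSet n N' m W) {t : ℕ} (ht : t < n) {x : Euc N} :
    x ∈ spine n N' t W ↔ x ∈ W ∧ ¬ HasFlat W x t := by
  obtain ⟨𝒳, R, h⟩ := h
  refine ⟨fun hx => ⟨spine_subset t W hx, ?_⟩, fun hx => (h.mem_spine_iff hN ht.le).2
    (h.mem_of_not_hasFlat hN ht.le hx.1 hx.2)⟩
  obtain ⟨m', hm', 𝒳', R', h', hx'⟩ := hx
  exact h'.not_hasFlat hN hm' ht hx'

/-- Spines are local. -/
lemma mem_spine_congr (hN : N' + n ≤ N) {m m' : ℕ} {W W' : Set (Euc N)}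
    (h : IsTypeSet n N' m W) (h' : IsTypeSet n N' m' W') {t : ℕ} (ht : t ≤ n) {x y : Euc N} {r : ℝ}
    (hx : x ∈ Metric.ball y r) (e : W ∩ Metric.ball y r = W' ∩ Metric.ball y r)
    (hxs : x ∈ spine n N' t W) : x ∈ spine n N' t W' := by
  have hxW : x ∈ W' := by
    have : x ∈ W ∩ Metric.ball y r := ⟨spine_subset t W hxs, hx⟩
    rw [e] at this
    exact this.1
  rcases ht.eq_or_lt with rfl | ht
  · rwa [spine_top_eq hN h']
  · rw [mem_spine_iff_not_hasFlat hN h ht] at hxs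
    exact (mem_spine_iff_not_hasFlat hN h' ht).2 ⟨hxW, fun hf => hxs.2 (hf.congr hx e.symm)⟩

lemma Presents.image {m : ℕ} {𝒳 : Finset (Finset (Euc N'))}
    {R : Euc N ≃ᵢ Euc N} {W : Set (Euc N)} (h : Presents n m 𝒳 R W) (R' : Euc N ≃ᵢ Euc N) :
    Presents n m 𝒳 (R.trans R') (R' '' W) := by
  obtain ⟨h1, h2, h3, rfl⟩ := h
  exact ⟨h1, h2, h3, by rw [image_trans_image]⟩

lemma mem_spine_image {t : ℕ} {W : Set (Euc N)} {x : Euc N} (hx : x ∈ spine n N' t W)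
    (R : Euc N ≃ᵢ Euc N) : R x ∈ spine n N' t (R '' W) := by
  obtain ⟨m, hm, 𝒳, R', h, hx⟩ := hx
  exact ⟨m, hm, 𝒳, R'.trans R, h.image R, by
    rw [image_trans_image]; exact Set.mem_image_of_mem R hx⟩

end Spines

end ConeStrata
namespace ConeStrata
open scoped Classical

/-! ### The class of blow-ups -/

section BlowUps

variable {N N' n : ℕ} {ℬ : Set (Set (Euc N))}

lemma symm_image_image (R : Euc N ≃ᵢ Euc N) (W : Set (Euc N)) : R.symm '' (R '' W) = W := by
  rw [Set.image_image]
  simp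

lemma image_mem_blowUps {Z : Set (Euc N)} (hZ : Z ∈ blowUps ℬ) (R : Euc N ≃ᵢ Euc N) :
    R '' Z ∈ blowUps ℬ := by
  obtain ⟨W, hW, x, K, R', hK, rfl⟩ := hZ
  exact ⟨W, hW, x, K, R'.trans R, hK, by rw [image_trans_image]⟩

lemma image_mem_ofType {m : ℕ} {Z : Set (Euc N)} (hZ : Z ∈ ofType n N' (blowUps ℬ) m)
    (R : Euc N ≃ᵢ Euc N) : R '' Z ∈ ofType n N' (blowUps ℬ) m :=
  ⟨image_mem_blowUps hZ.1 R, hZ.2.image R⟩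

/-- By uniqueness a blow-up is the local cone already found, so each face contributes at most one
blow-up up to isometry. -/
lemma IsTypeSet.exists_of_isBlowUp (hN' : N' ≤ N) {m : ℕ} {W : Set (Euc N)}
    (h : IsTypeSet n N' m W) : ∃ 𝒳 : Finset (Finset (Euc N')), m ≤ n ∧ IsComplexCone (n - m) 𝒳 ∧
      IsNonFlat (n - m) 𝒳 ∧ ∀ x K, IsBlowUp W x K → IsLocalCone W x K ∧
        ∃ F ∈ Omega 𝒳, ∃ Λ : Euc N ≃ₗᵢ[ℝ] Euc N, K = Λ '' prodFlat m (starCone 𝒳 F) := by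
  obtain ⟨𝒳, R, h⟩ := h
  refine ⟨𝒳, h.1, h.2.1, h.2.2.1, fun x K hK => ?_⟩
  obtain ⟨F, hF, -, Λ, hloc⟩ := h.exists_isLocalCone hN' hK.1
  have := hK.unique hloc.isBlowUp
  subst this
  exact ⟨hloc, F, hF, Λ, rfl⟩

lemma exists_isTypeSet_of_mem_blowUps (hN : N' + n ≤ N)
    (hℬ : ∀ W ∈ ℬ, ∃ m ≤ n, IsTypeSet n N' m W) {Z : Set (Euc N)} (hZ : Z ∈ blowUps ℬ) :
    ∃ m ≤ n, IsTypeSet n N' m Z := by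
  obtain ⟨W, hW, x, K, R, hK, rfl⟩ := hZ
  obtain ⟨m, hm, h⟩ := hℬ W hW
  obtain ⟨𝒳, -, hX, hn, H⟩ := h.exists_of_isBlowUp (by omega)
  obtain ⟨-, F, hF, Λ, rfl⟩ := H x K hK
  refine ⟨m + F.card, by have := hX.card_le hF; omega, ?_⟩
  exact ((isTypeSet_starCone hN hm hX hn hF).image Λ.toIsometryEquiv).image R

/-- The class of blow-ups is closed under local cones. -/
lemma mem_blowUps_of_isLocalCone (hN : N' + n ≤ N)
    (hℬ : ∀ W ∈ ℬ, ∃ m ≤ n, IsTypeSet n N' m W) {Z K : Set (Euc N)} {y : Euc N}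
    (hZ : Z ∈ blowUps ℬ) (hK : IsLocalCone Z y K) : K ∈ blowUps ℬ := by
  obtain ⟨W, hW, x, K₀, R, hK₀, rfl⟩ := hZ
  obtain ⟨m, hm, h⟩ := hℬ W hW
  obtain ⟨𝒳, -, -, -, H⟩ := h.exists_of_isBlowUp (by omega)
  obtain ⟨Λ, hΛ⟩ := exists_linear_part R.symm
  have h1 := hK.image R.symm.injective hΛ
  rw [symm_image_image] at h1
  obtain ⟨s, hs⟩ := (H x K₀ hK₀).1.trans h1
  refine ⟨W, hW, _, _, Λ.symm.toIsometryEquiv, hs.isBlowUp, ?_⟩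
  change K = Λ.symm '' (Λ '' K)
  rw [Set.image_image]
  simp

/-- The star is, up to isometry, the local cone at the point whose coordinates are `1` on `F` and
`0` elsewhere, and the class of blow-ups is closed under local cones. -/
lemma starCone_mem_blowUps (hN : N' + n ≤ N)
    (hℬ : ∀ W ∈ ℬ, ∃ m ≤ n, IsTypeSet n N' m W) {m : ℕ} {𝒳 : Finset (Finset (Euc N'))}
    {R : Euc N ≃ᵢ Euc N} {Z : Set (Euc N)} (hZ : Z ∈ blowUps ℬ) (h : Presents n m 𝒳 R Z)
    {F : Finset (Euc N')} (hF : F ∈ Omega 𝒳) :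
    R '' prodFlat m (starCone 𝒳 F) ∈ ofType n N' (blowUps ℬ) (m + F.card) := by
  have hN' : N' ≤ N := by omega
  have htype := isTypeSet_starCone hN h.1 h.2.1 h.2.2.1 hF
  refine ⟨?_, htype.image R⟩
  obtain ⟨Λ, hΛ⟩ := exists_linear_part R
  have hFO := hF
  obtain ⟨X, hX, hFX⟩ := hF
  let c : Euc N' → ℝ := fun v => if v ∈ F then 1 else 0
  have hc : IsCoord 𝒳 ∅ c :=
    ⟨fun v _ => by dsimp only [c]; split_ifs <;> norm_num, X, hX, by simp,
      fun v hv => if_neg fun hvF => hv (hFX hvF)⟩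
  have hloc := (h.2.1.isLocalCone_prodFlat (m := m) hN' hc (x := emb N (combo (verts 𝒳) c))
    (head_emb hN' _) (fun i hi => by
      have : ¬ (i : ℕ) < N' := by omega
      rw [emb_apply, dif_neg this]) (F := F) (fun v => by simp [c])).image R.injective hΛ
  rw [← iUnion_coneOver_eq, ← h.2.2.2] at hloc
  have h1 := image_mem_blowUps (mem_blowUps_of_isLocalCone hN hℬ hZ hloc)
    (Λ.symm.toIsometryEquiv.trans R)
  rw [image_trans_image] at h1
  change R '' (Λ.symm '' (Λ '' _)) ∈ _ at h1
  rw [Set.image_image Λ.symm] at h1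
  simpa using h1

lemma exists_finite_representatives {𝒞 : Set (Set (Euc N))}
    (h : (Quotient.mk (isometricSetoid N) '' 𝒞).Finite) :
    ∃ 𝒮 ⊆ 𝒞, 𝒮.Finite ∧ ∀ Z ∈ 𝒞, ∃ Z₀ ∈ 𝒮, ∃ R : Euc N ≃ᵢ Euc N, Z = R '' Z₀ := by
  obtain ⟨𝒮, hS, hbij⟩ := Set.exists_subset_bijOn 𝒞 (Quotient.mk (isometricSetoid N))
  refine ⟨𝒮, hS, Set.Finite.of_finite_image (by rwa [hbij.image_eq]) hbij.injOn, fun Z hZ => ?_⟩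
  obtain ⟨Z₀, hZ₀, e⟩ := hbij.surjOn (Set.mem_image_of_mem _ hZ)
  obtain ⟨R, hR⟩ := Quotient.exact e.symm
  exact ⟨Z₀, hZ₀, R, hR⟩

/-- The class of blow-ups is finite modulo isometries. -/
theorem blowUps_finite (hN : N' + n ≤ N)
    (hℬ : ∀ W ∈ ℬ, ∃ m ≤ n, IsTypeSet n N' m W)
    (hfin : (Quotient.mk (isometricSetoid N) '' ℬ).Finite) :
    (Quotient.mk (isometricSetoid N) '' blowUps ℬ).Finite := by
  have hN' : N' ≤ N := by omega
  obtain ⟨𝒟, hD, hDfin, hrep⟩ := exists_finite_representatives hfin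
  have hC : ∀ W ∈ 𝒟, ∃ C : Set (Quotient (isometricSetoid N)), C.Finite ∧
      ∀ x K, IsBlowUp W x K → Quotient.mk (isometricSetoid N) K ∈ C := by
    intro W hW
    obtain ⟨m, hm, h⟩ := hℬ W (hD hW)
    obtain ⟨𝒳, -, -, -, H⟩ := h.exists_of_isBlowUp hN'
    refine ⟨(fun F => Quotient.mk (isometricSetoid N) (prodFlat m (starCone 𝒳 F))) '' Omega 𝒳,
      (finite_Omega 𝒳).image _, fun x K hK => ?_⟩
    obtain ⟨-, F, hF, Λ, rfl⟩ := H x K hK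
    exact ⟨F, hF, Quotient.sound ⟨Λ.symm.toIsometryEquiv, by
      change _ = Λ.symm '' (Λ '' _)
      rw [Set.image_image]
      simp⟩⟩
  choose! C hCfin hC using hC
  refine (hDfin.biUnion hCfin).subset ?_
  rintro _ ⟨Z, ⟨W, hW, x, K, R, hK, rfl⟩, rfl⟩
  obtain ⟨m, hm, h⟩ := hℬ W hW
  obtain ⟨W₀, hW₀, R₀, rfl⟩ := hrep W hW
  obtain ⟨𝒳, -, -, -, H⟩ := h.exists_of_isBlowUp hN'
  obtain ⟨Λ, hΛ⟩ := exists_linear_part R₀.symm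
  have h1 := (H x K hK).1.image R₀.symm.injective hΛ
  rw [symm_image_image] at h1
  refine Set.mem_biUnion hW₀ ?_
  have h2 := hC W₀ hW₀ _ _ h1.isBlowUp
  rwa [show Quotient.mk (isometricSetoid N) (R '' K) = Quotient.mk (isometricSetoid N) (Λ '' K) from
    Quotient.sound ⟨Λ.symm.toIsometryEquiv.trans R, by
      rw [image_trans_image]
      change _ = R '' (Λ.symm '' (Λ '' K))
      rw [Set.image_image Λ.symm]
      simp⟩]

end BlowUps

/-! ### Existence of admissible constants -/

section Constants

variable {N N' n : ℕ} {ℬ : Set (Set (Euc N))}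

lemma IsTypeSet.exists_gap (hN : N' + n ≤ N) {m : ℕ} {V : Set (Euc N)}
    (h : IsTypeSet n N' m V) :
    ∃ δ > 0, ∀ t < n, ∀ x ∈ spine n N' t V, ∀ k, t < k → ∀ W, IsTypeSet n N' k W →
      ∀ r > 0, ENNReal.ofReal δ < relDist x r V W := by
  obtain ⟨𝒳, R, h⟩ := h
  obtain ⟨δ, hδ, H⟩ := h.exists_lt_relDist hN
  refine ⟨δ, hδ, fun t ht x hx k hk W hW r hr => ?_⟩
  obtain ⟨hmt, hx⟩ := (h.mem_spine_iff hN ht.le).1 hx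
  obtain ⟨S, hS, hSW⟩ := hW.exists_isInvariant hN
  exact H t hmt ht x hx S (by omega) W hSW r hr

/-- A set of type `k` can be moved off any ball. -/
lemma IsTypeSet.exists_disjoint_ball (hn : 0 < n) (hN' : n < N') (hN : N' + n ≤ N) {k : ℕ}
    {Y : Set (Euc N)} (h : IsTypeSet n N' k Y) (x : Euc N) {r : ℝ} (hr : 0 < r) :
    ∃ R : Euc N ≃ᵢ Euc N, R '' Y ∩ Metric.ball x r = ∅ := by
  obtain ⟨𝒳, R₀, hk, hX, -, rfl⟩ := h
  have hle : N' ≤ N := by omega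
  -- The spans have dimension at most `n < N'`, and finitely many proper subspaces do not cover
  -- `ℝ^N'`. Rescaling a point off them puts it at distance at least `r` from the cone.
  have hcov : (⋃ p ∈ 𝒳.image fun X : Finset (Euc N') => Submodule.span ℝ (X : Set (Euc N')),
      (p : Set (Euc N'))) ≠
      Set.univ := by
    refine Subspace.biUnion_ne_univ_of_top_notMem fun htop => ?_
    obtain ⟨X, hXm, e⟩ := Finset.mem_image.1 htop
    have h1 := finrank_span_finset_le_card (R := ℝ) X
    rw [Set.finrank, e, finrank_top, (hX.2.1 X hXm).1, finrank_euclideanSpace_fin] at h1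
    omega
  obtain ⟨p, hp⟩ := (Set.ne_univ_iff_exists_notMem _).1 hcov
  have hclosed : IsClosed (⋃ p ∈ 𝒳.image fun X : Finset (Euc N') =>
      Submodule.span ℝ (X : Set (Euc N')),
      (p : Set (Euc N'))) :=
    (Finset.finite_toSet _).isClosed_biUnion fun p _ => p.closed_of_finiteDimensional
  obtain ⟨ρ, hρ, hball⟩ := Metric.isOpen_iff.1 hclosed.isOpen_compl p hp
  have hdis : ∀ X ∈ 𝒳, ∀ y ∈ Submodule.span ℝ (X : Set (Euc N')), ρ ≤ ‖y - p‖ := by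
    intro X hXm y hy
    by_contra hlt
    rw [not_le, ← mem_ball_iff_norm] at hlt
    exact hball hlt (Set.mem_biUnion (by simpa using ⟨X, hXm, rfl⟩) hy)
  set q : Euc N := emb N ((r / ρ) • p) with hq
  have hfar : ∀ z ∈ (prodFlat k (⋃ X ∈ 𝒳, coneOver (X : Set (Euc N'))) : Set (Euc N)),
      r ≤ ‖z - q‖ := by
    intro z hz
    rw [mem_prodFlat_iff hle] at hz
    obtain ⟨hz, -⟩ := hz
    simp only [Set.mem_iUnion, exists_prop] at hz
    obtain ⟨X, hXm, hz⟩ := hz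
    obtain ⟨c, -, -, e⟩ := mem_coneOver_iff.1 hz
    have h1 := hdis X hXm ((ρ / r) • head N' z)
      (Submodule.smul_mem _ _ (e ▸ combo_mem_span X c))
    have h2 := norm_head_le hle (z - q)
    rw [map_sub, hq, head_emb hle] at h2
    refine le_trans ?_ h2
    have h3 : (ρ / r) • head N' z - p = (ρ / r) • (head N' z - (r / ρ) • p) := by
      rw [smul_sub, smul_smul, show ρ / r * (r / ρ) = 1 by field_simp, one_smul]
    rw [h3, norm_smul, Real.norm_of_nonneg (by positivity), div_mul_eq_mul_div,
      le_div_iff₀ hr] at h1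
    exact le_of_mul_le_mul_left h1 hρ
  refine ⟨R₀.symm.trans (IsometryEquiv.addRight (x - q)), ?_⟩
  rw [image_trans_image, symm_image_image]
  ext w
  simp only [Set.mem_inter_iff, Set.mem_empty_iff_false, iff_false, not_and]
  rintro ⟨z, hz, rfl⟩
  rw [mem_ball_iff_norm, not_lt]
  refine (hfar z hz).trans (le_of_eq ?_)
  congr 1
  change z - q = z + (x - q) - x
  abel

/-- For a point of `W` in the ball, count its coordinates exceeding `2 κ r`. If there are at most `t
- m`, deleting others leads to a nearby point of the `t`-spine. If there are more, `W` agrees in the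
ball with the star of a face with `t + 1 - m` elements. -/
lemma IsTypeSet.exists_replacement (hn : 0 < n) (hN' : n < N') (hN : N' + n ≤ N)
    (hℬ : ∀ W ∈ ℬ, ∃ m ≤ n, IsTypeSet n N' m W) {m : ℕ} {W : Set (Euc N)} (hW : W ∈ blowUps ℬ)
    (h : IsTypeSet n N' m W) :
    ∃ M : ℝ, ∀ n₀ ≥ M, ∀ t, m ≤ t → t < n → ∀ (x : Euc N) (r : ℝ), 0 < r →
      Metric.ball x (n₀ * r) ∩ spine n N' t W = ∅ →
      ∃ Y ∈ ofType n N' (blowUps ℬ) (t + 1), W ∩ Metric.ball x r = Y ∩ Metric.ball x r := by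
  have hle : N' ≤ N := by omega
  obtain ⟨𝒳, R, h⟩ := h
  obtain ⟨κ, hκ1, hκ⟩ := h.2.1.exists_lipschitz
  have hκ0 : 0 < κ := by linarith
  -- At most `n - m` coordinates are deleted, each at most `2 κ r`; the `1` accounts for the
  -- distance from `x` to the point of `W`.
  refine ⟨1 + 2 * (n - m : ℕ) * κ, fun n₀ hn₀ t hmt htn x r hr hsp => ?_⟩
  have hk : ∀ X ∈ 𝒳, X.card = n - m := fun X hX => (h.2.1.2.1 X hX).1
  -- Even an empty intersection must be realised by a set of type `t + 1`; one is moved off the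
  -- ball.
  rcases (W ∩ Metric.ball x r).eq_empty_or_nonempty with hemp | ⟨w, hwW, hwx⟩
  · obtain ⟨X, hX⟩ := h.2.1.1
    obtain ⟨F, hFX, hF⟩ := Finset.exists_subset_card_eq (s := X) (n := t + 1 - m)
      (by rw [hk X hX]; omega)
    have hY := starCone_mem_blowUps hN hℬ hW h ⟨X, hX, hFX⟩
    rw [hF, show m + (t + 1 - m) = t + 1 by omega] at hY
    obtain ⟨R', hR'⟩ := hY.2.exists_disjoint_ball hn hN' hN x hr
    exact ⟨_, image_mem_ofType hY R', by rw [hemp, hR']⟩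
  have hWe := h.2.2.2
  rw [iUnion_coneOver_eq] at hWe
  rw [hWe] at hwW
  obtain ⟨z, hz, rfl⟩ := hwW
  rw [mem_prodFlat_iff hle] at hz
  obtain ⟨⟨c, hc, hzc⟩, hz0⟩ := hz
  have hcX := hc.2
  obtain ⟨X, hX, -, hX0⟩ := hcX
  set G₀ := X.filter (2 * κ * r < c ·)
  have hG₀X : G₀ ⊆ X := Finset.filter_subset _ _
  rcases le_or_gt G₀.card (t - m) with hcard | hcard
  · exfalso
    obtain ⟨G, hG₀, hGX, hG⟩ := Finset.exists_subsuperset_card_eq hG₀X hcard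
      (by rw [hk X hX]; omega)
    set p := z - emb N (∑ v ∈ X \ G, c v • v) with hp
    have hzX : head N' z = ∑ v ∈ X, c v • v := by
      rw [hzc, combo_eq_of_subset (subset_verts hX) hX0, combo_apply]
    have hhp : head N' p = combo G c := by
      rw [hp, map_sub, head_emb hle, hzX, combo_apply, ← Finset.sum_sdiff hGX,
        add_sub_cancel_left]
    have hpsp : R p ∈ spine n N' t W := by
      refine (h.mem_spine_iff hN htn.le).2 ⟨hmt, p, ?_, rfl⟩
      rw [mem_prodFlat_iff hle, hhp]
      refine ⟨⟨G, ⟨X, hX, hGX⟩, hG, mem_coneOver_iff.2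
        ⟨fun v => if v ∈ G then c v else 0, fun v => ?_, fun v hv => if_neg hv, ?_⟩⟩,
          fun i hi => ?_⟩
      · dsimp only
        split_ifs
        exacts [hc.1 v (by simp), le_rfl]
      · exact combo_congr fun v hv => by rw [if_pos hv]
      · have : ¬ (i : ℕ) < N' := by omega
        rw [hp, PiLp.sub_apply, hz0 i hi, emb_apply, dif_neg this, sub_zero]
    have hdist : dist (R p) (R z) ≤ 2 * (n - m : ℕ) * κ * r := by
      rw [R.isometry.dist_eq, dist_eq_norm, hp, sub_sub_cancel_left, norm_neg, norm_emb hle]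
      calc ‖∑ v ∈ X \ G, c v • v‖ ≤ ∑ v ∈ X \ G, ‖c v • v‖ := norm_sum_le _ _
        _ ≤ ∑ v ∈ X \ G, 2 * κ * r := by
          refine Finset.sum_le_sum fun v hv => ?_
          rw [Finset.mem_sdiff] at hv
          rw [norm_smul, (h.2.1.2.1 X hX).2.1 v hv.1, mul_one,
            Real.norm_of_nonneg (hc.1 v (by simp))]
          by_contra hlt
          exact hv.2 (hG₀ (Finset.mem_filter.2 ⟨hv.1, not_le.1 hlt⟩))
        _ = (X \ G).card * (2 * κ * r) := by rw [Finset.sum_const, nsmul_eq_mul]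
        _ ≤ (n - m : ℕ) * (2 * κ * r) := by
          rw [← hk X hX]
          gcongr
          exact Finset.sdiff_subset
        _ = _ := by ring
    have : R p ∈ Metric.ball x (n₀ * r) ∩ spine n N' t W := by
      refine ⟨?_, hpsp⟩
      rw [Metric.mem_ball] at hwx ⊢
      have h1 := dist_triangle (R p) (R z) x
      have h2 := mul_le_mul_of_nonneg_right hn₀ hr.le
      linarith
    rw [hsp] at this
    exact this
  · obtain ⟨F, hFG, hF⟩ := Finset.exists_subset_card_eq (s := G₀) (n := t + 1 - m) (by omega)
    have hY := starCone_mem_blowUps hN hℬ hW h ⟨X, hX, hFG.trans hG₀X⟩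
    rw [hF, show m + (t + 1 - m) = t + 1 by omega] at hY
    refine ⟨_, hY, ?_⟩
    -- The radius is `2 r` because this ball is centred at a point of `W` in `B(x, r)` and has to
    -- contain `B(x, r)`.
    have hloc := starCone_inter_ball hκ hκ0 (F := F) hc (r := 2 * r) fun v hv => by
      have := (Finset.mem_filter.1 (hFG hv)).2
      linarith
    ext y
    refine and_congr_left fun hy => ?_
    obtain ⟨y, rfl⟩ := R.surjective y
    rw [hWe, R.injective.mem_set_image, R.injective.mem_set_image, mem_prodFlat_iff hle,
      mem_prodFlat_iff hle]
    refine and_congr_left fun _ => ?_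
    have hb : head N' y ∈ Metric.ball (combo (verts 𝒳) c) (2 * r) := by
      rw [mem_ball_iff_norm, ← hzc, ← map_sub]
      refine (norm_head_le hle _).trans_lt ?_
      rw [← dist_eq_norm, ← R.isometry.dist_eq]
      rw [Metric.mem_ball] at hy hwx
      linarith [dist_triangle_right (R y) (R z) x]
    have := Set.ext_iff.1 hloc (head N' y)
    simpa only [Set.mem_inter_iff, hb, and_true] using this

theorem exists_isConstantPair (hn : 0 < n) (hN' : n < N') (hN : N' + n ≤ N)
    (hℬ : ∀ W ∈ ℬ, ∃ m ≤ n, IsTypeSet n N' m W)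
    (hfin : (Quotient.mk (isometricSetoid N) '' ℬ).Finite) :
    ∃ n₀ δ₀ : ℝ, IsConstantPair n N' (blowUps ℬ) n₀ δ₀ := by
  obtain ⟨𝒮, hS, hSfin, hrep⟩ := exists_finite_representatives (blowUps_finite hN hℬ hfin)
  obtain ⟨δ, hδ, hgap⟩ := exists_pos_forall_finite hSfin
    (P := fun V δ => ∀ t < n, ∀ x ∈ spine n N' t V, ∀ k, t < k → ∀ W, IsTypeSet n N' k W →
      ∀ r > 0, ENNReal.ofReal δ < relDist x r V W)
    (fun V _ a b _ hab H t ht x hx k hk W hW r hr =>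
      (ENNReal.ofReal_le_ofReal hab).trans_lt (H t ht x hx k hk W hW r hr))
    (fun V hV => by
      obtain ⟨m, -, hm⟩ := exists_isTypeSet_of_mem_blowUps hN hℬ (hS hV)
      exact hm.exists_gap hN)
  -- The lower bound on `n₀` is written as `1 / a`, so that a uniform bound becomes a uniform small
  -- parameter.
  obtain ⟨a, ha, hrepl⟩ := exists_pos_forall_finite (hSfin.prod (Set.finite_Iic n))
    (P := fun Wm a => IsTypeSet n N' Wm.2 Wm.1 → ∀ n₀ ≥ 1 / a, ∀ t, Wm.2 ≤ t → t < n →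
      ∀ (x : Euc N) (r : ℝ), 0 < r → Metric.ball x (n₀ * r) ∩ spine n N' t Wm.1 = ∅ →
      ∃ Y ∈ ofType n N' (blowUps ℬ) (t + 1), Wm.1 ∩ Metric.ball x r = Y ∩ Metric.ball x r)
    (fun Wm _ a b ha hab H hW n₀ hn₀ =>
      H hW n₀ ((one_div_le_one_div_of_le ha hab).trans hn₀))
    (fun Wm hWm => by
      by_cases hW : IsTypeSet n N' Wm.2 Wm.1
      · obtain ⟨M, hM⟩ := hW.exists_replacement hn hN' hN hℬ (hS hWm.1)
        refine ⟨1 / max M 1, by positivity, fun _ n₀ hn₀ => hM n₀ ?_⟩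
        rw [one_div_one_div] at hn₀
        exact (le_max_left _ _).trans hn₀
      · exact ⟨1, one_pos, fun h => (hW h).elim⟩)
  have key : ∀ m t : ℕ, m ≤ t → t < n → ∀ W ∈ ofType n N' (blowUps ℬ) m, ∀ (x : Euc N) (r : ℝ),
      0 < r → Metric.ball x (max 11 (1 / a) * r) ∩ spine n N' t W = ∅ →
      ∃ Y ∈ ofType n N' (blowUps ℬ) (t + 1), W ∩ Metric.ball x r = Y ∩ Metric.ball x r := by
    intro m t hmt htn W hW x r hr hsp
    obtain ⟨W₀, hW₀, R, rfl⟩ := hrep W hW.1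
    have hW₀t : IsTypeSet n N' m W₀ := by
      have := hW.2.image R.symm
      rwa [symm_image_image] at this
    obtain ⟨Y, hY, e⟩ := hrepl (W₀, m) ⟨hW₀, by simp; omega⟩ hW₀t _ (le_max_right 11 (1 / a)) t
      hmt htn (R.symm x) r hr (by
        rw [Set.eq_empty_iff_forall_notMem] at hsp ⊢
        rintro y ⟨hy, hys⟩
        refine hsp (R y) ⟨?_, mem_spine_image hys R⟩
        rw [Metric.mem_ball] at hy ⊢
        rwa [← R.apply_symm_apply x, R.isometry.dist_eq])
    refine ⟨R '' Y, image_mem_ofType hY R, ?_⟩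
    have := congrArg (R '' ·) e
    simp only [Set.image_inter R.injective, R.image_ball, R.apply_symm_apply] at this
    exact this
  refine ⟨max 11 (1 / a), min δ (1 / 11), lt_of_lt_of_le (by norm_num) (le_max_left _ _),
    lt_min hδ (by norm_num), (min_le_right _ _).trans_lt (by norm_num), ?_, ?_⟩
  · intro m t hmt htn W hW x r hr
    refine ⟨fun _ hsp => ?_, fun hne => ?_⟩
    · obtain ⟨Y, hY, e⟩ := key m t hmt htn W hW x r hr hsp
      exact ⟨t + 1, by omega, by omega, Y, hY, e⟩
    · by_contra hemp
      obtain ⟨Y, hY, e⟩ := key m t hmt htn W hW x r hr (Set.not_nonempty_iff_eq_empty.1 hemp)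
      exact hne Y hY e
  · intro m t hmt htn V hV x hx k hk hkn W hW r hr
    refine lt_of_le_of_lt (ENNReal.ofReal_le_ofReal (min_le_left _ _)) ?_
    obtain ⟨V₀, hV₀, R, rfl⟩ := hrep V hV.1
    obtain ⟨y, rfl⟩ := R.surjective x
    rw [relDist_image_left]
    have hy := mem_spine_image hx R.symm
    rw [symm_image_image, R.symm_apply_apply] at hy
    have hW' := hW.2.image R.symm
    rw [R.image_symm] at hW'
    exact hgap V₀ hV₀ t htn y hy k hk _ hW' r hr

/-- Sets of type `m < n` have points of the next spine at any distance from a point of the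
smallest spine, and far from the smallest spine. -/
lemma exists_mem_next_spine (hN : N' + n ≤ N) {m : ℕ} {W : Set (Euc N)}
    (h : IsTypeSet n N' m W) (hmn : m < n) {x : Euc N} (hx : x ∈ spine n N' m W) {r : ℝ}
    (hr : 0 < r) : ∃ y ∈ spine n N' (m + 1) W, dist y x = r ∧
      Metric.ball y r ∩ spine n N' m W = ∅ := by
  have hle : N' ≤ N := by omega
  obtain ⟨𝒳, R, h⟩ := h
  have hsk : ∀ y ∈ skeleton 𝒳 (m - m), y = 0 := by
    rintro y ⟨Y, -, hY, hy⟩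
    rw [Nat.sub_self, Finset.card_eq_zero] at hY
    subst hY
    obtain ⟨c, -, -, rfl⟩ := mem_coneOver_iff.1 hy
    simp [combo_apply]
  have hhead : ∀ z ∈ (prodFlat m (skeleton 𝒳 (m - m)) : Set (Euc N)), head N' z = 0 := fun z hz =>
    hsk _ ((mem_prodFlat_iff hle).1 hz).1
  obtain ⟨-, z, hz, rfl⟩ := (h.mem_spine_iff hN hmn.le).1 hx
  obtain ⟨X, hX⟩ := h.2.1.1
  -- A step of length `r` along an edge of the cone gives a head of norm `r`, whereas heads vanish
  -- on the `m`-spine before applying `R`.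
  obtain ⟨v, hv⟩ : X.Nonempty := by
    rw [← Finset.card_pos, (h.2.1.2.1 X hX).1]
    omega
  have hv1 : ‖r • v‖ = r := by
    rw [norm_smul, (h.2.1.2.1 X hX).2.1 v hv, mul_one, Real.norm_of_nonneg hr.le]
  have hhv : head N' (z + emb N (r • v)) = r • v := by
    rw [map_add, hhead z hz, head_emb hle, zero_add]
  refine ⟨R (z + emb N (r • v)), (h.mem_spine_iff hN hmn).2 ⟨by omega, _, ?_, rfl⟩, ?_, ?_⟩
  · rw [mem_prodFlat_iff hle, hhv]
    refine ⟨⟨{v}, ⟨X, hX, by simpa using hv⟩, by simp, ?_⟩, fun i hi => ?_⟩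
    · exact Or.inr ⟨r, hr.le, v, subset_convexHull _ _ (by simp), rfl⟩
    · have : ¬ (i : ℕ) < N' := by omega
      rw [PiLp.add_apply, ((mem_prodFlat_iff hle).1 hz).2 i hi, emb_apply, dif_neg this, add_zero]
  · rw [R.isometry.dist_eq, dist_eq_norm, add_sub_cancel_left, norm_emb hle, hv1]
  · rw [Set.eq_empty_iff_forall_notMem]
    rintro w ⟨hw, hws⟩
    obtain ⟨-, w, hw', rfl⟩ := (h.mem_spine_iff hN hmn.le).1 hws
    rw [Metric.mem_ball, R.isometry.dist_eq, dist_comm, dist_eq_norm] at hw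
    have := norm_head_le hle (z + emb N (r • v) - w)
    rw [map_sub, hhv, hhead w hw', sub_zero, hv1] at this
    linarith

end Constants

end ConeStrata

namespace ConeStrata

open scoped Classical

/-! ### Closeness of two sets in a ball, with explicit radii and errors -/

section Close

variable {N : ℕ}

/-- In the ball `B(x, r)`, the sets `A` and `B` are within distance `a` of each other. -/
def Close (x : Euc N) (r a : ℝ) (A B : Set (Euc N)) : Prop :=
  (∀ z ∈ A, dist z x < r → ∃ y ∈ B, dist z y < a) ∧
    ∀ z ∈ B, dist z x < r → ∃ y ∈ A, dist z y < a

variable {x x' : Euc N} {r r' a b : ℝ} {A B C : Set (Euc N)}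

lemma Close.symm (h : Close x r a A B) : Close x r a B A := ⟨h.2, h.1⟩

lemma Close.mono (h : Close x r a A B) (hr : r' + dist x' x ≤ r) (ha : a ≤ b) :
    Close x' r' b A B := by
  have key : ∀ z, dist z x' < r' → dist z x < r := fun z hz => by
    linarith [dist_triangle z x' x]
  refine ⟨fun z hz hzx => ?_, fun z hz hzx => ?_⟩
  · obtain ⟨y, hy, hzy⟩ := h.1 z hz (key z hzx)
    exact ⟨y, hy, hzy.trans_le ha⟩
  · obtain ⟨y, hy, hzy⟩ := h.2 z hz (key z hzx)
    exact ⟨y, hy, hzy.trans_le ha⟩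

lemma Close.mono_radius (h : Close x r a A B) (hr : r' ≤ r) (ha : a ≤ b) : Close x r' b A B :=
  h.mono (by simpa using hr) ha

/-- The intermediate point may leave the ball of radius `r'` by the first error, whence the loss of
radius. -/
lemma Close.trans (h : Close x r a A B) (h' : Close x r b B C) (ha : r' + a ≤ r)
    (hb : r' + b ≤ r) (hr : r' ≤ r) : Close x r' (a + b) A C := by
  refine ⟨fun z hz hzx => ?_, fun z hz hzx => ?_⟩
  · obtain ⟨y, hy, hzy⟩ := h.1 z hz (hzx.trans_le hr)
    obtain ⟨w, hw, hyw⟩ := h'.1 y hy (by linarith [dist_triangle_left y x z])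
    exact ⟨w, hw, by linarith [dist_triangle z y w]⟩
  · obtain ⟨y, hy, hzy⟩ := h'.2 z hz (hzx.trans_le hr)
    obtain ⟨w, hw, hyw⟩ := h.2 y hy (by linarith [dist_triangle_left y x z])
    exact ⟨w, hw, by linarith [dist_triangle z y w]⟩

lemma Close.congr_right (h : Close x r a A B) {s : ℝ}
    (e : B ∩ Metric.ball x s = C ∩ Metric.ball x s)
    (ha : r' + a ≤ s) (hr : r' ≤ r) (hs : r' ≤ s) : Close x r' a A C := by
  refine ⟨fun z hz hzx => ?_, fun z hz hzx => ?_⟩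
  · obtain ⟨y, hy, hzy⟩ := h.1 z hz (hzx.trans_le hr)
    have : y ∈ C ∩ Metric.ball x s := e ▸ ⟨hy, by
      rw [Metric.mem_ball]; linarith [dist_triangle_left y x z]⟩
    exact ⟨y, this.1, hzy⟩
  · have : z ∈ B ∩ Metric.ball x s := e ▸ ⟨hz, hzx.trans_le hs⟩
    exact h.2 z this.1 (hzx.trans_le hr)

/-- Used to move a spine point that is near a given point of `E` exactly onto it. -/
lemma Close.translate (h : Close x r a A B) {v : Euc N} (hv : ‖v‖ < b) (ha : r' + a ≤ r)
    (hb : r' + b ≤ r) (hr : r' ≤ r) :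
    Close x r' (a + b) A (IsometryEquiv.addRight v '' B) := by
  refine h.trans ⟨fun z hz _ => ⟨z + v, ⟨z, hz, rfl⟩, by simpa [dist_eq_norm] using hv⟩, ?_⟩
    ha hb hr
  rintro _ ⟨z, hz, rfl⟩ -
  exact ⟨z, hz, by simpa [dist_eq_norm] using hv⟩

lemma close_of_relDist_lt (hr : 0 < r) (h : relDist x r A B < ENNReal.ofReal a) :
    Close x r (a * r) A B := by
  have ha : 0 < a := by
    by_contra! h0
    simp [ENNReal.ofReal_of_nonpos h0] at h
  have h' : (relDist x r A B).toReal < a := (ENNReal.lt_ofReal_iff_toReal_lt h.ne_top).1 h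
  have := exists_dist_lt_of_relDist_le hr (ENNReal.ofReal_toReal h.ne_top).symm.le
    (mul_lt_mul_of_pos_right h' hr) (by positivity)
  exact ⟨this.2, this.1⟩

lemma Close.relDist_le (h : Close x r a A B) (hr : 0 < r) :
    relDist x r A B ≤ ENNReal.ofReal (a / r) := by
  rw [relDist, ENNReal.ofReal_div_of_pos hr]
  have key : ∀ C D : Set (Euc N), (∀ z ∈ C, dist z x < r → ∃ y ∈ D, dist z y < a) →
      ⨆ z ∈ C ∩ Metric.ball x r, Metric.infEDist z D ≤ ENNReal.ofReal a := by
    intro C D h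
    refine iSup₂_le fun z hz => ?_
    obtain ⟨y, hy, hzy⟩ := h z hz.1 hz.2
    refine (Metric.infEDist_le_edist_of_mem hy).trans ?_
    rw [edist_dist]
    exact ENNReal.ofReal_le_ofReal hzy.le
  exact ENNReal.div_le_div_right (max_le (key _ _ h.2) (key _ _ h.1)) _

end Close

/-! ### The strata of `E`, described by the types of approximating sets -/

section Strata

variable {N : ℕ}

/-- The standing hypotheses on the constants and on the set `E`. -/
structure IsTame (n N' : ℕ) (𝒜 : Set (Set (Euc N))) (n₀ δ₀ ε : ℝ) (E : Set (Euc N)) : Prop where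
  le : N' + n ≤ N
  pair : IsConstantPair n N' 𝒜 n₀ δ₀
  image_mem : ∀ m, ∀ W ∈ ofType n N' 𝒜 m, ∀ R : Euc N ≃ᵢ Euc N, R '' W ∈ ofType n N' 𝒜 m
  pos : 0 < ε
  small : 16 * n₀ ^ 2 * ε * (4000 * n₀ ^ 2) ≤ δ₀
  approx : ∀ x ∈ E, ∀ r, 0 < r → ∃ j, ∃ Z ∈ ofType n N' 𝒜 j, Close x r (ε * r) E Z

/-- At `x` and at the scale `r`, the set `E` is `a`-close to a set of `𝒜` of type at least `t`. -/
def HighAt (n N' : ℕ) (𝒜 : Set (Set (Euc N))) (E : Set (Euc N)) (a : ℝ) (t : ℕ) (x : Euc N)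
    (r : ℝ) : Prop :=
  ∃ k, t ≤ k ∧ ∃ W ∈ ofType n N' 𝒜 k, Close x r (a * r) E W

variable {n N' : ℕ} {𝒜 : Set (Set (Euc N))} {n₀ δ₀ ε : ℝ} {E : Set (Euc N)}

lemma IsTypeSet.le {m : ℕ} {W : Set (Euc N)} (h : IsTypeSet n N' m W) : m ≤ n := by
  obtain ⟨_, _, h⟩ := h
  exact h.1

lemma HighAt.mono {a b : ℝ} {s t : ℕ} {x : Euc N} {r : ℝ} (h : HighAt n N' 𝒜 E a t x r)
    (hr : 0 ≤ r) (hab : a ≤ b) (hst : s ≤ t) : HighAt n N' 𝒜 E b s x r := by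
  obtain ⟨k, hk, W, hW, hc⟩ := h
  exact ⟨k, hst.trans hk, W, hW, hc.mono_radius le_rfl (mul_le_mul_of_nonneg_right hab hr)⟩

namespace IsTame

variable (h : IsTame n N' 𝒜 n₀ δ₀ ε E)

include h

lemma not_close {m t k : ℕ} {V W : Set (Euc N)} {x : Euc N} {r a : ℝ} (hmt : m ≤ t)
    (hV : V ∈ ofType n N' 𝒜 m) (hx : x ∈ spine n N' t V) (htk : t < k)
    (hW : W ∈ ofType n N' 𝒜 k) (hr : 0 < r) (ha : a ≤ δ₀ * r) : ¬ Close x r a V W := by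
  intro hc
  have hkn := hW.2.le
  refine (h.pair.2.2.2.2 m t hmt (htk.trans_le hkn) V hV x hx k htk hkn W hW r hr).not_ge ?_
  refine (hc.relDist_le hr).trans (ENNReal.ofReal_le_ofReal ?_)
  rwa [div_le_iff₀ hr]

lemma exists_eq_on_ball {m t : ℕ} {W : Set (Euc N)} (hmt : m ≤ t) (htn : t < n)
    (hW : W ∈ ofType n N' 𝒜 m) {x : Euc N} {r : ℝ} (hr : 0 < r)
    (he : ∀ p ∈ spine n N' t W, ¬ dist p x < n₀ * r) :
    ∃ Y ∈ ofType n N' 𝒜 (t + 1), W ∩ Metric.ball x r = Y ∩ Metric.ball x r := by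
  by_contra! hne
  obtain ⟨p, hp, hps⟩ := (h.pair.2.2.2.1 m t hmt htn W hW x r hr).2 hne
  exact he p hps hp

lemma alpha_le : 16 * n₀ ^ 2 * ε ≤ δ₀ / (4000 * n₀ ^ 2) := by
  have := h.pair.1
  rw [le_div_iff₀ (by positivity)]
  exact h.small

/-- If the `t`-spine stayed away, `W` could be replaced near `x` by a set of type `t + 1`, which
`hno` excludes. For `t = n` the spine is `W` itself. -/
lemma exists_mem_spine_close {t : ℕ} {W : Set (Euc N)} (hW : W ∈ ofType n N' 𝒜 t) {x : Euc N}
    (hx : x ∈ E) {r a s b : ℝ} (hs : 0 < s) (hc : Close x r a E W) (hr0 : 0 < r)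
    (hab : 2 * a ≤ s) (hsr : s ≤ r) (hsb : n₀ * s ≤ b)
    (hno : ∀ Y ∈ ofType n N' 𝒜 (t + 1), ¬ Close x (s / 2) a E Y) :
    ∃ p ∈ spine n N' t W, dist p x < b := by
  have hn₀ := h.pair.1
  rcases hW.2.le.eq_or_lt with rfl | htn
  · obtain ⟨y, hy, hxy⟩ := hc.1 x hx (by simpa using hr0)
    refine ⟨y, by rwa [spine_top_eq h.le hW.2], ?_⟩
    rw [dist_comm]
    nlinarith
  · by_contra! hp
    obtain ⟨Y, hY, e⟩ := h.exists_eq_on_ball le_rfl htn hW hs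
      fun p hps => not_lt.2 (hsb.trans (hp p hps))
    exact hno Y hY (hc.congr_right e (by linarith) (by linarith) (by linarith))

/-- The rough approximation `W` only certifies the type; the accuracy comes from the
`ε`-approximation `Z`. If `Z` has lower type, the gap keeps its spine away from `x`, and near `x` it
can be replaced by a set of type `t` at no cost. The error `ε r` is `4 n₀ ε` relative to the new
radius. -/
lemma highAt_step {t : ℕ} {x : Euc N} {r : ℝ} (hx : x ∈ E) (hr : 0 < r)
    (hh : HighAt n N' 𝒜 E (δ₀ / 100) t x r) : HighAt n N' 𝒜 E (4 * n₀ * ε) t x (r / (4 * n₀)) := by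
  have hn₀ := h.pair.1
  have hδ := h.pair.2.1
  have hδ1 := h.pair.2.2.1
  have hε := h.pos
  have hsm : 16 * ε * n₀ ≤ δ₀ := by
    refine le_trans ?_ h.small
    have h3 : 1 ≤ n₀ ^ 3 := one_le_pow₀ (by linarith)
    have : 16 * ε * n₀ ≤ 16 * ε * n₀ * (4000 * n₀ ^ 3) :=
      le_mul_of_one_le_right (by positivity) (by linarith)
    linarith
  have hε1 : 160 * ε ≤ δ₀ := by nlinarith
  have e1 : 4 * n₀ * ε * (r / (4 * n₀)) = ε * r := by field_simp
  have hs : r / (4 * n₀) ≤ r / 40 := div_le_div_of_nonneg_left hr.le (by norm_num) (by linarith)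
  have hεr : ε * r ≤ r / (4 * n₀) := by
    rw [le_div_iff₀ (by positivity)]
    nlinarith
  have hεr' : 160 * (ε * r) ≤ δ₀ * r := by nlinarith
  have hδr : 10 * (δ₀ * r) ≤ r := by nlinarith
  obtain ⟨k, hk, W, hW, hc⟩ := hh
  obtain ⟨j, Z, hZ, hZc⟩ := h.approx x hx r hr
  rw [HighAt, e1]
  by_cases hj : t ≤ j
  · exact ⟨j, hj, Z, hZ, hZc.mono_radius (by linarith) le_rfl⟩
  obtain ⟨m, rfl⟩ : ∃ m, t = m + 1 := ⟨t - 1, by omega⟩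
  have hkn := hW.2.le
  -- A point of the `m`-spine of `Z` within `r / 2` of `x` would be one where `Z` is close to `W`,
  -- of type larger than `m`. So the spine misses the ball of radius `n₀ · r / (2 n₀)`.
  obtain ⟨Y, hY, e⟩ := h.exists_eq_on_ball (t := m) (by omega) (by omega) hZ (x := x)
    (r := r / (2 * n₀)) (by positivity) (by
      intro p hp hpx
      have : n₀ * (r / (2 * n₀)) = r / 2 := by field_simp
      rw [this] at hpx
      have hZW : Close x (3 * r / 4) (ε * r + δ₀ / 100 * r) Z W :=
        hZc.symm.trans hc (by linarith) (by linarith) (by linarith)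
      exact h.not_close (by omega) hZ hp hk hW (by positivity : 0 < r / 4) (by nlinarith)
        (hZW.mono (by linarith) le_rfl))
  refine ⟨m + 1, le_rfl, Y, hY, hZc.congr_right e ?_ (by linarith) ?_⟩
  · have : r / (2 * n₀) = r / (4 * n₀) + r / (4 * n₀) := by field_simp; norm_num
    linarith
  · exact div_le_div_of_nonneg_left hr.le (by positivity) (by linarith)

lemma alpha_small : 16 * n₀ ^ 2 * ε * 40000 * n₀ ≤ δ₀ ∧ 16 * n₀ ^ 2 * ε * 400000 ≤ δ₀ ∧
    0 < 16 * n₀ ^ 2 * ε ∧ ε ≤ 16 * n₀ ^ 2 * ε := by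
  have hn₀ := h.pair.1
  have hε := h.pos
  have h0 : 0 < 16 * n₀ ^ 2 * ε := by positivity
  have := h.small
  have h1 : 100 ≤ n₀ * n₀ := by nlinarith
  refine ⟨le_trans ?_ h.small, le_trans ?_ h.small, h0, ?_⟩
  · rw [mul_assoc]
    exact mul_le_mul_of_nonneg_left (by nlinarith) h0.le
  · exact mul_le_mul_of_nonneg_left (by nlinarith) h0.le
  · exact le_mul_of_one_le_left hε.le (by nlinarith)

/-- The step preserves the rough hypothesis, so it can be iterated along the scales `r / (4 n₀)^j`.
Restricting to intermediate scales costs one more factor `4 n₀`. -/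
lemma highAt_of_le {t : ℕ} {x : Euc N} {r s : ℝ} (hx : x ∈ E) (hr : 0 < r)
    (hh : HighAt n N' 𝒜 E (δ₀ / 100) t x r) (hs : 0 < s) (hsr : s ≤ r / (4 * n₀)) :
    HighAt n N' 𝒜 E (16 * n₀ ^ 2 * ε) t x s := by
  have hn₀ := h.pair.1
  have hε := h.pos
  obtain ⟨-, hα, hα0, hεα⟩ := h.alpha_small
  have key : ∀ r s, 0 < r → HighAt n N' 𝒜 E (δ₀ / 100) t x r → s ≤ r / (4 * n₀) →
      r / (4 * n₀) / (4 * n₀) ≤ s → HighAt n N' 𝒜 E (16 * n₀ ^ 2 * ε) t x s := by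
    intro r s hr hh hsr hrs
    obtain ⟨k, hk, W, hW, hc⟩ := h.highAt_step hx hr hh
    refine ⟨k, hk, W, hW, hc.mono_radius hsr ?_⟩
    calc 4 * n₀ * ε * (r / (4 * n₀)) = 16 * n₀ ^ 2 * ε * (r / (4 * n₀) / (4 * n₀)) := by
          field_simp; norm_num
      _ ≤ _ := by gcongr
  have hpow : ∀ j : ℕ, HighAt n N' 𝒜 E (δ₀ / 100) t x (r * (1 / (4 * n₀)) ^ j) := by
    intro j
    induction j with
    | zero => simpa using hh
    | succ j ih =>
      have hpos : 0 < r * (1 / (4 * n₀)) ^ j := by positivity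
      refine (key _ _ hpos ih (by rw [pow_succ]; exact le_of_eq (by ring)) ?_).mono
        (by positivity) (by linarith) le_rfl
      rw [pow_succ, ← mul_assoc, mul_one_div]
      exact div_le_self (by positivity) (by linarith)
  have hq : 1 / (4 * n₀) < 1 := by
    rw [div_lt_one (by positivity)]
    linarith
  obtain ⟨j, hj1, hj2⟩ := exists_nat_pow_near_of_lt_one (x := s * (4 * n₀) / r)
    (y := 1 / (4 * n₀)) (by positivity)
    (by rw [div_le_one hr]; rwa [le_div_iff₀ (by positivity)] at hsr) (by positivity) hq
  rw [lt_div_iff₀ hr] at hj1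
  rw [div_le_iff₀ hr] at hj2
  refine key _ s (by positivity) (hpow j) ?_ ?_
  · rw [le_div_iff₀ (by positivity)]
    linarith
  · rw [div_le_iff₀ (by positivity)]
    refine le_of_eq_of_le ?_ hj1.le
    rw [pow_succ]
    ring

lemma highAt_zero {x : Euc N} (hx : x ∈ E) {r : ℝ} (hr : 0 < r) :
    HighAt n N' 𝒜 E (δ₀ / 100) 0 x r := by
  obtain ⟨j, Z, hZ, hc⟩ := h.approx x hx r hr
  have hn₀ := h.pair.1
  obtain ⟨-, hα, hα0, hεα⟩ := h.alpha_small
  have : ε ≤ δ₀ / 100 := by linarith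
  exact ⟨j, Nat.zero_le _, Z, hZ, hc.mono_radius le_rfl (mul_le_mul_of_nonneg_right this hr.le)⟩

/-- At a smaller scale the error is far below `δ₀ / 100`, so the same approximating set serves all
nearby centres. -/
lemma exists_highAt_of_dist {t : ℕ} {x : Euc N} {r : ℝ} (hx : x ∈ E) (hr : 0 < r)
    (hh : HighAt n N' 𝒜 E (δ₀ / 100) t x r) : ∃ s, 0 < s ∧ ∀ y, dist y x < s →
      HighAt n N' 𝒜 E (δ₀ / 100) t y s := by
  have hn₀ := h.pair.1
  have hε := h.pos
  obtain ⟨-, hα, hα0, hεα⟩ := h.alpha_small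
  obtain ⟨k, hk, W, hW, hc⟩ := h.highAt_of_le hx hr hh (s := r / (4 * n₀)) (by positivity) le_rfl
  have hs : 0 < r / (4 * n₀) := by positivity
  refine ⟨r / (4 * n₀) / 2, by positivity, fun y hy => ⟨k, hk, W, hW, hc.mono (by linarith) ?_⟩⟩
  nlinarith

/-- The stratum `E_t` consists of the points of `E ∩ B(0, 2)` near which `E` is close to sets of
type at least `t`, but not to sets of type larger than `t`. -/
lemma mem_stratum_iff {C₀ : ℝ} (hκ : C₀ * ε ≤ δ₀ / 100)
    (hκ' : 10000 * n₀ ^ 3 * ε < δ₀ * (C₀ * ε)) {t : ℕ} {x : Euc N} :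
    x ∈ stratum n N' 𝒜 C₀ ε E t ↔
      (x ∈ E ∩ Metric.ball 0 2 ∧ (∃ r, 0 < r ∧ HighAt n N' 𝒜 E (δ₀ / 100) t x r)) ∧
        ¬ ∃ r, 0 < r ∧ HighAt n N' 𝒜 E (δ₀ / 100) (t + 1) x r := by
  generalize hκ0 : C₀ * ε = κ at hκ hκ'
  simp only [stratum, hκ0, Set.mem_ofPred_eq]
  have hn₀ := h.pair.1
  have hδ := h.pair.2.1
  have hδ1 := h.pair.2.2.1
  have hε := h.pos
  obtain ⟨-, hα, hα0, hεα⟩ := h.alpha_small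
  have hdev : ∀ r, typeDeviation n N' 𝒜 E t x r < ENNReal.ofReal κ → 0 < r →
      ∃ W ∈ ofType n N' 𝒜 t, x ∈ spine n N' t W ∧ Close x r (κ * r) E W := by
    intro r hr hr0
    simp only [typeDeviation, iInf_lt_iff] at hr
    obtain ⟨W, ⟨hW, hxW⟩, hd⟩ := hr
    exact ⟨W, hW, hxW, close_of_relDist_lt hr0 hd⟩
  constructor
  · rintro ⟨hx, ρ, hρ, H⟩
    refine ⟨⟨hx, ρ / 2, by positivity, ?_⟩, ?_⟩
    · obtain ⟨W, hW, -, hc⟩ := hdev (ρ / 2) (H _ (by positivity) (by linarith)) (by positivity)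
      exact ⟨t, le_rfl, W, hW, hc.mono_radius le_rfl
        (mul_le_mul_of_nonneg_right hκ (by positivity))⟩
    -- At one small scale `E` would be close both to a set of type larger than `t` and to a set of
    -- type `t` with `x` on its `t`-spine, against the gap.
    · rintro ⟨r, hr, hh⟩
      obtain ⟨s, hs, hsr, hsρ⟩ : ∃ s, 0 < s ∧ s ≤ r / (4 * n₀) ∧ s < ρ :=
        ⟨min (r / (4 * n₀)) (ρ / 2), by positivity, min_le_left _ _,
          (min_le_right _ _).trans_lt (by linarith)⟩
      obtain ⟨k, hk, W, hW, hc⟩ := h.highAt_of_le hx.1 hr hh hs hsr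
      obtain ⟨V, hV, hxV, hc'⟩ := hdev s (H s hs hsρ) hs
      refine h.not_close le_rfl hV hxV hk hW (by positivity : 0 < s / 2) ?_
        (hc'.symm.trans hc ?_ ?_ (by linarith)) <;> nlinarith
  · rintro ⟨⟨hx, r, hr, hh⟩, hno⟩
    refine ⟨hx, r / (8 * n₀), by positivity, fun s' hs' hsr' => ?_⟩
    obtain ⟨s, rfl⟩ : ∃ s, s' = s / 2 := ⟨2 * s', by ring⟩
    have hs : 0 < s := by linarith
    have hsr : s ≤ r / (4 * n₀) := by
      have : r / (4 * n₀) = 2 * (r / (8 * n₀)) := by field_simp; norm_num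
      linarith
    set α := 16 * n₀ ^ 2 * ε with hαdef
    obtain ⟨k, hk, W, hW, hc⟩ := h.highAt_of_le hx.1 hr hh hs hsr
    rw [← hαdef] at hc
    obtain rfl : k = t := by
      by_contra hne
      exact hno ⟨s, hs, k, by omega, W, hW, hc.mono_radius le_rfl
        (mul_le_mul_of_nonneg_right (by linarith) hs.le)⟩
    have hl : n₀ * (200 * α / δ₀) = 3200 * n₀ ^ 3 * ε / δ₀ := by
      rw [hαdef]; field_simp; norm_num
    have hl1 : 3200 * n₀ ^ 3 * ε / δ₀ < 0.32 * κ := by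
      rw [div_lt_iff₀ hδ]
      linarith
    have hl0 : 0 < 200 * α / δ₀ := by positivity
    have hαl : 2 * α ≤ 200 * α / δ₀ := by
      rw [le_div_iff₀ hδ]
      nlinarith
    have hlκ : 10 * (200 * α / δ₀) ≤ 0.32 * κ := by nlinarith
    -- The factor `200 α / δ₀` is chosen so that the error `α s` is exactly `δ₀ / 100` of half the
    -- radius: a set of type `t + 1` there would contradict `hno`.
    obtain ⟨p, hp, hpx⟩ := h.exists_mem_spine_close hW hx.1 (s := 200 * α / δ₀ * s)
      (b := n₀ * (200 * α / δ₀) * s) (by positivity) hc hs (by nlinarith) (by nlinarith)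
      (by rw [mul_assoc]) (by
        intro Y hY hcY
        refine hno ⟨200 * α / δ₀ * s / 2, by positivity, k + 1, le_rfl, Y, hY,
          hcY.mono_radius le_rfl (le_of_eq ?_)⟩
        field_simp; norm_num)
    -- Moving the spine point `p` to `x` adds an error of order `n₀³ ε s / δ₀`; absorbing it is what
    -- requires `C₀` to be large.
    have hfin : Close x (s / 2) (α * s + n₀ * (200 * α / δ₀) * s) E
        (IsometryEquiv.addRight (x - p) '' W) := by
      refine hc.translate ?_ ?_ ?_ (by linarith)
      · rwa [← dist_eq_norm, dist_comm]
      · nlinarith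
      · nlinarith
    have hmem : x ∈ spine n N' k (IsometryEquiv.addRight (x - p) '' W) := by
      have := mem_spine_image hp (IsometryEquiv.addRight (x - p))
      rwa [IsometryEquiv.addRight_apply, add_sub_cancel] at this
    refine lt_of_le_of_lt (iInf₂_le _ ⟨h.image_mem _ _ hW _, hmem⟩) ?_
    refine (hfin.relDist_le hs').trans_lt ?_
    rw [ENNReal.ofReal_lt_ofReal_iff (by nlinarith)]
    rw [div_lt_iff₀ hs']
    nlinarith

/-- At a smaller scale `E` is close to a set `W` of type at least `t`. Comparison with `K`, whose
`t`-spine contains `e`, forces type `t` and a point of the spine of `W` near `e`. Recentring `W` at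
a point of `E` near that spine point restores all hypotheses. -/
lemma exists_refine {t : ℕ} {e : Euc N} {K : Set (Euc N)} {r : ℝ} (he : e ∈ E) (hr : 0 < r)
    (hK : K ∈ ofType n N' 𝒜 t) (heK : e ∈ spine n N' t K)
    (hc : Close e r (δ₀ / (1000 * n₀ ^ 2) * r) E K) :
    ∃ e' ∈ E, ∃ K' ∈ ofType n N' 𝒜 t, e' ∈ spine n N' t K' ∧ dist e e' ≤ 1 / (8 * n₀) * r ∧
      Close e' (1 / (8 * n₀) * r) (δ₀ / (1000 * n₀ ^ 2) * (1 / (8 * n₀) * r)) E K' := by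
  have hn₀ := h.pair.1
  have hδ := h.pair.2.1
  have hδ1 := h.pair.2.2.1
  obtain ⟨hα1, hα, hα0, hεα⟩ := h.alpha_small
  have hα4 : 4 * (16 * n₀ ^ 2 * ε) ≤ δ₀ / (1000 * n₀ ^ 2) := by
    have := h.alpha_le
    have e1 : δ₀ / (4000 * n₀ ^ 2) = δ₀ / (1000 * n₀ ^ 2) / 4 := by field_simp; norm_num
    linarith
  set c := δ₀ / (1000 * n₀ ^ 2) with hcdef
  set α := 16 * n₀ ^ 2 * ε with hαdef
  have hcn : c * n₀ * (1000 * n₀) = δ₀ := by rw [hcdef]; field_simp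
  have hc0 : 0 < c := by positivity
  have hcn1 : 1000 * (c * n₀ * n₀) = δ₀ := by linarith
  have hcn2 : 10000 * (c * n₀) ≤ δ₀ := by nlinarith [mul_pos hc0 (by linarith : 0 < n₀)]
  have hcn3 : 100000 * c ≤ δ₀ := by nlinarith
  obtain ⟨s, rfl⟩ : ∃ s, r = 4 * n₀ * s := ⟨r / (4 * n₀), by field_simp⟩
  have hs : 0 < s := by
    by_contra! h0
    nlinarith
  have hq : 1 / (8 * n₀) * (4 * n₀ * s) = s / 2 := by field_simp; norm_num
  rw [hq]
  have hh : HighAt n N' 𝒜 E (δ₀ / 100) t e (4 * n₀ * s) :=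
    ⟨t, le_rfl, K, hK, hc.mono_radius le_rfl (mul_le_mul_of_nonneg_right (by linarith) hr.le)⟩
  obtain ⟨k, hk, W, hW, hcW⟩ := h.highAt_of_le he hr hh hs (le_of_eq (by field_simp))
  rw [← hαdef] at hcW
  have hαs : α * s * 400000 ≤ δ₀ * s := by nlinarith
  have hδs : 10 * (δ₀ * s) ≤ s := by nlinarith
  have hcs : c * (4 * n₀ * s) * 2500 ≤ δ₀ * s := by nlinarith
  have hns : 40 * s ≤ 4 * n₀ * s := by nlinarith
  have hc' : Close e s (c * (4 * n₀ * s)) E K := hc.mono_radius (by linarith) le_rfl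
  have hδs0 : 0 < δ₀ * s := by positivity
  obtain rfl : k = t := by
    by_contra hne
    exact h.not_close le_rfl hK heK (by omega : t < k) hW (by positivity : 0 < s / 2)
      (by linarith) (hc'.symm.trans hcW (by linarith) (by linarith) (by linarith))
  obtain ⟨σ, hσ⟩ : ∃ σ, s = 4 * n₀ * σ := ⟨s / (4 * n₀), by field_simp⟩
  have hσ0 : 0 < σ := by
    by_contra! h0
    nlinarith
  have hασ : α * s * 10000 ≤ δ₀ * σ := by
    have : α * n₀ * 40000 * σ ≤ δ₀ * σ := mul_le_mul_of_nonneg_right (by linarith) hσ0.le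
    rw [hσ]
    linarith
  have hcσ : c * (4 * n₀ * s) * 60 ≤ δ₀ * σ := by
    have : 1000 * (c * n₀ * n₀) * σ = δ₀ * σ := by rw [hcn1]
    have h2 : 0 < c * n₀ * n₀ * σ := by positivity
    rw [hσ]
    linarith
  have hδσ : 10 * (δ₀ * σ) ≤ σ := by nlinarith
  have hσs : 40 * σ ≤ s := by nlinarith
  have hδσ0 : 0 < δ₀ * σ := by positivity
  obtain ⟨p, hp, hpe⟩ := h.exists_mem_spine_close hW he (s := σ) (b := s / 4) hσ0 hcW hs
    (by linarith) (by linarith) (by linarith) (fun Y hY hcY =>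
      h.not_close le_rfl hK heK (Nat.lt_succ_self _) hY (by positivity : 0 < σ / 4) (by linarith)
        ((hc'.mono_radius (by linarith) le_rfl).symm.trans hcY (by linarith) (by linarith)
          (by linarith)))
  obtain ⟨e', he', hpe'⟩ := hcW.2 p (spine_subset _ _ hp) (by linarith)
  have hee : dist e e' ≤ s / 2 := by
    linarith [dist_triangle_left e e' p]
  have hmem := mem_spine_image hp (IsometryEquiv.addRight (e' - p))
  rw [IsometryEquiv.addRight_apply, add_sub_cancel] at hmem
  refine ⟨e', he', _, h.image_mem _ _ hW _, hmem, hee, ?_⟩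
  -- The new error `2 α s` is `4 α` relative to the radius `s / 2`, which is at most `c`; precision
  -- does not deteriorate under iteration.
  have htr : Close e (9 * s / 10 + s / 20) (α * s + α * s) E
      (IsometryEquiv.addRight (e' - p) '' W) :=
    hcW.translate (by rwa [← dist_eq_norm, dist_comm]) (by linarith) (by linarith) (by linarith)
  refine htr.mono ?_ ?_
  · have : dist e' e < s / 4 + α * s := by
      linarith [dist_triangle_left e' e p]
    linarith
  · nlinarith

/-- The recentred sets have spine points converging geometrically to `y`, so at arbitrarily small
scales `E` near `y` looks like a set of type `t` centred on its `t`-spine. Persistence and the gap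
then rule out every larger type. -/
lemma exists_limit (hE : IsClosed E) {t : ℕ} {e : Euc N} {K : Set (Euc N)} {r : ℝ} (he : e ∈ E)
    (hr : 0 < r) (hK : K ∈ ofType n N' 𝒜 t) (heK : e ∈ spine n N' t K)
    (hc : Close e r (δ₀ / (1000 * n₀ ^ 2) * r) E K) :
    ∃ y ∈ E, dist e y ≤ r ∧ (∃ r, 0 < r ∧ HighAt n N' 𝒜 E (δ₀ / 100) t y r) ∧
      ¬ ∃ r, 0 < r ∧ HighAt n N' 𝒜 E (δ₀ / 100) (t + 1) y r := by
  have hn₀ := h.pair.1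
  have hδ := h.pair.2.1
  have hδ1 := h.pair.2.2.1
  obtain ⟨hα1, hα, hα0, hεα⟩ := h.alpha_small
  have hc1 : δ₀ / (1000 * n₀ ^ 2) ≤ δ₀ / 1000 :=
    div_le_div_of_nonneg_left hδ.le (by norm_num) (by nlinarith)
  set q := 1 / (8 * n₀) with hqdef
  set c := δ₀ / (1000 * n₀ ^ 2) with hcdef
  set α := 16 * n₀ ^ 2 * ε with hαdef
  have hq0 : 0 < q := by positivity
  have hq1 : q ≤ 1 / 80 := div_le_div_of_nonneg_left (by norm_num) (by norm_num) (by linarith)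
  -- The states of the iteration: a point of `E`, a set of type `t` centred there, and a scale.
  let S := {p : Euc N × Set (Euc N) × ℝ // p.1 ∈ E ∧ 0 < p.2.2 ∧ p.2.1 ∈ ofType n N' 𝒜 t ∧
    p.1 ∈ spine n N' t p.2.1 ∧ Close p.1 p.2.2 (c * p.2.2) E p.2.1}
  have hstep : ∀ p : S, ∃ p' : S, p'.1.2.2 = q * p.1.2.2 ∧ dist p.1.1 p'.1.1 ≤ q * p.1.2.2 := by
    rintro ⟨⟨e, K, r⟩, he, hr, hK, heK, hc⟩
    obtain ⟨e', he', K', hK', heK', hd, hc'⟩ := h.exists_refine he hr hK heK hc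
    exact ⟨⟨⟨e', K', q * r⟩, he', by positivity, hK', heK', hc'⟩, rfl, hd⟩
  choose next hnext using hstep
  let p : ℕ → S := fun j => next^[j] ⟨⟨e, K, r⟩, he, hr, hK, heK, hc⟩
  have hp : ∀ j, p (j + 1) = next (p j) := fun j => Function.iterate_succ_apply' _ _ _
  have hscale : ∀ j, (p j).1.2.2 = r * q ^ j := by
    intro j
    induction j with
    | zero => simp [p]
    | succ j ih => rw [hp, (hnext _).1, ih, pow_succ]; ring
  have hdist : ∀ j, dist (p j).1.1 (p (j + 1)).1.1 ≤ q * r * q ^ j := by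
    intro j
    rw [hp, mul_assoc, ← hscale]
    exact (hnext _).2
  obtain ⟨y, hy⟩ := cauchySeq_tendsto_of_complete
    (cauchySeq_of_le_geometric q (q * r) (by linarith) hdist)
  have hdy : ∀ j, dist (p j).1.1 y ≤ r * q ^ j / 4 := by
    intro j
    refine (dist_le_of_le_geometric_of_tendsto q (q * r) (by linarith) hdist hy j).trans ?_
    have : 0 < r * q ^ j := by positivity
    rw [div_le_iff₀ (by linarith)]
    nlinarith
  refine ⟨y, hE.mem_of_tendsto hy (Filter.Eventually.of_forall fun j => (p j).2.1), ?_, ?_, ?_⟩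
  · have := hdy 0
    simp only [p, Function.iterate_zero, id, pow_zero, mul_one] at this
    linarith
  · have := hdy 0
    simp only [p, Function.iterate_zero, id, pow_zero, mul_one] at this
    rw [dist_comm] at this
    refine ⟨r / 2, by positivity, t, le_rfl, K, hK, hc.mono (by linarith) ?_⟩
    nlinarith
  · rintro ⟨r', hr', hh⟩
    obtain ⟨j, hj⟩ : ∃ j : ℕ, q ^ j < r' / (4 * n₀) / 2 / r :=
      exists_pow_lt_of_lt_one (by positivity) (by linarith)
    rw [lt_div_iff₀ hr] at hj
    obtain ⟨he', hr'', hK', heK', hc'⟩ := (p j).2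
    have hd := hdy j
    have hyE : y ∈ E := hE.mem_of_tendsto hy (Filter.Eventually.of_forall fun j => (p j).2.1)
    rw [hscale] at hr'' hc'
    have hs : 0 < r * q ^ j := hr''
    obtain ⟨k, hk, W, hW, hcW⟩ := h.highAt_of_le hyE hr' hh (s := 2 * (r * q ^ j))
      (by positivity) (by linarith)
    rw [← hαdef] at hcW
    generalize r * q ^ j = s at *
    have hαs : α * (2 * s) * 100 ≤ δ₀ * s := by nlinarith
    have hcs : c * s * 1000 ≤ δ₀ * s := by nlinarith
    have hδs : 10 * (δ₀ * s) ≤ s := by nlinarith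
    have hδs0 : 0 < δ₀ * s := by positivity
    exact h.not_close le_rfl hK' heK' hk hW (by positivity : 0 < s / 2) (by linarith)
      (hc'.symm.trans (hcW.mono (r' := s) (by linarith) le_rfl) (by linarith) (by linarith)
        (by linarith))

/-- Arbitrarily close to a point of `E_m` there are points around which `E` stays close to sets of
type `m + 1`. -/
lemma exists_next_stratum (hE : IsClosed E) {C₀ : ℝ} (hκ0 : 0 ≤ C₀ * ε)
    (hκ : C₀ * ε * (100000 * n₀ ^ 3) ≤ δ₀) {m : ℕ}
    (hmn : m < n) {x : Euc N} (hx : x ∈ stratum n N' 𝒜 C₀ ε E m) {η : ℝ} (hη : 0 < η) :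
    ∃ y ∈ E, dist x y < η ∧ (∃ r, 0 < r ∧ HighAt n N' 𝒜 E (δ₀ / 100) (m + 1) y r) ∧
      ¬ ∃ r, 0 < r ∧ HighAt n N' 𝒜 E (δ₀ / 100) (m + 1 + 1) y r := by
  have hn₀ := h.pair.1
  have hδ := h.pair.2.1
  have hδ1 := h.pair.2.2.1
  obtain ⟨hx, ρ, hρ, H⟩ := hx
  generalize C₀ * ε = κ at *
  obtain ⟨u, hu, huρ, huη⟩ : ∃ u, 0 < u ∧ 16 * n₀ * u < ρ ∧ 16 * n₀ * u < η := by
    refine ⟨min ρ η / (32 * n₀), by positivity, ?_, ?_⟩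
    · have : 16 * n₀ * (min ρ η / (32 * n₀)) = min ρ η / 2 := by field_simp; norm_num
      linarith [min_le_left ρ η]
    · have : 16 * n₀ * (min ρ η / (32 * n₀)) = min ρ η / 2 := by field_simp; norm_num
      linarith [min_le_right ρ η]
  have hr : 0 < 16 * n₀ * u := by positivity
  have hdev := H _ hr huρ
  simp only [typeDeviation, iInf_lt_iff] at hdev
  obtain ⟨V, ⟨hV, hxV⟩, hd⟩ := hdev
  have hc := close_of_relDist_lt hr hd
  -- The ball of radius `8 n₀ u` about `y₀` misses the `m`-spine, so `V` has a replacement of type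
  -- `m + 1` in `B(y₀, 8u)`. This ball lies inside `B(x, 16 n₀ u)`, where `V` approximates `E`.
  obtain ⟨y₀, hy₀, hyx, hmiss⟩ := exists_mem_next_spine h.le hV.2 hmn hxV
    (by positivity : 0 < 8 * n₀ * u)
  obtain ⟨K, hK, e⟩ := h.exists_eq_on_ball le_rfl hmn hV (x := y₀) (r := 8 * u) (by positivity)
    (fun p hp hpy => by
      have : p ∈ Metric.ball y₀ (8 * n₀ * u) ∩ spine n N' m V :=
        ⟨by rw [Metric.mem_ball]; linarith, hp⟩
      rw [hmiss] at this
      exact this)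
  have hyK := mem_spine_congr h.le hV.2 hK.2 hmn (Metric.mem_ball_self (by positivity)) e hy₀
  have hu10 : 10 * u ≤ n₀ * u := by nlinarith
  have hκu : 2 * (κ * (16 * n₀ * u)) ≤ δ₀ / (1000 * n₀ ^ 2) * u := by
    rw [← mul_assoc, ← mul_assoc]
    refine mul_le_mul_of_nonneg_right ?_ hu.le
    rw [le_div_iff₀ (by positivity)]
    have : 0 ≤ κ * n₀ ^ 3 := by positivity
    linarith
  have hc1 : δ₀ / (1000 * n₀ ^ 2) * u ≤ u / 10000 := by
    have : δ₀ / (1000 * n₀ ^ 2) ≤ 1 / 10000 := by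
      rw [div_le_iff₀ (by positivity)]
      nlinarith
    nlinarith
  obtain ⟨e₀, he₀, hye⟩ := hc.2 y₀ (spine_subset _ _ hy₀) (by linarith)
  have hcK : Close y₀ (7 * u) (κ * (16 * n₀ * u)) E K :=
    (hc.mono (r' := 8 * u) (by linarith) le_rfl).congr_right e (by linarith) (by linarith)
      (by linarith)
  have hmem := mem_spine_image hyK (IsometryEquiv.addRight (e₀ - y₀))
  rw [IsometryEquiv.addRight_apply, add_sub_cancel] at hmem
  have hcK' : Close e₀ u (δ₀ / (1000 * n₀ ^ 2) * u) E
      (IsometryEquiv.addRight (e₀ - y₀) '' K) := by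
    refine (hcK.translate (r' := 6 * u) (b := κ * (16 * n₀ * u))
      (by rwa [← dist_eq_norm, dist_comm]) (by linarith) (by linarith) (by linarith)).mono ?_ ?_
    · rw [dist_comm]
      linarith
    · linarith
  obtain ⟨y, hy, hey, h1, h2⟩ := h.exists_limit hE he₀ hu (h.image_mem _ _ hK _) hmem hcK'
  refine ⟨y, hy, ?_, h1, h2⟩
  have := dist_triangle x y₀ y
  have := dist_triangle y₀ e₀ y
  rw [dist_comm y₀ x] at hyx
  linarith

/-- Type at least `0` is always available, so the union over `t ≤ m` is exactly the set of points of
`E ∩ B(0, 2)` where type at least `m + 1` fails at every scale; by openness of `HighAt`, the failure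
passes to limits. -/
lemma isClosed_iUnion_stratum (hE : IsClosed E) {C₀ : ℝ} (hκ : C₀ * ε ≤ δ₀ / 100)
    (hκ' : 10000 * n₀ ^ 3 * ε < δ₀ * (C₀ * ε)) (m : ℕ) :
    IsClosed ((⋃ t ≤ m, stratum n N' 𝒜 C₀ ε E t) ∩ Metric.closedBall 0 1.989) := by
  have hU : ∀ x, x ∈ (⋃ t ≤ m, stratum n N' 𝒜 C₀ ε E t) ↔ x ∈ E ∩ Metric.ball 0 2 ∧
      ¬ ∃ r, 0 < r ∧ HighAt n N' 𝒜 E (δ₀ / 100) (m + 1) x r := by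
    intro x
    simp only [Set.mem_iUnion, h.mem_stratum_iff hκ hκ', exists_prop]
    constructor
    · rintro ⟨t, ht, ⟨hx, -⟩, hno⟩
      refine ⟨hx, fun ⟨r, hr, hh⟩ => hno ⟨r, hr, hh.mono hr.le le_rfl (by omega)⟩⟩
    · rintro ⟨hx, hno⟩
      obtain ⟨t, ht, h1, h2⟩ : ∃ t ≤ m, (∃ r, 0 < r ∧ HighAt n N' 𝒜 E (δ₀ / 100) t x r) ∧
          ¬ ∃ r, 0 < r ∧ HighAt n N' 𝒜 E (δ₀ / 100) (t + 1) x r := by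
        by_contra! hall
        have : ∀ t ≤ m + 1, ∃ r, 0 < r ∧ HighAt n N' 𝒜 E (δ₀ / 100) t x r := by
          intro t
          induction t with
          | zero => exact fun _ => ⟨1, one_pos, h.highAt_zero hx.1 one_pos⟩
          | succ t ih => exact fun ht => hall t (by omega) (ih (by omega))
        exact hno (this _ le_rfl)
      exact ⟨t, ht, ⟨hx, h1⟩, h2⟩
  refine isClosed_of_closure_subset fun x hx => ?_
  have hxE : x ∈ E := hE.closure_subset_iff.2 (fun y hy => ((hU y).1 hy.1).1.1) hx
  have hxb : x ∈ Metric.closedBall (0 : Euc N) 1.989 :=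
    Metric.isClosed_closedBall.closure_subset_iff.2 (fun y hy => hy.2) hx
  refine ⟨(hU x).2 ⟨⟨hxE, Metric.closedBall_subset_ball (by norm_num) hxb⟩, ?_⟩, hxb⟩
  rintro ⟨r, hr, hh⟩
  obtain ⟨s, hs, hall⟩ := h.exists_highAt_of_dist hxE hr hh
  obtain ⟨y, hy, hxy⟩ := Metric.mem_closure_iff.1 hx s hs
  exact ((hU y).1 hy.1).2 ⟨s, hs, hall y (by rwa [dist_comm])⟩

lemma stratum_subset_closure (hE : IsClosed E) {C₀ : ℝ} (hκ0 : 0 ≤ C₀ * ε)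
    (hκ : C₀ * ε * (100000 * n₀ ^ 3) ≤ δ₀) (hκ' : 10000 * n₀ ^ 3 * ε < δ₀ * (C₀ * ε)) {m : ℕ}
    (hmn : m < n) : stratum n N' 𝒜 C₀ ε E m ∩ Metric.closedBall 0 1.988 ⊆
      closure (stratum n N' 𝒜 C₀ ε E (m + 1)) := by
  rintro x ⟨hx, hxb⟩
  refine Metric.mem_closure_iff.2 fun η hη => ?_
  -- The margin `1 / 100` keeps `y` inside `B(0, 2)`, as `1.988 + 0.01 < 2`.
  obtain ⟨y, hy, hxy, h1, h2⟩ := h.exists_next_stratum hE hκ0 hκ hmn hx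
    (by positivity : 0 < min η (1 / 100))
  have hn₀ := h.pair.1
  have hκ2 : C₀ * ε ≤ δ₀ / 100 := by
    have : 1 ≤ n₀ ^ 3 := one_le_pow₀ (by linarith)
    nlinarith
  refine ⟨y, (h.mem_stratum_iff hκ2 hκ').2 ⟨⟨⟨hy, ?_⟩, h1⟩, h2⟩,
    hxy.trans_le (min_le_left _ _)⟩
  rw [Metric.mem_closedBall] at hxb
  rw [Metric.mem_ball]
  have := hxy.trans_le (min_le_right _ _)
  have := dist_triangle_left y 0 x
  linarith

end IsTame

end Strata

end ConeStrata
-- The two assertions and the choice of `ε₀`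
theorem mainTheorem6 (n N' N : ℕ) (hn : 0 < n) (hN' : n < N') (hN : N' + n ≤ N)
    (ℬ : Set (Set (ConeStrata.Euc N)))
    (hℬ : ∀ W ∈ ℬ, ∃ m ≤ n, ConeStrata.IsTypeSet n N' m W)
    (hfin : (Quotient.mk (ConeStrata.isometricSetoid N) '' ℬ).Finite) :
    (∃ n₀ δ₀ : ℝ, ConeStrata.IsConstantPair n N' (ConeStrata.blowUps ℬ) n₀ δ₀) ∧
    ∀ n₀ δ₀ : ℝ, ConeStrata.IsConstantPair n N' (ConeStrata.blowUps ℬ) n₀ δ₀ →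
      ∃ ε₀ : ℝ, 0 < ε₀ ∧
        ∀ ε : ℝ, ε < ε₀ → ∀ E : Set (ConeStrata.Euc N), IsClosed E → 0 ∈ E →
          ConeStrata.IsApproximable (ConeStrata.blowUps ℬ) ε E →
          (∀ m ≤ n, IsClosed ((⋃ t ≤ m,
              ConeStrata.stratum n N' (ConeStrata.blowUps ℬ)
                (ConeStrata.stratumConst n n₀ δ₀) ε E t) ∩ Metric.closedBall 0 1.989)) ∧
          (∀ m < n,
            ConeStrata.stratum n N' (ConeStrata.blowUps ℬ)
                (ConeStrata.stratumConst n n₀ δ₀) ε E m ∩ Metric.closedBall 0 1.988 ⊆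
              closure (ConeStrata.stratum n N' (ConeStrata.blowUps ℬ)
                (ConeStrata.stratumConst n n₀ δ₀) ε E (m + 1))) := by
  refine ⟨ConeStrata.exists_isConstantPair hn hN' hN hℬ hfin, fun n₀ δ₀ hp => ?_⟩
  have hn₀ := hp.1
  have hδ := hp.2.1
  -- Since `n ≥ 1`, the exponent `3 n` is at least `3`; only this consequence of the size of `C₀` is
  -- needed.
  have hC : 10 ^ 8 * n₀ ^ 4 / δ₀ ≤ ConeStrata.stratumConst n n₀ δ₀ := by
    have h3 : n₀ ^ 3 ≤ (n₀ + n) ^ (3 * n) :=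
      calc n₀ ^ 3 ≤ (n₀ + n) ^ 3 := pow_le_pow_left₀ (by linarith) (by simp) 3
        _ ≤ (n₀ + n) ^ (3 * n) :=
          pow_le_pow_right₀ (by linarith [Nat.cast_nonneg (α := ℝ) n]) (by omega)
    calc 10 ^ 8 * n₀ ^ 4 / δ₀ = 10 ^ 8 * n₀ ^ 3 * (n₀ / δ₀) := by ring
      _ ≤ _ := by rw [ConeStrata.stratumConst]; gcongr
  set C₀ := ConeStrata.stratumConst n n₀ δ₀
  have hC0 : 0 < C₀ := lt_of_lt_of_le (by positivity) hC
  refine ⟨δ₀ / (100000 * n₀ ^ 3 * C₀), by positivity, fun ε hε E hE h0 hap => ?_⟩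
  -- A nonpositive `ε` is excluded by the approximation hypothesis at the origin.
  have hε0 : 0 < ε := by
    obtain ⟨Z, -, -, hZ⟩ := hap 0 h0 1 one_pos
    exact ENNReal.ofReal_pos.1 (pos_of_gt hZ)
  have hκ : C₀ * ε * (100000 * n₀ ^ 3) ≤ δ₀ := by
    rw [lt_div_iff₀ (by positivity)] at hε
    linarith
  have hCδ : 10 ^ 8 * n₀ ^ 4 * ε ≤ δ₀ * (C₀ * ε) := by
    rw [div_le_iff₀ hδ] at hC
    linarith [mul_le_mul_of_nonneg_right hC hε0.le]
  have hn3 : 1 ≤ n₀ ^ 3 := one_le_pow₀ (by linarith)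
  have hpos : 0 < C₀ * ε := by positivity
  have hκ2 : C₀ * ε ≤ δ₀ / 100 := by nlinarith
  have hκ' : 10000 * n₀ ^ 3 * ε < δ₀ * (C₀ * ε) := by
    have : 0 < n₀ ^ 3 * ε := by positivity
    have : n₀ ^ 3 * ε * 10 ≤ n₀ ^ 4 * ε := by
      rw [pow_succ n₀ 3]
      nlinarith
    linarith
  have hT : ConeStrata.IsTame n N' (ConeStrata.blowUps ℬ) n₀ δ₀ ε E := by
    refine ⟨hN, hp, fun m W hW R => ConeStrata.image_mem_ofType hW R, hε0, ?_, ?_⟩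
    · have : δ₀ * (C₀ * ε) ≤ δ₀ := by nlinarith [hp.2.2.1]
      have : 0 < n₀ ^ 4 * ε := by positivity
      linarith
    · intro x hx r hr
      obtain ⟨Z, hZ, -, hd⟩ := hap x hx r hr
      obtain ⟨j, -, hj⟩ := ConeStrata.exists_isTypeSet_of_mem_blowUps hN hℬ hZ
      exact ⟨j, Z, ⟨hZ, hj⟩, ConeStrata.close_of_relDist_lt hr hd⟩
  exact ⟨fun m _ => hT.isClosed_iUnion_stratum hE hκ2 hκ' m,
    fun m hm => hT.stratum_subset_closure hE hpos.le hκ hκ' hm⟩
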